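/- Let $d\ge 1$, $1\le p\le\infty$, $\frac1p+\frac1{p'}=1$, $q=\max(p,p')$, $\alpha\ge 0$, and $\langle x\rangle=(1+\|x\|^2)^{1/2}$ with the Euclidean norm. For $\beta\in\mathbb R$, let $L_{p,\beta}(\mathbb R^d)$ be the space of measurable $f:\mathbb R^d\to\mathbb C$ with $\|f\|_{L_{p,\beta}}=\|\langle\cdot\rangle^{\beta}f\|_{L_p}<\infty$, let $\ell_{p,\beta}(\mathbb Z^d)$ be the space of sequences $c$ with $(\langle k\rangle^{\beta}c[k])_k\in\ell_p(\mathbb Z^d)$, and let $W_{q,\alpha}(\mathbb R^d)$ be the space of measurable $f$ for which $x\mapsto\sum_{k\in\mathbb Z^d}\langle x+k\rangle^{\alpha}|f(x+k)|$ lies in $L_q([0,1]^d)$. For $h>0$ put $$V_{p,-\alpha,h}(\varphi)=\Big\{\sum_{k\in\mathbb Z^d}c[k]\,\varphi\big(\tfrac{\cdot}{h}-k\big):c\in\ell_{p,-\alpha}(\mathbb Z^d)\Big\},$$ where series are understood to converge absolutely almost everywhere, and write $V_2(\varphi)=V_{2,0,1}(\varphi)$. Suppose that $\varphi\in W_{q,\alpha}(\mathbb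 R^d)$ and that $\{\varphi(\cdot-k)\}_{k\in\mathbb Z^d}$ is a Riesz basis for $V_2(\varphi)$, i.e. $\varphi\in L_2(\mathbb R^d)$ and there are $A,B>0$ with $A\|c\|_{\ell_2}\le\|\sum_k c[k]\varphi(\cdot-k)\|_{L_2}\le B\|c\|_{\ell_2}$ for all $c\in\ell_2(\mathbb Z^d)$. Then there is a dual kernel $\varphi_{\rm d}\in L_2(\mathbb R^d)$ with $$\widehat{\varphi_{\rm d}}(\omega)=\frac{\hat\varphi(\omega)}{\sum_{k\in\mathbb Z^d}|\hat\varphi(\omega+2\pi k)|^2},\qquad \hat f(\omega)=\int_{\mathbb R^d}f(x)e^{-\mathrm i\langle\omega,x\rangle}\,dx ,$$ and for every $h>0$ the following hold. 1. For every $c\in\ell_{p,-\alpha}(\mathbb Z^d)$ the series $\sum_k c[k]\varphi(\frac{\cdot}{h}-k)$ converges absolutely almost everywhere, and $V_{p,-\alpha,h}(\varphi)$ is a closed linear subspace of $L_{p,-\alpha}(\mathbb R^d)$. 2. The formula $$P_{\varphi,h}f=\sum_{k\in\mathbb Z^d}c[k]\,\varphi\big(\tfrac{\cdot}{h}-k\big),\qquad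 c[k]=\frac1{h^d}\int_{\mathbb R^d}f(y)\,\overline{\varphi_{\rm d}\big(\tfrac yh-k\big)}\,dy,$$ in which the integrals converge absolutely, and the series converges absolutely almost everywhere, defines a bounded linear operator on $L_{p,-\alpha}(\mathbb R^d)$ that is a projector onto $V_{p,-\alpha,h}(\varphi)$: it maps $L_{p,-\alpha}(\mathbb R^d)$ into $V_{p,-\alpha,h}(\varphi)$ and is the identity on $V_{p,-\alpha,h}(\varphi)$. Moreover, for the given $p$, there is a constant $C$, depending on $\varphi$ and $\alpha$ but not on $h$ or $f$, such that $$\|P_{\varphi,h}f\|_{L_{p,-\alpha}}\le C\,\|f\|_{L_{p,-\alpha}}\qquad\text{for all }f\in L_{p,-\alpha}(\mathbb R^d)\text{ and all }h\in(0,1).$$ -/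

import Mathlib

open MeasureTheory Set
open scoped ENNReal FourierTransform ComplexConjugate

noncomputable section

namespace WeightedShiftInvariant

/-- The Euclidean space `ℝᵈ`. -/
abbrev Euc (d : ℕ) : Type := EuclideanSpace ℝ (Fin d)

/-- The multi-integer `k ∈ ℤᵈ`, seen as a point of `ℝᵈ`. -/
def latticePoint {d : ℕ} (k : Fin d → ℤ) : Euc d := WithLp.toLp 2 fun i => (k i : ℝ)

/-- The Sobolev weight `⟨x⟩ ^ α = (1 + ‖x‖²) ^ (α / 2)`. -/
def weight {d : ℕ} (α : ℝ) (x : Euc d) : ℝ := (1 + ‖x‖ ^ 2) ^ (α / 2)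

lemma weight_pos {d : ℕ} (α : ℝ) (x : Euc d) : 0 < weight α x :=
  Real.rpow_pos_of_pos (by positivity) _

/-- The weighted space `L_{p,α}(ℝᵈ)`: all (classes of) measurable `f` with `⟨·⟩^α f ∈ L_p(ℝᵈ)`. -/
def WeightedLp (d : ℕ) (p : ℝ≥0∞) (α : ℝ) : Submodule ℂ (Euc d →ₘ[volume] ℂ) where
  carrier := {f | MemLp (fun x => (weight α x : ℂ) * f x) p volume}
  zero_mem' := by
    have h : (fun x : Euc d => (weight α x : ℂ) * (0 : Euc d →ₘ[volume] ℂ) x) =ᵐ[volume] 0 := by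
      filter_upwards [AEEqFun.coeFn_zero (α := Euc d) (β := ℂ) (μ := volume)] with x hx
      simp [hx]
    exact (memLp_congr_ae h).2 MemLp.zero
  add_mem' := by
    intro f g hf hg
    have h : (fun x : Euc d => (weight α x : ℂ) * (f + g) x) =ᵐ[volume]
        (fun x => (weight α x : ℂ) * f x) + fun x => (weight α x : ℂ) * g x := by
      filter_upwards [AEEqFun.coeFn_add f g] with x hx
      simp [hx, mul_add]
    exact (memLp_congr_ae h).2 (MemLp.add hf hg)
  smul_mem' := by
    intro a f hf
    have h : (fun x : Euc d => (weight α x : ℂ) * (a • f) x) =ᵐ[volume]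
        a • fun x => (weight α x : ℂ) * f x := by
      filter_upwards [AEEqFun.coeFn_smul a f] with x hx
      simp [hx, mul_left_comm]
    exact (memLp_congr_ae h).2 (MemLp.const_smul hf a)

lemma WeightedLp.memLp {d : ℕ} {p : ℝ≥0∞} {α : ℝ} (f : WeightedLp d p α) :
    MemLp (fun x => (weight α x : ℂ) * f.1 x) p volume := f.2

/-- Multiplication by the weight, `f ↦ ⟨·⟩^α f`, from `L_{p,α}` into `L_p`. -/
def WeightedLp.mulWeight (d : ℕ) (p : ℝ≥0∞) (α : ℝ) :
    WeightedLp d p α →+ Lp ℂ p (volume : Measure (Euc d)) where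
  toFun f := (WeightedLp.memLp f).toLp
  map_zero' := by
    refine (Lp.eq_zero_iff_ae_eq_zero).2 ?_
    filter_upwards [(WeightedLp.memLp (0 : WeightedLp d p α)).coeFn_toLp,
      AEEqFun.coeFn_zero (α := Euc d) (β := ℂ) (μ := volume)] with x hx h0
    rw [hx]
    simp [h0]
  map_add' f g := by
    rw [← MemLp.toLp_add]
    refine MemLp.toLp_congr _ _ ?_
    filter_upwards [AEEqFun.coeFn_add f.1 g.1] with x hx
    have h : (f + g).1 x = f.1 x + g.1 x := hx
    simp only [Pi.add_apply]
    rw [h, mul_add]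

lemma WeightedLp.mulWeight_smul {d : ℕ} {p : ℝ≥0∞} {α : ℝ} (a : ℂ) (f : WeightedLp d p α) :
    WeightedLp.mulWeight d p α (a • f) = a • WeightedLp.mulWeight d p α f := by
  change (WeightedLp.memLp (a • f)).toLp = a • (WeightedLp.memLp f).toLp
  rw [← MemLp.toLp_const_smul]
  refine MemLp.toLp_congr _ _ ?_
  filter_upwards [AEEqFun.coeFn_smul a f.1] with x hx
  have h : (a • f).1 x = a * f.1 x := hx
  simp only [Pi.smul_apply, smul_eq_mul]
  rw [h]
  ring

lemma WeightedLp.mulWeight_injective (d : ℕ) (p : ℝ≥0∞) (α : ℝ) :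
    Function.Injective (WeightedLp.mulWeight d p α) := by
  intro f g hfg
  have h := (MemLp.toLp_eq_toLp_iff (WeightedLp.memLp f) (WeightedLp.memLp g)).1 hfg
  refine Subtype.ext (AEEqFun.ext ?_)
  filter_upwards [h] with x hx
  exact mul_left_cancel₀ (by exact_mod_cast (weight_pos α x).ne') hx

/-- The norm `‖f‖_{L_{p,α}} = ‖⟨·⟩^α f‖_{L_p}`. -/
instance WeightedLp.instNormedAddCommGroup (d : ℕ) (p : ℝ≥0∞) [Fact (1 ≤ p)] (α : ℝ) :
    NormedAddCommGroup (WeightedLp d p α) :=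
  NormedAddCommGroup.induced _ _ (WeightedLp.mulWeight d p α)
    (WeightedLp.mulWeight_injective d p α)

instance WeightedLp.instNormedSpace (d : ℕ) (p : ℝ≥0∞) [Fact (1 ≤ p)] (α : ℝ) :
    NormedSpace ℂ (WeightedLp d p α) where
  norm_smul_le a f := by
    change ‖WeightedLp.mulWeight d p α (a • f)‖ ≤ ‖a‖ * ‖WeightedLp.mulWeight d p α f‖
    rw [WeightedLp.mulWeight_smul, norm_smul]

/-- `c ∈ ℓ_{p,α}(ℤᵈ)`. -/
def MemWeightedSeq {d : ℕ} (p : ℝ≥0∞) (α : ℝ) (c : (Fin d → ℤ) → ℂ) : Prop :=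
  Memℓp (fun k => (weight α (latticePoint k) : ℂ) * c k) p

/-- The hybrid norm `‖f‖_{W_{q,α}}`, i.e. the `L_q([0,1]ᵈ)` norm (an essential supremum if `q = ∞`)
of `x ↦ ∑ₖ ⟨x + k⟩^α |f (x + k)|`. -/
def hybridNorm {d : ℕ} (q : ℝ≥0∞) (α : ℝ) (f : Euc d → ℂ) : ℝ≥0∞ :=
  eLpNorm (fun x => ∑' k : Fin d → ℤ,
      ‖(weight α (x + latticePoint k) : ℂ) * f (x + latticePoint k)‖ₑ) q
    (volume.restrict {x : Euc d | ∀ i, x i ∈ Icc (0 : ℝ) 1})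

/-- `f ∈ W_{q,α}(ℝᵈ)`. -/
def MemHybrid {d : ℕ} (q : ℝ≥0∞) (α : ℝ) (f : Euc d → ℂ) : Prop :=
  AEStronglyMeasurable f volume ∧ hybridNorm q α f < ∞

/-- The `k`-th term `c[k] φ(x / h - k)` of the expansion with coefficients `c`. -/
def shiftTerm {d : ℕ} (φ : Euc d → ℂ) (h : ℝ) (c : (Fin d → ℤ) → ℂ) (x : Euc d)
    (k : Fin d → ℤ) : ℂ :=
  c k * φ (h⁻¹ • x - latticePoint k)

/-- The shift-invariant space `V_{p,α,h}(φ)`: all (classes of) functions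
`f = ∑ₖ c[k] φ(· / h - k)`, the series converging absolutely almost everywhere,
with `c ∈ ℓ_{p,α}(ℤᵈ)`. -/
def shiftInvariantSpace {d : ℕ} (φ : Euc d → ℂ) (p : ℝ≥0∞) (α h : ℝ) :
    Submodule ℂ (Euc d →ₘ[volume] ℂ) where
  carrier := {f | ∃ c : (Fin d → ℤ) → ℂ, MemWeightedSeq p α c ∧
    ∀ᵐ x, HasSum (shiftTerm φ h c x) (f x)}
  zero_mem' := by
    refine ⟨0, ?_, ?_⟩
    · have h0 : (fun k : Fin d → ℤ => (weight α (latticePoint k) : ℂ) *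
          (0 : (Fin d → ℤ) → ℂ) k) = 0 := by
        ext k; simp
      unfold MemWeightedSeq
      rw [h0]
      exact zero_memℓp
    · filter_upwards [AEEqFun.coeFn_zero (α := Euc d) (β := ℂ) (μ := volume)] with x hx
      have h0 : shiftTerm φ h 0 x = fun _ => 0 := by
        ext k; simp [shiftTerm]
      rw [hx, h0]
      exact hasSum_zero
  add_mem' := by
    rintro f g ⟨c, hc, hf⟩ ⟨b, hb, hg⟩
    refine ⟨c + b, ?_, ?_⟩
    · have h0 : (fun k : Fin d → ℤ => (weight α (latticePoint k) : ℂ) * (c + b) k) =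
          (fun k => (weight α (latticePoint k) : ℂ) * c k) +
            fun k => (weight α (latticePoint k) : ℂ) * b k := by
        ext k; simp [mul_add]
      unfold MemWeightedSeq
      rw [h0]
      exact Memℓp.add hc hb
    · filter_upwards [AEEqFun.coeFn_add f g, hf, hg] with x hx hfx hgx
      have h0 : shiftTerm φ h (c + b) x = fun k => shiftTerm φ h c x k + shiftTerm φ h b x k := by
        ext k; simp [shiftTerm, add_mul]
      rw [hx, h0]
      exact hfx.add hgx
  smul_mem' := by
    rintro a f ⟨c, hc, hf⟩
    refine ⟨a • c, ?_, ?_⟩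
    · have h0 : (fun k : Fin d → ℤ => (weight α (latticePoint k) : ℂ) * (a • c) k) =
          a • fun k => (weight α (latticePoint k) : ℂ) * c k := by
        ext k; simp [mul_left_comm]
      unfold MemWeightedSeq
      rw [h0]
      exact Memℓp.const_smul hc a
    · filter_upwards [AEEqFun.coeFn_smul a f, hf] with x hx hfx
      have h0 : shiftTerm φ h (a • c) x = fun k => a • shiftTerm φ h c x k := by
        ext k; simp [shiftTerm, mul_assoc]
      rw [hx, h0]
      exact hfx.const_smul a

/-- `{φ(· - k)}` is a Riesz basis for `V₂(φ) = {∑ₖ c[k] φ(· - k) : c ∈ ℓ₂}`: the synthesis map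
`c ↦ ∑ₖ c[k] φ(· - k)`, which is onto `V₂(φ)` by the definition of `V₂(φ)`, is bounded and bounded
below from `ℓ₂(ℤᵈ)` to `L₂(ℝᵈ)`. -/
def IsRieszBasisOfShifts {d : ℕ} (φ : Euc d → ℂ) : Prop :=
  MemLp φ 2 volume ∧ ∃ A B : ℝ, 0 < A ∧ 0 < B ∧
    ∀ c : lp (fun _ : Fin d → ℤ => ℂ) 2,
      (∀ᵐ x, Summable (shiftTerm φ 1 c x)) ∧
      ENNReal.ofReal (A * ‖c‖) ≤ eLpNorm (fun x => ∑' k, shiftTerm φ 1 c x k) 2 volume ∧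
      eLpNorm (fun x => ∑' k, shiftTerm φ 1 c x k) 2 volume ≤ ENNReal.ofReal (B * ‖c‖)

open Classical in
/-- The Fourier transform `∫ f(x) e^{-2πi⟨x,ξ⟩} dx` of `f ∈ L₂(ℝᵈ)`, in the sense of Plancherel
(and `0` if `f ∉ L₂`). -/
def fourierL2 {d : ℕ} (f : Euc d → ℂ) : Euc d → ℂ :=
  if hf : MemLp f 2 volume then (𝓕 (hf.toLp f) : Lp ℂ 2 (volume : Measure (Euc d))) else 0

open Classical in
/-- The inverse of `fourierL2` (and `0` if `f ∉ L₂`). -/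
def fourierInvL2 {d : ℕ} (f : Euc d → ℂ) : Euc d → ℂ :=
  if hf : MemLp f 2 volume then (𝓕⁻ (hf.toLp f) : Lp ℂ 2 (volume : Measure (Euc d))) else 0

/-- The function `φ̂(ξ) / ∑ₖ |φ̂(ξ + k)|²`. Frequencies are ordinary ones, `ξ = ω / 2π`, so that
shifts of the angular frequency `ω` by `2πk` become shifts of `ξ` by `k`. -/
def dualSymbol {d : ℕ} (φ : Euc d → ℂ) (ξ : Euc d) : ℂ :=
  fourierL2 φ ξ / ((∑' k : Fin d → ℤ, ‖fourierL2 φ (ξ + latticePoint k)‖ ^ 2 : ℝ) : ℂ)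

/-- The dual kernel of `φ`, the function in `L₂(ℝᵈ)` with Fourier transform `dualSymbol φ`. -/
def dualKernel {d : ℕ} (φ : Euc d → ℂ) : Euc d → ℂ := fourierInvL2 (dualSymbol φ)

/-- The integrand `f(y) * conj (φ_d(y / h - k))` of the scalar product
`⟨f, φ_d(· / h - k)⟩`, with `φ_d` the dual kernel of `φ`. -/
def coeffIntegrand {d : ℕ} (φ : Euc d → ℂ) (h : ℝ) (f : Euc d → ℂ) (k : Fin d → ℤ)
    (y : Euc d) : ℂ :=
  f y * conj (dualKernel φ (h⁻¹ • y - latticePoint k))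

/-- The coefficient `c[k] = h⁻ᵈ ⟨f, φ_d(· / h - k)⟩`. -/
def projCoeff {d : ℕ} (φ : Euc d → ℂ) (h : ℝ) (f : Euc d → ℂ) (k : Fin d → ℤ) : ℂ :=
  ((h ^ d)⁻¹ : ℝ) * ∫ y, coeffIntegrand φ h f k y

end WeightedShiftInvariant

end

/-! ### Moderate weights, the unit cube and periodization. -/

namespace WeightedShiftInvariant

variable {d : ℕ}

/-! Everything rests on one kernel `ψ = ∑ b[k] φ(· - k)` which inherits the weighted hybrid bounds
of `φ`, has shifts biorthogonal to those of `φ`, and agrees almost everywhere with the dual kernel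
(`exists_isDualPair`).

Here `b` is the convolution inverse of the autocorrelation `a[k] = ⟨φ, φ(· - k)⟩`. Since `q ≥ 2`,
`φ` has a finite hybrid norm with exponent `2`, and this puts `a` in `ℓ_{1,α}`. The Riesz bounds say
that convolution with `a` on `ℓ_2` is a positive operator between `A²` and `B²`, so `u = δ - B⁻² a`
acts on `ℓ_2` as a strict contraction. That `b` lies in `ℓ_{1,α}` is Wiener's lemma for a weight of
polynomial growth (`exists_convolution_inverse`). Its proof avoids Gelfand theory: truncate `u` to a
finitely supported `v`; the power `v^j` lives on the `j`-fold sumset of the support, whose total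
weight is polynomial in `j`, while its coefficients are bounded by the `ℓ_2` operator norm of `v^j`,
which decays geometrically. Hence a power of `u` is a contraction on the weighted `ℓ_1`, and `δ - u`
is invertible there.

By Parseval, biorthogonality says that the periodization of `φ̂ · conj ψ̂` has the Fourier
coefficients of the constant `1`. Since `ψ̂` is a periodic symbol times `φ̂`, that symbol must be `1
/ ∑ |φ̂(· + k)|²` (`dualSymbol_ae_eq`).

Boundedness comes from two Young-type inequalities, for synthesis with `φ` (exponent `p`) and for
analysis with `ψ` (exponent `p'`). After rescaling to `h = 1` the weight becomes `⟨h ·⟩^{-α}`, which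
is moderate with constant `2^{α/2} max(1, h)^α`; this does not depend on `h` in `(0, 1)`, and the
Jacobian factors cancel. Biorthogonality makes the coefficients of an expansion recoverable, so the
operator is a projector, and its range is closed as the fixed-point set of a continuous map. -/

lemma latticePoint_add (k l : Fin d → ℤ) :
    latticePoint (k + l) = latticePoint k + latticePoint l := by
  ext i; simp [latticePoint]

lemma latticePoint_neg (k : Fin d → ℤ) : latticePoint (-k) = -latticePoint k := by
  ext i; simp [latticePoint]

lemma latticePoint_sub (k l : Fin d → ℤ) :
    latticePoint (k - l) = latticePoint k - latticePoint l := by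
  ext i; simp [latticePoint]

lemma latticePoint_zero : latticePoint (0 : Fin d → ℤ) = 0 := by
  ext i; simp [latticePoint]

lemma latticePoint_apply (k : Fin d → ℤ) (i : Fin d) : latticePoint k i = k i := rfl

lemma weight_neg_apply (α : ℝ) (x : Euc d) : weight α (-x) = weight α x := by
  simp [weight]

lemma weight_neg_exponent (α : ℝ) (x : Euc d) : weight (-α) x = (weight α x)⁻¹ := by
  rw [weight, weight, neg_div, Real.rpow_neg (by positivity)]

lemma one_le_weight {α : ℝ} (hα : 0 ≤ α) (x : Euc d) : 1 ≤ weight α x :=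
  Real.one_le_rpow (by nlinarith [sq_nonneg ‖x‖]) (by positivity)

lemma continuous_weight (α : ℝ) : Continuous (weight (d := d) α) := by
  unfold weight
  exact Continuous.rpow_const (by fun_prop) fun x => Or.inl (by positivity)

/-- Peetre's inequality. -/
lemma weight_add_le {α : ℝ} (hα : 0 ≤ α) (x y : Euc d) :
    weight α (x + y) ≤ 2 ^ (α / 2) * weight α x * weight α y := by
  unfold weight
  rw [← Real.mul_rpow (by positivity) (by positivity),
    ← Real.mul_rpow (by positivity) (by positivity)]
  refine Real.rpow_le_rpow (by positivity) ?_ (by positivity)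
  have h := norm_add_le x y
  nlinarith [norm_nonneg x, norm_nonneg y, norm_nonneg (x + y), sq_nonneg (‖x‖ - ‖y‖),
    mul_nonneg (sq_nonneg ‖x‖) (sq_nonneg ‖y‖), mul_self_le_mul_self (norm_nonneg _) h]

/-- Dilation multiplies `1 + ‖x‖²` by at most `max 1 |h| ^ 2`. There is no loss when `|h| ≤ 1`,
which is where uniformity over `h ∈ (0, 1)` originates. -/
lemma weight_smul_le {α : ℝ} (hα : 0 ≤ α) (h : ℝ) (x : Euc d) :
    weight α (h • x) ≤ (max 1 |h|) ^ α * weight α x := by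
  unfold weight
  have h1 : (max 1 |h|) ^ α = ((max 1 |h|) ^ 2) ^ (α / 2) := by
    rw [← Real.rpow_natCast, ← Real.rpow_mul (by positivity)]
    congr 1; push_cast; ring
  rw [h1, ← Real.mul_rpow (by positivity) (by positivity)]
  refine Real.rpow_le_rpow (by positivity) ?_ (by positivity)
  rw [norm_smul, Real.norm_eq_abs, mul_pow, mul_add, mul_one]
  have h2 : (1 : ℝ) ≤ max 1 |h| := le_max_left _ _
  have h3 : |h| ≤ max 1 |h| := le_max_right _ _
  have : |h| ^ 2 ≤ (max 1 |h|) ^ 2 := pow_le_pow_left₀ (abs_nonneg _) h3 2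
  have : 1 ≤ (max 1 |h|) ^ 2 := one_le_pow₀ h2
  nlinarith [sq_nonneg ‖x‖]

/-- The constant of moderateness of the dilated weight. -/
noncomputable def moderateConst (α h : ℝ) : ℝ := 2 ^ (α / 2) * (max 1 |h|) ^ α

lemma moderateConst_pos (α h : ℝ) : 0 < moderateConst α h := by
  have : (0 : ℝ) < max 1 |h| := lt_of_lt_of_le one_pos (le_max_left _ _)
  unfold moderateConst
  positivity

/-- Peetre's inequality for `h x = h (x + y) + h (-y)`, read for reciprocals. Only the factor in `y`
is freed of its dilation, so the kernel can later carry the undilated weight. -/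
lemma weight_smul_add_le {α : ℝ} (hα : 0 ≤ α) (h : ℝ) (x y : Euc d) :
    weight (-α) (h • (x + y)) ≤ moderateConst α h * weight (-α) (h • x) * weight α y := by
  rw [weight_neg_exponent, weight_neg_exponent]
  have h1 : weight α (h • x) ≤ moderateConst α h * weight α (h • (x + y)) * weight α y := by
    have h2 := weight_add_le hα (h • (x + y)) (h • (-y))
    rw [← smul_add, add_neg_cancel_right] at h2
    have h3 := weight_smul_le hα h (-y)
    rw [weight_neg_apply] at h3
    refine h2.trans ?_
    have hw := weight_pos α (h • (x + y))
    have : (0 : ℝ) < 2 ^ (α / 2) := by positivity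
    calc _ ≤ 2 ^ (α / 2) * weight α (h • (x + y)) * ((max 1 |h|) ^ α * weight α y) := by gcongr
      _ = _ := by unfold moderateConst; ring
  have ha := weight_pos α (h • x)
  have hb := weight_pos α (h • (x + y))
  rw [inv_eq_one_div, div_le_iff₀ hb]
  calc 1 = (weight α (h • x))⁻¹ * weight α (h • x) := by field_simp
    _ ≤ (weight α (h • x))⁻¹ * (moderateConst α h * weight α (h • (x + y)) * weight α y) := by
      gcongr
    _ = _ := by ring

/-- The half-open unit cube. -/
def unitCube (d : ℕ) : Set (Euc d) := {x | ∀ i, x i ∈ Ioc (0 : ℝ) 1}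

lemma measurableSet_unitCube : MeasurableSet (unitCube d) := by
  have : unitCube d = ⋂ i, (fun x : Euc d => x i) ⁻¹' Ioc 0 1 := by
    ext x; simp [unitCube]
  rw [this]
  refine MeasurableSet.iInter fun i => measurableSet_Ioc.preimage (by fun_prop)

lemma unitCube_subset : unitCube d ⊆ {x : Euc d | ∀ i, x i ∈ Icc (0 : ℝ) 1} :=
  fun _ hx i => Ioc_subset_Icc_self (hx i)

lemma volume_unitCube_lt_top : volume (unitCube d) < ∞ := by
  refine Bornology.IsBounded.measure_lt_top ?_
  refine (Metric.isBounded_closedBall (x := (0 : Euc d)) (r := Real.sqrt d)).subset fun x hx => ?_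
  rw [mem_closedBall_zero_iff, EuclideanSpace.norm_eq]
  refine Real.sqrt_le_sqrt ?_
  calc ∑ i, ‖x i‖ ^ 2 ≤ ∑ _i : Fin d, (1 : ℝ) := by
        refine Finset.sum_le_sum fun i _ => ?_
        have := hx i
        rw [Real.norm_eq_abs, abs_of_pos this.1]
        exact pow_le_one₀ this.1.le this.2
    _ = d := by simp

instance : IsFiniteMeasure (volume.restrict (unitCube d)) :=
  ⟨by rw [Measure.restrict_apply_univ]; exact volume_unitCube_lt_top⟩

/-- Half-open intervals make the integer translates of the cube tile space exactly, so that no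
boundary null sets enter the unfolding arguments. -/
lemma existsUnique_add_latticePoint_mem (x : Euc d) :
    ∃! k : Fin d → ℤ, x + latticePoint k ∈ unitCube d := by
  have h := fun i => existsUnique_add_zsmul_mem_Ioc (one_pos : (0 : ℝ) < 1) (x i) 0
  choose k hk hu using h
  refine ⟨k, fun i => ?_, fun l hl => funext fun i => hu i (l i) ?_⟩
  · simpa [latticePoint] using hk i
  · simpa [latticePoint] using hl i

/-- Periodization of a nonnegative function. -/
noncomputable def periodize (g : Euc d → ℝ≥0∞) (x : Euc d) : ℝ≥0∞ :=
  ∑' k : Fin d → ℤ, g (x + latticePoint k)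

lemma periodize_add (g : Euc d → ℝ≥0∞) (x : Euc d) (k : Fin d → ℤ) :
    periodize g (x + latticePoint k) = periodize g x := by
  unfold periodize
  rw [← (Equiv.addLeft k).tsum_eq fun l => g (x + latticePoint l)]
  simp [latticePoint_add, add_assoc]

lemma periodize_sub (g : Euc d → ℝ≥0∞) (x : Euc d) (k : Fin d → ℤ) :
    periodize g (x - latticePoint k) = periodize g x := by
  rw [sub_eq_add_neg, ← latticePoint_neg, periodize_add]

lemma tsum_sub_eq_periodize (g : Euc d → ℝ≥0∞) (x : Euc d) :
    ∑' k : Fin d → ℤ, g (x - latticePoint k) = periodize g x := by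
  unfold periodize
  rw [← (Equiv.neg (Fin d → ℤ)).tsum_eq]
  simp [latticePoint_neg]

lemma aemeasurable_comp_add {β : Type*} [MeasurableSpace β] {g : Euc d → β}
    (hg : AEMeasurable g) (v : Euc d) : AEMeasurable fun x => g (x + v) :=
  hg.comp_quasiMeasurePreserving (measurePreserving_add_right volume v).quasiMeasurePreserving

lemma aemeasurable_comp_sub {β : Type*} [MeasurableSpace β] {g : Euc d → β}
    (hg : AEMeasurable g) (v : Euc d) : AEMeasurable fun x => g (x - v) := by
  simpa [sub_eq_add_neg] using aemeasurable_comp_add hg (-v)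

lemma aemeasurable_periodize {g : Euc d → ℝ≥0∞} (hg : AEMeasurable g) :
    AEMeasurable (periodize g) :=
  AEMeasurable.tsum fun _ => aemeasurable_comp_add hg _

lemma lintegral_unitCube_tsum {g : Euc d → ℝ≥0∞} (hg : AEMeasurable g) :
    ∫⁻ x in unitCube d, periodize g x = ∫⁻ x, g x := by
  unfold periodize
  rw [lintegral_tsum fun k => (aemeasurable_comp_add hg _).restrict]
  have hU : (⋃ k : Fin d → ℤ, (fun x : Euc d => x + latticePoint k) ⁻¹' unitCube d) = univ := by
    refine eq_univ_of_forall fun x => mem_iUnion.2 ?_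
    exact (existsUnique_add_latticePoint_mem x).exists
  have hm : ∀ k : Fin d → ℤ,
      MeasurableSet ((fun x : Euc d => x + latticePoint k) ⁻¹' unitCube d) :=
    fun k => measurableSet_unitCube.preimage (by fun_prop)
  conv_rhs => rw [← setLIntegral_univ, ← hU, lintegral_iUnion hm (fun k l hkl => by
    refine disjoint_left.2 fun x hx hx' => hkl ?_
    exact (existsUnique_add_latticePoint_mem x).unique hx hx')]
  -- The cell moved into the cube by adding `k` contributes `g (x - k)` there, hence the change of
  -- sign in the index.
  rw [← (Equiv.neg (Fin d → ℤ)).tsum_eq]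
  refine tsum_congr fun k => ?_
  have := (measurePreserving_add_right volume (latticePoint k)).setLIntegral_comp_preimage_emb
    (measurableEmbedding_addRight _) (fun x => g (x + latticePoint (-k))) (unitCube d)
  rw [Equiv.neg_apply, ← this]
  simp [latticePoint_neg]

/-- Unfolding: a periodic factor comes out of the sum over the lattice. -/
lemma lintegral_mul_periodic {g G : Euc d → ℝ≥0∞} (hg : AEMeasurable g) (hG : AEMeasurable G)
    (hper : ∀ x (k : Fin d → ℤ), G (x + latticePoint k) = G x) :
    ∫⁻ x, g x * G x = ∫⁻ x in unitCube d, periodize g x * G x := by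
  rw [show ∫⁻ x, g x * G x = ∫⁻ x, (g * G) x from rfl, ← lintegral_unitCube_tsum (hg.mul hG)]
  refine lintegral_congr fun x => ?_
  simp only [periodize, Pi.mul_apply, hper]
  rw [ENNReal.tsum_mul_right]

end WeightedShiftInvariant

/-! ### Young-type inequalities between sequences on the lattice and functions. -/

namespace WeightedShiftInvariant

variable {d : ℕ}

/-- Only countably many translates of the cube are needed, so their exceptional sets unite to a null
set. -/
lemma ae_of_ae_unitCube {P : Euc d → Prop} (h : ∀ᵐ x ∂volume.restrict (unitCube d), P x)
    (hper : ∀ x (k : Fin d → ℤ), P (x + latticePoint k) → P x) : ∀ᵐ x, P x := by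
  rw [ae_restrict_iff' measurableSet_unitCube] at h
  have h2 : ∀ᵐ x : Euc d, ∀ k : Fin d → ℤ,
      x + latticePoint k ∈ unitCube d → P (x + latticePoint k) :=
    ae_all_iff.2 fun k =>
      (measurePreserving_add_right volume (latticePoint k)).quasiMeasurePreserving.ae h
  filter_upwards [h2] with x hx
  obtain ⟨k, hk⟩ := (existsUnique_add_latticePoint_mem x).exists
  exact hper x k (hx k hk)

lemma lintegral_sub_mul_periodic {g G : Euc d → ℝ≥0∞} (hg : AEMeasurable g) (hG : AEMeasurable G)
    (hper : ∀ x (k : Fin d → ℤ), G (x + latticePoint k) = G x) (k : Fin d → ℤ) :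
    ∫⁻ x, g (x - latticePoint k) * G x = ∫⁻ x in unitCube d, periodize g x * G x := by
  rw [← lintegral_mul_periodic hg hG hper,
    ← lintegral_sub_right_eq_self (fun x => g x * G x) (latticePoint k)]
  refine lintegral_congr fun x => ?_
  rw [← hper (x - latticePoint k) k, sub_add_cancel]

/-- Jensen's inequality for the `r`-th power against the unnormalized measure `w`; the missing
normalization leaves the total mass to the power `r - 1`. -/
lemma tsum_mul_rpow_le {ι : Type*} {r : ℝ} (hr : 1 ≤ r) (w f : ι → ℝ≥0∞) :
    (∑' i, w i * f i) ^ r ≤ (∑' i, w i) ^ (r - 1) * ∑' i, w i * f i ^ r := by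
  have hr0 : 0 < r := by linarith
  have h : ∑' i, w i * f i ≤ (∑' i, w i) ^ (1 - r⁻¹) * (∑' i, w i * f i ^ r) ^ r⁻¹ := by
    rw [ENNReal.tsum_eq_iSup_sum]
    refine iSup_le fun s => (ENNReal.inner_le_weight_mul_Lp_of_nonneg s hr w f).trans ?_
    have : 0 ≤ 1 - r⁻¹ := sub_nonneg.2 (inv_le_one_of_one_le₀ hr)
    gcongr <;> exact ENNReal.sum_le_tsum _
  calc _ ≤ ((∑' i, w i) ^ (1 - r⁻¹) * (∑' i, w i * f i ^ r) ^ r⁻¹) ^ r := by gcongr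
    _ = _ := by
      rw [ENNReal.mul_rpow_of_nonneg _ _ hr0.le, ← ENNReal.rpow_mul, ← ENNReal.rpow_mul,
        inv_mul_cancel₀ hr0.ne', ENNReal.rpow_one]
      congr 2
      field_simp

lemma le_eLpNorm_top_count {ι : Type*} [MeasurableSpace ι] [MeasurableSingletonClass ι]
    (c : ι → ℝ≥0∞) (k : ι) :
    c k ≤ eLpNorm c ∞ Measure.count := by
  rw [eLpNorm_exponent_top]
  have h := enorm_ae_le_eLpNormEssSup c Measure.count
  rw [Measure.ae_count_iff] at h
  simpa using h k

lemma periodize_ae_le {g : Euc d → ℝ≥0∞} :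
    ∀ᵐ x, periodize g x ≤ eLpNorm (periodize g) ∞ (volume.restrict (unitCube d)) := by
  refine ae_of_ae_unitCube ?_ fun x k h => by rwa [periodize_add] at h
  rw [eLpNorm_exponent_top]
  simpa using enorm_ae_le_eLpNormEssSup (periodize g) (volume.restrict (unitCube d))

/-- Young-type inequality for semi-discrete convolutions. -/
lemma eLpNorm_semidiscrete_conv_le {g : Euc d → ℝ≥0∞} (hg : AEMeasurable g) {p : ℝ≥0∞}
    (hp : 1 ≤ p) (c : (Fin d → ℤ) → ℝ≥0∞) :
    eLpNorm (fun x => ∑' k, g (x - latticePoint k) * c k) p volume ≤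
      eLpNorm (periodize g) p (volume.restrict (unitCube d)) * eLpNorm c p Measure.count := by
  rcases eq_or_ne p ∞ with rfl | hpt
  · rw [eLpNorm_exponent_top (f := fun x => _)]
    refine eLpNormEssSup_le_of_ae_enorm_bound ?_
    filter_upwards [periodize_ae_le (g := g)] with x hx
    rw [enorm_eq_self]
    calc _ ≤ ∑' k, g (x - latticePoint k) * eLpNorm c ∞ Measure.count := by
          gcongr with k
          exact le_eLpNorm_top_count c k
      _ = periodize g x * eLpNorm c ∞ Measure.count := by
          rw [ENNReal.tsum_mul_right, tsum_sub_eq_periodize]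
      _ ≤ _ := by gcongr
  have hp0 : p ≠ 0 := (zero_lt_one.trans_le hp).ne'
  have hr : 1 ≤ p.toReal := by
    simpa using ENNReal.toReal_mono hpt hp
  rw [eLpNorm_eq_lintegral_rpow_enorm_toReal hp0 hpt, eLpNorm_eq_lintegral_rpow_enorm_toReal hp0 hpt,
    eLpNorm_eq_lintegral_rpow_enorm_toReal hp0 hpt,
    ← ENNReal.mul_rpow_of_nonneg _ _ (by positivity)]
  generalize p.toReal = r at hr
  refine ENNReal.rpow_le_rpow ?_ (by positivity)
  simp only [enorm_eq_self, lintegral_count]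
  have hP := aemeasurable_periodize hg
  -- Jensen is applied with the weights `g (x - k)`, whose sum is the periodization. The remaining
  -- factor `periodize g ^ (r - 1)` is periodic, so every shift of `g` integrates against it to the
  -- same number, independent of `k`.
  calc ∫⁻ x, (∑' k, g (x - latticePoint k) * c k) ^ r
      ≤ ∫⁻ x, ∑' k, c k ^ r * (g (x - latticePoint k) * periodize g x ^ (r - 1)) := by
        refine lintegral_mono fun x => (tsum_mul_rpow_le hr _ _).trans_eq ?_
        rw [tsum_sub_eq_periodize, ← ENNReal.tsum_mul_left]
        refine tsum_congr fun k => by ring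
    _ = ∑' k, c k ^ r * ∫⁻ x, g (x - latticePoint k) * periodize g x ^ (r - 1) := by
        have hm : ∀ k : Fin d → ℤ,
            AEMeasurable fun x => g (x - latticePoint k) * periodize g x ^ (r - 1) :=
          fun k => (aemeasurable_comp_sub hg _).mul (hP.pow_const _)
        rw [lintegral_tsum fun k => (hm k).const_mul _]
        exact tsum_congr fun k => lintegral_const_mul'' _ (hm k)
    _ = ∑' k, c k ^ r * ∫⁻ x in unitCube d, periodize g x ^ r := by
        refine tsum_congr fun k => ?_
        rw [lintegral_sub_mul_periodic hg (hP.pow_const _) fun x k => by rw [periodize_add]]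
        congr 2 with x
        conv_rhs => rw [show r = 1 + (r - 1) by ring,
          ENNReal.rpow_add_of_nonneg _ _ zero_le_one (by linarith), ENNReal.rpow_one]
    _ = _ := by rw [ENNReal.tsum_mul_right, mul_comm]

/-- The adjoint inequality to `eLpNorm_semidiscrete_conv_le`. -/
lemma eLpNorm_lintegral_shift_mul_le {g f : Euc d → ℝ≥0∞} (hg : AEMeasurable g)
    (hf : AEMeasurable f) {p p' : ℝ≥0∞} (hpp' : p⁻¹ + p'⁻¹ = 1)
    (hfin : eLpNorm (periodize g) p' (volume.restrict (unitCube d)) ≠ ∞) :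
    eLpNorm (fun k => ∫⁻ x, g (x - latticePoint k) * f x) p Measure.count ≤
      eLpNorm (periodize g) p' (volume.restrict (unitCube d)) * eLpNorm f p volume := by
  have hP := aemeasurable_periodize hg
  have hgk : ∀ k : Fin d → ℤ, AEMeasurable fun x => g (x - latticePoint k) :=
    fun k => aemeasurable_comp_sub hg _
  rcases eq_or_ne p ∞ with rfl | hpt
  · obtain rfl : p' = 1 := by simpa using hpp'
    rw [eLpNorm_exponent_top]
    refine eLpNormEssSup_le_of_ae_enorm_bound (Filter.Eventually.of_forall fun k => ?_)
    rw [enorm_eq_self]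
    calc _ ≤ ∫⁻ x, g (x - latticePoint k) * eLpNorm f ∞ volume := by
          refine lintegral_mono_ae ?_
          filter_upwards [enorm_ae_le_eLpNormEssSup f volume] with x hx
          gcongr
          rwa [enorm_eq_self, ← eLpNorm_exponent_top] at hx
      _ = _ := by
          rw [lintegral_mul_const'' _ (hgk k), lintegral_sub_right_eq_self g,
            ← lintegral_unitCube_tsum hg, eLpNorm_one_eq_lintegral_enorm]
          simp
  rcases eq_or_ne p 1 with rfl | hp1
  · obtain rfl : p' = ∞ := by
      have : (1 : ℝ≥0∞) + p'⁻¹ = 1 + 0 := by simpa using hpp'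
      simpa using (ENNReal.add_right_inj ENNReal.one_ne_top).1 this
    rw [eLpNorm_one_eq_lintegral_enorm, eLpNorm_one_eq_lintegral_enorm]
    simp only [enorm_eq_self, lintegral_count]
    rw [← lintegral_tsum (f := fun k x => g (x - latticePoint k) * f x) fun k => (hgk k).mul hf,
      ← lintegral_const_mul'' _ hf]
    refine lintegral_mono_ae ?_
    filter_upwards [periodize_ae_le (g := g)] with x hx
    rw [ENNReal.tsum_mul_right, tsum_sub_eq_periodize]
    gcongr
  have hp1' : 1 < p := lt_of_le_of_ne (by
    rw [← ENNReal.inv_le_one, ← hpp']; exact le_self_add) hp1.symm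
  have hp0 : p ≠ 0 := (zero_lt_one.trans hp1').ne'
  have hp'0 : p' ≠ 0 := by rintro rfl; simp at hpp'
  have hp't : p' ≠ ∞ := by rintro rfl; simp at hpp'; exact hp1 hpp'
  have hpq : p.toReal.HolderConjugate p'.toReal := by
    rw [Real.holderConjugate_iff]
    refine ⟨by simpa using (ENNReal.toReal_lt_toReal ENNReal.one_ne_top hpt).2 hp1', ?_⟩
    rw [← ENNReal.toReal_inv, ← ENNReal.toReal_inv, ← ENNReal.toReal_add (by simpa) (by simpa),
      hpp', ENNReal.toReal_one]
  -- Finiteness of the periodization is what allows dividing by it below.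
  have hPfin : ∀ᵐ x, periodize g x < ∞ := by
    refine ae_of_ae_unitCube ?_ fun x k h => by rwa [periodize_add] at h
    rw [eLpNorm_eq_lintegral_rpow_enorm_toReal hp'0 hp't] at hfin
    have h1 : ∫⁻ x in unitCube d, ‖periodize g x‖ₑ ^ p'.toReal ≠ ∞ := fun h => hfin (by
      rw [h]; exact ENNReal.top_rpow_of_pos (by simpa using hpq.symm.pos))
    filter_upwards [ae_lt_top' (hP.restrict.enorm.pow_const _) h1] with x hx
    simpa [ENNReal.rpow_lt_top_iff_of_pos hpq.symm.pos] using hx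
  rw [eLpNorm_eq_lintegral_rpow_enorm_toReal hp0 hpt,
    eLpNorm_eq_lintegral_rpow_enorm_toReal hp'0 hp't,
    eLpNorm_eq_lintegral_rpow_enorm_toReal hp0 hpt]
  simp only [enorm_eq_self, lintegral_count]
  generalize p.toReal = r at hpq
  generalize p'.toReal = s at hpq
  have hr := hpq.pos
  have hs := hpq.symm.pos
  have hrs : 1 + s / r = s := by
    have := hpq.inv_add_inv_eq_one
    field_simp at this ⊢
    linarith
  set M := ∫⁻ x in unitCube d, periodize g x ^ s with hM
  -- Hölder with `P = periodize g` and the splitting `g f = (f g^{1/r} P^{-1/r}) (g^{1/s} P^{1/r})`.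
  -- Since `1 + s / r = s`, the second factor integrates to `M` for every `k`; in the first,
  -- summation over `k` gives `∑ g(x - k) / P ≤ 1` and leaves `∫ f^r`.
  have key : ∀ k : Fin d → ℤ, (∫⁻ x, g (x - latticePoint k) * f x) ^ r ≤
      M ^ (r / s) * ∫⁻ x, g (x - latticePoint k) * ((periodize g x)⁻¹ * f x ^ r) := by
    intro k
    have h1 := ENNReal.lintegral_mul_le_Lp_mul_Lq volume hpq
      (f := fun x => f x * (g (x - latticePoint k)) ^ (1 / r) * (periodize g x)⁻¹ ^ (1 / r))
      (g := fun x => (g (x - latticePoint k)) ^ (1 / s) * periodize g x ^ (1 / r))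
      ((hf.mul ((hgk k).pow_const _)).mul (hP.inv.pow_const _))
      (((hgk k).pow_const _).mul (hP.pow_const _))
    have h2 : ∫⁻ x, g (x - latticePoint k) * f x ≤ ∫⁻ x,
        ((fun x => f x * (g (x - latticePoint k)) ^ (1 / r) * (periodize g x)⁻¹ ^ (1 / r)) *
        fun x => (g (x - latticePoint k)) ^ (1 / s) * periodize g x ^ (1 / r)) x := by
      refine lintegral_mono_ae ?_
      filter_upwards [hPfin] with x hx
      simp only [Pi.mul_apply]
      rcases eq_or_ne (periodize g x) 0 with h0 | h0
      · have : g (x - latticePoint k) = 0 := by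
          rw [← tsum_sub_eq_periodize, ENNReal.tsum_eq_zero] at h0
          exact h0 k
        simp [this]
      · refine le_of_eq ?_
        have e1 : (periodize g x)⁻¹ ^ (1 / r) * periodize g x ^ (1 / r) = 1 := by
          rw [← ENNReal.mul_rpow_of_nonneg _ _ (by positivity), ENNReal.inv_mul_cancel h0 hx.ne,
            ENNReal.one_rpow]
        have e2 : g (x - latticePoint k) ^ (1 / r) * g (x - latticePoint k) ^ (1 / s) =
            g (x - latticePoint k) := by
          rw [← ENNReal.rpow_add_of_nonneg _ _ (by positivity) (by positivity), one_div, one_div,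
            hpq.inv_add_inv_eq_one, ENNReal.rpow_one]
        calc _ = f x * (g (x - latticePoint k) ^ (1 / r) * g (x - latticePoint k) ^ (1 / s)) *
              ((periodize g x)⁻¹ ^ (1 / r) * periodize g x ^ (1 / r)) := by
              rw [e1, e2]; ring
          _ = _ := by ring
    have h3 : ∫⁻ x, ((g (x - latticePoint k)) ^ (1 / s) * periodize g x ^ (1 / r)) ^ s = M := by
      rw [hM, ← show ∫⁻ x in unitCube d, periodize g x * periodize g x ^ (s / r) =
        ∫⁻ x in unitCube d, periodize g x ^ s from ?_, ← lintegral_sub_mul_periodic hg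
        (hP.pow_const _) (fun x k => by rw [periodize_add]) k]
      · refine lintegral_congr fun x => ?_
        rw [ENNReal.mul_rpow_of_nonneg _ _ hs.le, ← ENNReal.rpow_mul, ← ENNReal.rpow_mul,
          one_div_mul_cancel hs.ne', ENNReal.rpow_one]
        congr 2; ring
      · refine lintegral_congr fun x => ?_
        conv_rhs => rw [← hrs, ENNReal.rpow_add_of_nonneg _ _ zero_le_one (by positivity),
          ENNReal.rpow_one]
    have h4 : ∀ x, (f x * (g (x - latticePoint k)) ^ (1 / r) * (periodize g x)⁻¹ ^ (1 / r)) ^ r =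
        g (x - latticePoint k) * ((periodize g x)⁻¹ * f x ^ r) := fun x => by
      rw [ENNReal.mul_rpow_of_nonneg _ _ hr.le, ENNReal.mul_rpow_of_nonneg _ _ hr.le,
        ← ENNReal.rpow_mul, ← ENNReal.rpow_mul, one_div_mul_cancel hr.ne', ENNReal.rpow_one,
        ENNReal.rpow_one]
      ring
    rw [h3] at h1
    simp only [h4] at h1
    calc _ ≤ ((∫⁻ x, g (x - latticePoint k) * ((periodize g x)⁻¹ * f x ^ r)) ^ (1 / r) *
          M ^ (1 / s)) ^ r := by
          gcongr
          exact h2.trans h1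
      _ = _ := by
          rw [ENNReal.mul_rpow_of_nonneg _ _ hr.le, ← ENNReal.rpow_mul, ← ENNReal.rpow_mul,
            one_div_mul_cancel hr.ne', ENNReal.rpow_one, mul_comm]
          congr 2; ring
  calc (∑' k : Fin d → ℤ, (∫⁻ x, g (x - latticePoint k) * f x) ^ r) ^ (1 / r)
      ≤ (∑' k : Fin d → ℤ, M ^ (r / s) *
        ∫⁻ x, g (x - latticePoint k) * ((periodize g x)⁻¹ * f x ^ r)) ^ (1 / r) := by
        gcongr with k
        exact key k
    _ ≤ (M ^ (r / s) * ∫⁻ x, f x ^ r) ^ (1 / r) := by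
        rw [ENNReal.tsum_mul_left,
          ← lintegral_tsum (f := fun k x => g (x - latticePoint k) *
            ((periodize g x)⁻¹ * f x ^ r)) fun k => (hgk k).mul (hP.inv.mul (hf.pow_const _))]
        gcongr with x
        rw [ENNReal.tsum_mul_right, tsum_sub_eq_periodize, ← mul_assoc]
        calc _ ≤ 1 * f x ^ r := by gcongr; exact ENNReal.mul_inv_le_one _
          _ = _ := one_mul _
    _ = _ := by
        rw [ENNReal.mul_rpow_of_nonneg _ _ (by positivity), ← ENNReal.rpow_mul]
        congr 2
        field_simp

end WeightedShiftInvariant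

/-! ### Convolution operators on weighted `ℓ_p` over an abelian group. -/

namespace WeightedShiftInvariant

/-- A weight `ω` on a group, bounded below by `1`, which is submultiplicative up to a constant. -/
structure ModerateWeight {G : Type*} [AddCommGroup G] (ω : G → ℝ) (K : ℝ) : Prop where
  one_le : ∀ k, 1 ≤ ω k
  one_le_const : 1 ≤ K
  add_le : ∀ k l, ω (k + l) ≤ K * ω k * ω l

namespace ModerateWeight

variable {G : Type*} [AddCommGroup G] {ω : G → ℝ} {K : ℝ}

lemma pos (hω : ModerateWeight ω K) (k : G) : 0 < ω k := zero_lt_one.trans_le (hω.one_le k)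

lemma one : ModerateWeight (fun _ : G => (1 : ℝ)) 1 := ⟨by simp, le_rfl, by simp⟩

/-- The quotient is the factor a shift by `k` acquires when weighted sequences are stored as `ω`
times the sequence; its bound is the norm bound for `shiftOp`. -/
lemma div_le (hω : ModerateWeight ω K) (n k : G) : ω n / ω (n - k) ≤ K * ω k := by
  rw [div_le_iff₀ (hω.pos _)]
  calc ω n = ω (k + (n - k)) := by congr 1; abel
    _ ≤ _ := hω.add_le _ _

variable {p : ℝ≥0∞}

lemma norm_shift_rpow_le (hω : ModerateWeight ω K) (k : G) (c : G → ℂ) (n : G) :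
    ‖((ω n / ω (n - k) : ℝ) : ℂ) * c (n - k)‖ ^ p.toReal ≤
      (K * ω k) ^ p.toReal * ‖c (n - k)‖ ^ p.toReal := by
  have h1 := hω.pos n
  have h2 := hω.pos (n - k)
  have h3 := hω.div_le n k
  rw [norm_mul, Complex.norm_real, Real.norm_of_nonneg (by positivity),
    Real.mul_rpow (by positivity) (norm_nonneg _)]
  gcongr

variable [Fact (1 ≤ p)]

lemma toReal_pos (hp : p ≠ ∞) : 0 < p.toReal :=
  ENNReal.toReal_pos (zero_lt_one.trans_le Fact.out).ne' hp

lemma summable_shift (hp : p ≠ ∞) (k : G) (c : lp (fun _ : G => ℂ) p) (C : ℝ) :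
    Summable fun n => C * ‖c (n - k)‖ ^ p.toReal :=
  (((Equiv.subRight k).summable_iff (f := fun n => ‖c n‖ ^ p.toReal)).2
    ((lp.memℓp c).summable (toReal_pos hp))).mul_left _

lemma memlp_shift (hω : ModerateWeight ω K) (hp : p ≠ ∞) (k : G) (c : lp (fun _ : G => ℂ) p) :
    Memℓp (fun n => ((ω n / ω (n - k) : ℝ) : ℂ) * c (n - k)) p :=
  memℓp_gen (Summable.of_nonneg_of_le (fun _ => by positivity)
    (hω.norm_shift_rpow_le k c) (summable_shift hp k c _))

/-- The shift by `k` on `ℓ_p` weighted by `ω`, transported to the unweighted `ℓ_p`. -/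
noncomputable def shiftOp (hω : ModerateWeight ω K) (hp : p ≠ ∞) (k : G) :
    lp (fun _ : G => ℂ) p →L[ℂ] lp (fun _ : G => ℂ) p :=
  LinearMap.mkContinuous
    { toFun := fun c => ⟨_, hω.memlp_shift hp k c⟩
      map_add' := fun c e => by ext n; exact mul_add _ _ _
      map_smul' := fun a c => by ext n; exact mul_left_comm _ _ _ } (K * ω k) (by
    intro c
    have hK : 0 ≤ K * ω k := mul_nonneg (zero_le_one.trans hω.one_le_const) (hω.pos k).le
    refine lp.norm_le_of_tsum_le (toReal_pos hp) (by positivity) ?_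
    have hs := (hω.memlp_shift hp k c).summable (toReal_pos hp)
    calc ∑' n, ‖((ω n / ω (n - k) : ℝ) : ℂ) * c (n - k)‖ ^ p.toReal
        ≤ ∑' n, (K * ω k) ^ p.toReal * ‖c (n - k)‖ ^ p.toReal :=
          hs.tsum_le_tsum (hω.norm_shift_rpow_le k c) (summable_shift hp k c _)
      _ = (K * ω k * ‖c‖) ^ p.toReal := by
          have h : ∑' n, ‖c (n - k)‖ ^ p.toReal = ∑' n, ‖c n‖ ^ p.toReal :=
            (Equiv.subRight k).tsum_eq (fun n => ‖c n‖ ^ p.toReal)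
          rw [Real.mul_rpow hK (norm_nonneg _), lp.norm_rpow_eq_tsum (toReal_pos hp), ← h]
          exact tsum_mul_left)

lemma shiftOp_apply (hω : ModerateWeight ω K) (hp : p ≠ ∞) (k : G)
    (c : lp (fun _ : G => ℂ) p) (n : G) :
    hω.shiftOp hp k c n = ((ω n / ω (n - k) : ℝ) : ℂ) * c (n - k) := rfl

lemma norm_shiftOp_le (hω : ModerateWeight ω K) (hp : p ≠ ∞) (k : G) :
    ‖hω.shiftOp hp k‖ ≤ K * ω k :=
  LinearMap.mkContinuous_norm_le _
    (mul_nonneg (zero_le_one.trans hω.one_le_const) (hω.pos k).le) _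

/-- The shifts form a representation of `G`. -/
noncomputable def shiftHom (hω : ModerateWeight ω K) (hp : p ≠ ∞) :
    Multiplicative G →* (lp (fun _ : G => ℂ) p →L[ℂ] lp (fun _ : G => ℂ) p) where
  toFun k := hω.shiftOp hp k.toAdd
  map_one' := by
    ext c n
    simp [shiftOp_apply, (hω.pos n).ne']
  map_mul' k l := by
    ext c n
    have h1 : (ω (n - k.toAdd) : ℂ) ≠ 0 := by exact_mod_cast (hω.pos _).ne'
    rw [mul_apply_eq_comp, shiftOp_apply, shiftOp_apply, shiftOp_apply, toAdd_mul,
      ← sub_sub, ← mul_assoc]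
    congr 1
    push_cast
    field_simp

/-- Convolution with `a` as an operator. -/
noncomputable def convOp (hω : ModerateWeight ω K) (hp : p ≠ ∞) (a : G → ℂ) :
    lp (fun _ : G => ℂ) p →L[ℂ] lp (fun _ : G => ℂ) p :=
  ∑' k, a k • hω.shiftOp hp k

lemma norm_smul_shiftOp_le (hω : ModerateWeight ω K) (hp : p ≠ ∞) (a : G → ℂ) (k : G) :
    ‖a k • hω.shiftOp hp k‖ ≤ K * (ω k * ‖a k‖) := by
  rw [norm_smul]
  calc _ ≤ ‖a k‖ * (K * ω k) := by gcongr; exact hω.norm_shiftOp_le hp k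
    _ = _ := by ring

lemma summable_smul_shiftOp (hω : ModerateWeight ω K) (hp : p ≠ ∞) {a : G → ℂ}
    (ha : Summable fun k => ω k * ‖a k‖) : Summable fun k => a k • hω.shiftOp hp k :=
  Summable.of_norm_bounded (ha.mul_left K) (hω.norm_smul_shiftOp_le hp a)

lemma hasSum_convOp_apply (hω : ModerateWeight ω K) (hp : p ≠ ∞) {a : G → ℂ}
    (ha : Summable fun k => ω k * ‖a k‖) (c : lp (fun _ : G => ℂ) p) (n : G) :
    HasSum (fun k => a k * (((ω n / ω (n - k) : ℝ) : ℂ) * c (n - k))) (hω.convOp hp a c n) := by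
  have h := (hω.summable_smul_shiftOp hp ha).hasSum
  exact (h.mapL (ContinuousLinearMap.apply ℂ _ c)).mapL (lp.evalCLM ℂ (fun _ : G => ℂ) p n)

/-- Writes `1 - t a` as convolution with a single sequence, so that hypotheses on `ℓ_2` and
conclusions on the weighted `ℓ_1` concern the same object. -/
lemma convOp_sub_smul [DecidableEq G] (hω : ModerateWeight ω K) (hp : p ≠ ∞) {a : G → ℂ}
    (ha : Summable fun k => ω k * ‖a k‖) (t : ℂ) :
    hω.convOp hp (fun k => Pi.single (M := fun _ => ℂ) 0 1 k - t * a k) =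
      1 - t • hω.convOp hp a := by
  have h := (hω.summable_smul_shiftOp hp ha).hasSum.const_smul t
  have h0 : HasSum (fun k => (Pi.single (M := fun _ => ℂ) (0 : G) (1 : ℂ) k) • hω.shiftOp hp k)
      (1 : lp (fun _ : G => ℂ) p →L[ℂ] lp (fun _ : G => ℂ) p) := by
    convert hasSum_single (0 : G) ?_ using 1
    · rw [Pi.single_eq_same, one_smul]
      exact (hω.shiftHom hp).map_one.symm
    · intro k hk
      simp [hk]
  have h1 := (h0.sub h).tsum_eq
  rw [convOp, convOp, ← h1]
  refine tsum_congr fun k => ?_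
  rw [sub_smul, mul_smul]

/-- The action of the group algebra. -/
noncomputable def algHom (hω : ModerateWeight ω K) (hp : p ≠ ∞) :
    AddMonoidAlgebra ℂ G →ₐ[ℂ] (lp (fun _ : G => ℂ) p →L[ℂ] lp (fun _ : G => ℂ) p) :=
  AddMonoidAlgebra.lift ℂ _ G (hω.shiftHom hp)

lemma algHom_apply (hω : ModerateWeight ω K) (hp : p ≠ ∞) (v : AddMonoidAlgebra ℂ G) :
    hω.algHom hp v = ∑ k ∈ v.coeff.support, v.coeff k • hω.shiftOp hp k :=
  AddMonoidAlgebra.lift_apply _ _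

variable [DecidableEq G]

/-- Convolving with the unit mass at `0` recovers the coefficients, which are therefore bounded by
the operator norm on any unweighted `ℓ_p`. -/
lemma algHom_one_single (v : AddMonoidAlgebra ℂ G) (hp : p ≠ ∞) (k : G) :
    (one (G := G)).algHom hp v (lp.single p 0 1) k = v.coeff k := by
  rw [algHom_apply, sum_apply, lp.coeFn_sum, Finset.sum_apply]
  simp only [smul_apply, lp.coeFn_smul, Pi.smul_apply, shiftOp_apply,
    smul_eq_mul, div_one, Complex.ofReal_one, one_mul, lp.single_apply]
  rw [Finset.sum_eq_single k]
  · simp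
  · intro l _ hl
    rw [Pi.single_eq_of_ne (sub_ne_zero.2 hl.symm), mul_zero]
  · intro hk
    simp [Finsupp.notMem_support_iff.1 hk]

/-- The bridge from `ℓ_2` to the weighted `ℓ_1`: each coefficient is at most the unweighted operator
norm, and the passage costs only the total weight of the support. -/
lemma norm_algHom_le (hω : ModerateWeight ω K) (hp : p ≠ ∞) (v : AddMonoidAlgebra ℂ G)
    (F : Finset G) (hF : v.coeff.support ⊆ F) {q : ℝ≥0∞} [Fact (1 ≤ q)] (hq : q ≠ ∞) :
    ‖hω.algHom hp v‖ ≤ K * (∑ k ∈ F, ω k) * ‖(one (G := G)).algHom hq v‖ := by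
  have hv : ∀ k, ‖v.coeff k‖ ≤ ‖(one (G := G)).algHom hq v‖ := fun k => by
    have hq0 : q ≠ 0 := (zero_lt_one.trans_le Fact.out).ne'
    rw [← algHom_one_single v hq k]
    refine (lp.norm_apply_le_norm hq0 _ k).trans ?_
    refine (ContinuousLinearMap.le_opNorm _ _).trans_eq ?_
    rw [lp.norm_single (pos_iff_ne_zero.2 hq0), norm_one, mul_one]
  have hK := hω.one_le_const
  rw [algHom_apply]
  refine (norm_sum_le _ _).trans ?_
  calc ∑ k ∈ v.coeff.support, ‖v.coeff k • hω.shiftOp hp k‖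
      ≤ ∑ k ∈ F, ‖v.coeff k • hω.shiftOp hp k‖ :=
        Finset.sum_le_sum_of_subset_of_nonneg hF fun _ _ _ => norm_nonneg _
    _ ≤ ∑ k ∈ F, K * ω k * ‖(one (G := G)).algHom hq v‖ := by
        refine Finset.sum_le_sum fun k _ => (hω.norm_smul_shiftOp_le hp v.coeff k).trans ?_
        rw [← mul_assoc]
        have := hω.pos k
        gcongr
        exact hv k
    _ = _ := by rw [← Finset.sum_mul, ← Finset.mul_sum]

end ModerateWeight

open scoped Pointwise in
lemma support_coeff_pow_subset {G : Type*} [AddCommGroup G] [DecidableEq G]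
    (v : AddMonoidAlgebra ℂ G) (F : Finset G) (hF : v.coeff.support ⊆ F) (j : ℕ) :
    (v ^ j).coeff.support ⊆ j • F := by
  induction j with
  | zero =>
    rw [pow_zero, zero_smul]
    refine (Finsupp.support_single_subset (a := (0 : G)) (b := (1 : ℂ))).trans ?_
    rfl
  | succ j ih =>
    rw [pow_succ, succ_nsmul]
    exact (AddMonoidAlgebra.support_coeff_mul_subset _ _).trans (Finset.add_subset_add ih hF)

end WeightedShiftInvariant

/-! ### Wiener's lemma and the inversion of positive operators. -/

namespace WeightedShiftInvariant

namespace ModerateWeight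

variable {G : Type*} [AddCommGroup G] {ω : G → ℝ} {K : ℝ}

lemma commute_shiftOp (hω : ModerateWeight ω K) {p : ℝ≥0∞} [Fact (1 ≤ p)] (hp : p ≠ ∞) (k l : G) :
    Commute (hω.shiftOp hp k) (hω.shiftOp hp l) :=
  (Commute.all (Multiplicative.ofAdd k) (Multiplicative.ofAdd l)).map (hω.shiftHom hp)

lemma commute_algHom_convOp (hω : ModerateWeight ω K) {p : ℝ≥0∞} [Fact (1 ≤ p)] (hp : p ≠ ∞)
    (v : AddMonoidAlgebra ℂ G) (u : G → ℂ) : Commute (hω.algHom hp v) (hω.convOp hp u) := by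
  refine Commute.tsum_right _ fun l => ?_
  rw [algHom_apply]
  refine Commute.sum_left _ _ _ fun k _ => ?_
  exact ((hω.commute_shiftOp hp k l).smul_left _).smul_right _

variable [DecidableEq G]

/-- Here `v` is `u` truncated to `F`, and the difference is convolution with the tail of `u`; each
of its partial sums sees only indices outside `F`. -/
lemma norm_convOp_sub_algHom_le (hω : ModerateWeight ω K) {p : ℝ≥0∞} [Fact (1 ≤ p)] (hp : p ≠ ∞)
    {u : G → ℂ} (hu : Summable fun k => ω k * ‖u k‖) (F : Finset G) {ε : ℝ}
    (hF : ∀ s : Finset G, Disjoint s F → ∑ k ∈ s, K * (ω k * ‖u k‖) ≤ ε) (v : AddMonoidAlgebra ℂ G)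
    (hv : ∀ k, v.coeff k = if k ∈ F then u k else 0) :
    ‖hω.convOp hp u - hω.algHom hp v‖ ≤ ε := by
  have h1 := (hω.summable_smul_shiftOp hp hu).hasSum
  have h2 : HasSum (fun k => v.coeff k • hω.shiftOp hp k) (hω.algHom hp v) := by
    rw [algHom_apply]
    refine hasSum_sum_of_ne_finset_zero fun k hk => ?_
    rw [Finsupp.notMem_support_iff.1 hk, zero_smul]
  refine le_of_tendsto ((h1.sub h2).norm) (Filter.Eventually.of_forall fun s => ?_)
  refine (norm_sum_le _ _).trans ?_
  refine le_trans ?_ (hF (s \ F) Finset.sdiff_disjoint)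
  rw [← Finset.sum_subset (Finset.sdiff_subset (s := s) (t := F))]
  · refine Finset.sum_le_sum fun k hk => ?_
    rw [hv, if_neg (Finset.mem_sdiff.1 hk).2, zero_smul, sub_zero]
    exact hω.norm_smul_shiftOp_le hp u k
  · intro k hk hk'
    have : k ∈ F := by simpa [hk] using hk'
    rw [hv, if_pos this, sub_self, norm_zero]

instance nontrivial_lp (p : ℝ≥0∞) : Nontrivial (lp (fun _ : G => ℂ) p) :=
  ⟨lp.single p 0 1, 0, fun h => one_ne_zero (α := ℂ) (by
    simpa using congrArg (fun c : lp (fun _ : G => ℂ) p => c 0) h)⟩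

open scoped Pointwise in
/-- Powers of a convolution operator on a weighted `ℓ_1`, for a weight of polynomial growth, become
small as soon as the operator is a strict contraction on the unweighted `ℓ_2`. -/
lemma exists_norm_convOp_pow_lt_one (hω : ModerateWeight ω K)
    (hgrowth : ∀ F : Finset G, ∃ (C : ℝ) (D : ℕ), ∀ j : ℕ, ∑ k ∈ j • F, ω k ≤ C * (1 + j) ^ D)
    {u : G → ℂ} (hu : Summable fun k => ω k * ‖u k‖)
    (h2 : ‖(one (G := G)).convOp (p := 2) ENNReal.ofNat_ne_top u‖ < 1) :
    ∃ n : ℕ, ‖hω.convOp (p := 1) ENNReal.one_ne_top u ^ n‖ < 1 := by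
  set ρ := ‖(one (G := G)).convOp (p := 2) ENNReal.ofNat_ne_top u‖ with hρ
  have hρ0 : 0 ≤ ρ := norm_nonneg _
  -- One `ε` pays for truncation in the `ℓ_2` norm, the other for the remainder `U - V` in the
  -- weighted `ℓ_1`.
  obtain ⟨ε, hε, hρε⟩ : ∃ ε : ℝ, 0 < ε ∧ ρ + ε + ε < 1 := ⟨(1 - ρ) / 4, by linarith, by linarith⟩
  obtain ⟨F, hF⟩ := summable_iff_vanishing_norm.1 (hu.mul_left K) ε hε
  have hK := hω.one_le_const
  have hF1 : ∀ s : Finset G, Disjoint s F → ∑ k ∈ s, K * (ω k * ‖u k‖) ≤ ε := fun s hs =>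
    (Real.le_norm_self _).trans (hF s hs).le
  -- Because `K` and `ω` are at least `1`, the same finite set `F` controls the unweighted tail.
  have hF2 : ∀ s : Finset G, Disjoint s F → ∑ k ∈ s, 1 * (1 * ‖u k‖) ≤ ε := fun s hs => by
    refine le_trans (Finset.sum_le_sum fun k _ => ?_) (hF1 s hs)
    have := hω.one_le k
    gcongr
  have hu1 : Summable fun k => (1 : ℝ) * ‖u k‖ := by
    refine Summable.of_nonneg_of_le (fun k => by positivity) (fun k => ?_) hu
    have := hω.one_le k
    gcongr
  let v : AddMonoidAlgebra ℂ G :=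
    .ofCoeff (Finsupp.onFinset F (fun k => if k ∈ F then u k else 0) fun k hk => by
      by_contra h; exact hk (if_neg h))
  have hv : ∀ k, v.coeff k = if k ∈ F then u k else 0 := fun k => rfl
  have hvF : v.coeff.support ⊆ F := fun k hk => by
    by_contra h
    exact (Finsupp.mem_support_iff.1 hk) (if_neg h)
  have hV2 : ‖(one (G := G)).algHom (p := 2) ENNReal.ofNat_ne_top v‖ ≤ ρ + ε := by
    have := (one (G := G)).norm_convOp_sub_algHom_le (p := 2) ENNReal.ofNat_ne_top hu1 F hF2 v hv
    have h := norm_sub_norm_le ((one (G := G)).algHom (p := 2) ENNReal.ofNat_ne_top v)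
      ((one (G := G)).convOp (p := 2) ENNReal.ofNat_ne_top u)
    rw [norm_sub_rev] at h
    linarith
  obtain ⟨C, D, hCD⟩ := hgrowth F
  set U := hω.convOp (p := 1) ENNReal.one_ne_top u with hU
  set V := hω.algHom (p := 1) ENNReal.one_ne_top v with hVdef
  have hW : ‖U - V‖ ≤ ε := hω.norm_convOp_sub_algHom_le ENNReal.one_ne_top hu F hF1 v hv
  have hC : 0 ≤ C := by
    have := (Finset.sum_nonneg fun k _ => (hω.pos k).le).trans (hCD 0)
    simpa using this
  -- The polynomial factor is the weight of the sumset `j • F` carrying `v ^ j`; the geometric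
  -- factor is the `ℓ_2` norm of that power.
  have hV : ∀ j : ℕ, ‖V ^ j‖ ≤ K * (C * (1 + j) ^ D) * (ρ + ε) ^ j := fun j => by
    rw [hVdef, ← map_pow]
    refine (hω.norm_algHom_le (p := 1) ENNReal.one_ne_top _ (j • F)
      (support_coeff_pow_subset v F hvF j) (q := 2) ENNReal.ofNat_ne_top).trans ?_
    refine mul_le_mul (mul_le_mul_of_nonneg_left (hCD j) (by linarith)) ?_ (norm_nonneg _)
      (by positivity)
    rw [map_pow]
    exact (norm_pow_le _ _).trans (by gcongr)
  -- `V` and `U - V` commute, so `(V + (U - V))^n` expands binomially; once the polynomial factor is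
  -- replaced by its value at `n`, the bounds reassemble to `((ρ + ε) + ε)^n`.
  have hpow : ∀ n : ℕ, ‖U ^ n‖ ≤ K * C * ((1 + n) ^ D * (ρ + ε + ε) ^ n) := fun n => by
    have hc : Commute V (U - V) :=
      (hω.commute_algHom_convOp ENNReal.one_ne_top v u).sub_right (Commute.refl _)
    rw [← add_sub_cancel V U, hc.add_pow]
    refine (norm_sum_le _ _).trans ?_
    rw [add_pow (ρ + ε) ε n, Finset.mul_sum, Finset.mul_sum]
    refine Finset.sum_le_sum fun j hj => ?_
    have hjn : j ≤ n := Nat.lt_succ_iff.1 (Finset.mem_range.1 hj)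
    have e1 : ‖V ^ j * (U - V) ^ (n - j) * (n.choose j : _)‖ ≤
        ‖V ^ j‖ * ‖U - V‖ ^ (n - j) * n.choose j := by
      rw [← nsmul_eq_mul']
      refine (norm_nsmul_le).trans ?_
      rw [mul_comm]
      gcongr
      refine (norm_mul_le _ _).trans ?_
      gcongr
      exact norm_pow_le _ _
    refine e1.trans ?_
    calc _ ≤ (K * (C * (1 + n) ^ D) * (ρ + ε) ^ j) * ε ^ (n - j) * n.choose j := by
          gcongr
          refine (hV j).trans ?_
          gcongr
      _ = _ := by ring
  have hlim : Filter.Tendsto (fun n : ℕ => K * C * ((1 + n : ℝ) ^ D * (ρ + ε + ε) ^ n))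
      Filter.atTop (nhds 0) := by
    have hq : 0 < ρ + ε + ε := by positivity
    -- The standard limit of `n^D r^n` is taken at `n + 1`; the surplus factor `r` is divided out in
    -- the constant.
    have h := (tendsto_pow_const_mul_const_pow_of_abs_lt_one D
      (r := ρ + ε + ε) (by rwa [abs_of_pos hq])).comp (Filter.tendsto_add_atTop_nat 1)
    have h' := h.const_mul (K * C * (ρ + ε + ε)⁻¹)
    rw [mul_zero] at h'
    refine h'.congr fun n => ?_
    simp only [Function.comp_apply, Nat.cast_add, Nat.cast_one, pow_succ]
    field_simp
    ring
  obtain ⟨n, hn⟩ := (hlim.eventually_lt_const one_pos).exists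
  exact ⟨n, (hpow n).trans_lt hn⟩

/-- `1 - x^n = (1 - x)(1 + x + ⋯ + x^{n-1})` with commuting factors, so invertibility of the product
passes to `1 - x`. -/
lemma isUnit_one_sub_of_norm_pow_lt_one {R : Type*} [NormedRing R] [HasSummableGeomSeries R]
    {x : R} {n : ℕ} (h : ‖x ^ n‖ < 1) : IsUnit (1 - x) := by
  have h1 := isUnit_one_sub_of_norm_lt_one h
  rw [← mul_neg_geom_sum] at h1
  refine (Commute.isUnit_mul_iff ?_).1 h1 |>.1
  exact (Commute.one_left _).sub_left (Commute.sum_right _ _ _ fun i _ => Commute.self_pow x i)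

open scoped Pointwise in
/-- **Wiener's lemma** for weights of polynomial growth. -/
theorem exists_convolution_inverse (hω : ModerateWeight ω K)
    (hgrowth : ∀ F : Finset G, ∃ (C : ℝ) (D : ℕ), ∀ j : ℕ, ∑ k ∈ j • F, ω k ≤ C * (1 + j) ^ D)
    {a : G → ℂ} (ha : Summable fun k => ω k * ‖a k‖) (t : ℂ)
    (h2 : ‖1 - t • (one (G := G)).convOp (p := 2) ENNReal.ofNat_ne_top a‖ < 1) :
    ∃ b : G → ℂ, (Summable fun k => ω k * ‖b k‖) ∧
      ∀ n, HasSum (fun k => a k * b (n - k)) (Pi.single (M := fun _ => ℂ) 0 1 n) := by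
  have ha1 : Summable fun k => (1 : ℝ) * ‖a k‖ := by
    refine Summable.of_nonneg_of_le (fun k => by positivity) (fun k => ?_) ha
    have := hω.one_le k
    gcongr
  have hu : Summable fun k => ω k * ‖Pi.single (M := fun _ => ℂ) 0 1 k - t * a k‖ := by
    have h0 : Summable fun k => ω k * ‖Pi.single (M := fun _ => ℂ) (0 : G) (1 : ℂ) k‖ :=
      summable_of_ne_finset_zero (s := {0}) fun k hk => by
        rw [Pi.single_eq_of_ne (by simpa using hk), norm_zero, mul_zero]
    refine Summable.of_nonneg_of_le (fun k => mul_nonneg (hω.pos k).le (norm_nonneg _))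
      (fun k => ?_) (h0.add (ha.mul_left ‖t‖))
    calc _ ≤ ω k * (‖Pi.single (M := fun _ => ℂ) (0 : G) (1 : ℂ) k‖ + ‖t * a k‖) := by
          have := hω.pos k
          gcongr
          exact norm_sub_le _ _
      _ = _ := by rw [norm_mul]; ring
  rw [← convOp_sub_smul _ _ ha1] at h2
  obtain ⟨n, hn⟩ := hω.exists_norm_convOp_pow_lt_one hgrowth hu h2
  have hunit := isUnit_one_sub_of_norm_pow_lt_one hn
  rw [convOp_sub_smul _ _ ha, sub_sub_cancel] at hunit
  obtain ⟨W, hW⟩ := hunit.exists_right_inv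
  -- Sequences are stored multiplied by `ω`: the unit of convolution is `ω 0` at `0`, and the
  -- inverse is `e / ω`. The scalar `t` appears because `W` is a right inverse of `t • convOp a`.
  let e : lp (fun _ : G => ℂ) 1 := t • W (lp.single 1 0 (ω 0 : ℂ))
  have he : hω.convOp (p := 1) ENNReal.one_ne_top a e = lp.single 1 0 (ω 0 : ℂ) := by
    have := congrArg (fun T => T (lp.single 1 0 (ω 0 : ℂ))) hW
    simpa [e] using this
  refine ⟨fun k => e k / ω k, ?_, fun n => ?_⟩
  · have h := (lp.memℓp e).summable (by simp)
    refine h.congr fun k => ?_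
    have := hω.pos k
    rw [norm_div, Complex.norm_real, Real.norm_of_nonneg this.le]
    simp only [ENNReal.toReal_one, Real.rpow_one]
    field_simp
  · have h := (hω.hasSum_convOp_apply (p := 1) ENNReal.one_ne_top ha e n).mul_left
      ((ω n : ℂ)⁻¹)
    have hn : (ω n : ℂ) ≠ 0 := by exact_mod_cast (hω.pos _).ne'
    rw [he] at h
    have e1 : ∀ k, (ω n : ℂ)⁻¹ * (a k * (((ω n / ω (n - k) : ℝ) : ℂ) * e (n - k))) =
        a k * (e (n - k) / ω (n - k)) := fun k => by
      have : (ω (n - k) : ℂ) ≠ 0 := by exact_mod_cast (hω.pos _).ne'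
      push_cast
      field_simp
    have e2 : (ω n : ℂ)⁻¹ * lp.single (E := fun _ : G => ℂ) 1 0 (ω 0 : ℂ) n =
        Pi.single (M := fun _ => ℂ) 0 1 n := by
      rcases eq_or_ne n 0 with rfl | h0
      · simp [hn]
      · simp [h0]
    simp only [e1, e2] at h
    exact h

end ModerateWeight

section Positive

variable {H : Type*} [NormedAddCommGroup H] [InnerProductSpace ℂ H] [CompleteSpace H]

/-- A positive operator between `m > 0` and `M` is inverted by a Neumann series. -/
lemma norm_one_sub_smul_lt_one (Q : H →L[ℂ] H) {m M : ℝ} (hm : 0 < m) (hmM : m ≤ M)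
    (hQ : ∀ x, ∃ t : ℝ, inner ℂ (Q x) x = t ∧ m * ‖x‖ ^ 2 ≤ t ∧ t ≤ M * ‖x‖ ^ 2) :
    ‖1 - ((M⁻¹ : ℝ) : ℂ) • Q‖ < 1 := by
  have hM : 0 < M := hm.trans_le hmM
  -- The scaling `M⁻¹` keeps `1 - M⁻¹ Q` positive, so its C⋆-norm is bounded by the upper order
  -- bound `r = 1 - m / M` alone.
  set r : ℝ := 1 - M⁻¹ * m with hr
  have hr0 : 0 ≤ r := by
    have : M⁻¹ * m ≤ 1 := by rw [inv_mul_le_iff₀ hM]; linarith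
    linarith
  have hr1 : r < 1 := by have : 0 < M⁻¹ * m := by positivity
                         linarith
  have key : ∀ x, ∃ t : ℝ, inner ℂ ((1 - ((M⁻¹ : ℝ) : ℂ) • Q) x) x = t ∧ 0 ≤ t ∧
      t ≤ r * ‖x‖ ^ 2 := fun x => by
    obtain ⟨t, h1, h2, h3⟩ := hQ x
    refine ⟨‖x‖ ^ 2 - M⁻¹ * t, ?_, ?_, ?_⟩
    · change inner ℂ (x - ((M⁻¹ : ℝ) : ℂ) • Q x) x = _
      rw [inner_sub_left, inner_smul_left, h1, inner_self_eq_norm_sq_to_K]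
      simp
    · have : M⁻¹ * t ≤ ‖x‖ ^ 2 := by rw [inv_mul_le_iff₀ hM]; linarith
      linarith
    · have : M⁻¹ * (m * ‖x‖ ^ 2) ≤ M⁻¹ * t := by gcongr
      rw [hr]; linarith
  have hpos : (0 : H →L[ℂ] H) ≤ 1 - ((M⁻¹ : ℝ) : ℂ) • Q := by
    rw [ContinuousLinearMap.nonneg_iff_isPositive, ContinuousLinearMap.isPositive_iff_complex]
    intro x
    obtain ⟨t, h1, h2, -⟩ := key x
    rw [h1]
    simpa using h2
  have hle : 1 - ((M⁻¹ : ℝ) : ℂ) • Q ≤ algebraMap ℝ (H →L[ℂ] H) r := by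
    rw [ContinuousLinearMap.le_def, ContinuousLinearMap.isPositive_iff_complex]
    intro x
    obtain ⟨t, h1, -, h2⟩ := key x
    have e : inner ℂ ((algebraMap ℝ (H →L[ℂ] H) r - (1 - ((M⁻¹ : ℝ) : ℂ) • Q)) x) x =
        ((r * ‖x‖ ^ 2 - t : ℝ) : ℂ) := by
      rw [sub_apply, inner_sub_left, h1, Algebra.algebraMap_eq_smul_one]
      change inner ℂ (r • x) x - _ = _
      rw [← Complex.coe_smul, inner_smul_left, inner_self_eq_norm_sq_to_K]
      simp
    rw [e, RCLike.re_eq_complex_re, Complex.ofReal_re]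
    exact ⟨rfl, sub_nonneg.2 h2⟩
  exact ((CStarAlgebra.norm_le_iff_le_algebraMap _ hr0 hpos).2 hle).trans_lt hr1

end Positive

end WeightedShiftInvariant

/-! ### Gram operators of Riesz sequences; polynomial growth on the lattice. -/

namespace WeightedShiftInvariant

section Gram

variable {G : Type*} [AddCommGroup G] [DecidableEq G]

lemma convOp_one_single {a : G → ℂ} (ha : Summable fun k => (1 : ℝ) * ‖a k‖) {p : ℝ≥0∞}
    [Fact (1 ≤ p)] (hp : p ≠ ∞) (k n : G) (c : ℂ) :
    (ModerateWeight.one (G := G)).convOp hp a (lp.single p k c) n = a (n - k) * c := by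
  refine ((ModerateWeight.one (G := G)).hasSum_convOp_apply hp ha _ n).unique ?_
  convert hasSum_single (n - k) ?_ using 1
  · simp
  · intro m hm
    have : n - m ≠ k := fun h => hm (by rw [← h]; abel)
    simp [this]

/-- A convolution operator whose symbol is the Gram matrix of a Riesz sequence inherits the bounds
of the Riesz sequence. -/
lemma convOp_gram_bounds {H : Type*} [NormedAddCommGroup H] [InnerProductSpace ℂ H]
    {a : G → ℂ} (ha : Summable fun k => (1 : ℝ) * ‖a k‖) {e : G → H}
    (he : ∀ n k, inner ℂ (e n) (e k) = a (n - k)) {A B : ℝ} (hA : 0 ≤ A)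
    (hAB : ∀ (s : Finset G) (x : G → ℂ),
      A * ‖∑ k ∈ s, lp.single (E := fun _ : G => ℂ) 2 k (x k)‖ ≤ ‖∑ k ∈ s, x k • e k‖ ∧
      ‖∑ k ∈ s, x k • e k‖ ≤ B * ‖∑ k ∈ s, lp.single (E := fun _ : G => ℂ) 2 k (x k)‖)
    (x : lp (fun _ : G => ℂ) 2) :
    ∃ t : ℝ, inner ℂ ((ModerateWeight.one (G := G)).convOp (p := 2) ENNReal.ofNat_ne_top a x) x =
      t ∧ A ^ 2 * ‖x‖ ^ 2 ≤ t ∧ t ≤ B ^ 2 * ‖x‖ ^ 2 := by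
  set Q := (ModerateWeight.one (G := G)).convOp (p := 2) ENNReal.ofNat_ne_top a with hQ
  -- By continuity it suffices to treat finite truncations, on which the quadratic form is exactly
  -- `‖∑ x k • e k‖²`. Hermitian symmetry of `a` reconciles the index order of the convolution
  -- matrix with that of the Gram matrix.
  let X : Finset G → lp (fun _ : G => ℂ) 2 := fun s => ∑ k ∈ s, lp.single 2 k (x k)
  have hX : Filter.Tendsto X Filter.atTop (nhds x) := lp.hasSum_single ENNReal.ofNat_ne_top x
  have hlim : Filter.Tendsto (fun s => inner ℂ (Q (X s)) (X s)) Filter.atTop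
      (nhds (inner ℂ (Q x) x)) :=
    ((Q.continuous.tendsto x).comp hX).inner hX
  have hfin : ∀ s, inner ℂ (Q (X s)) (X s) = ((‖∑ k ∈ s, x k • e k‖ ^ 2 : ℝ) : ℂ) := fun s => by
    have h := inner_self_eq_norm_sq_to_K (𝕜 := ℂ) (∑ k ∈ s, x k • e k)
    push_cast
    refine Eq.trans ?_ h
    simp only [X, map_sum, sum_inner, inner_sum]
    refine Finset.sum_congr rfl fun k _ => Finset.sum_congr rfl fun n _ => ?_
    rw [lp.inner_single_right, hQ, convOp_one_single ha, inner_smul_left, inner_smul_right, he,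
      ← neg_sub k n]
    have : a (-(k - n)) = conj (a (k - n)) := by
      rw [neg_sub, ← he, ← he, inner_conj_symm]
    rw [this]
    simp
    ring
  have hnorm := hX.norm.pow 2
  have hre := (Complex.continuous_re.tendsto _).comp hlim
  have him := (Complex.continuous_im.tendsto _).comp hlim
  refine ⟨(inner ℂ (Q x) x).re, ?_, ?_, ?_⟩
  · refine Complex.ext (by simp) ?_
    rw [Complex.ofReal_im]
    refine tendsto_nhds_unique him ?_
    refine tendsto_const_nhds.congr fun s => ?_
    rw [Function.comp_apply, hfin, Complex.ofReal_im]
  · refine le_of_tendsto_of_tendsto' (hnorm.const_mul _) hre fun s => ?_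
    rw [Function.comp_apply, hfin, Complex.ofReal_re, ← mul_pow]
    exact pow_le_pow_left₀ (by positivity) (hAB s x).1 2
  · refine le_of_tendsto_of_tendsto' hre (hnorm.const_mul _) fun s => ?_
    rw [Function.comp_apply, hfin, Complex.ofReal_re, ← mul_pow]
    exact pow_le_pow_left₀ (norm_nonneg _) (hAB s x).2 2

end Gram

section Lattice

variable {d : ℕ}

lemma moderateWeight_latticePoint {α : ℝ} (hα : 0 ≤ α) :
    ModerateWeight (fun k : Fin d → ℤ => weight α (latticePoint k)) (2 ^ (α / 2)) where
  one_le k := one_le_weight hα _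
  one_le_const := Real.one_le_rpow one_le_two (by positivity)
  add_le k l := by rw [latticePoint_add]; exact weight_add_le hα _ _

open scoped Pointwise in
lemma abs_le_of_mem_nsmul {F : Finset (Fin d → ℤ)} {R : ℕ} (hR : ∀ k ∈ F, ∀ i, |k i| ≤ R) (j : ℕ) :
    ∀ k ∈ j • F, ∀ i, |k i| ≤ j * R := by
  induction j with
  | zero =>
    intro k hk i
    rw [zero_smul, Finset.mem_zero] at hk
    simp [hk]
  | succ j ih =>
    intro k hk i
    rw [succ_nsmul] at hk
    obtain ⟨l, hl, m, hm, rfl⟩ := Finset.mem_add.1 hk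
    have h1 := ih l hl i
    have h2 := hR m hm i
    rw [Pi.add_apply]
    push_cast
    linarith [abs_add_le (l i) (m i)]

lemma weight_latticePoint_le {α : ℝ} {k : Fin d → ℤ} {R j : ℕ}
    (hk : ∀ i, |k i| ≤ j * R) :
    weight α (latticePoint k) ≤ ((1 + d * R ^ 2) * (1 + j) ^ 2) ^ ⌈α / 2⌉₊ := by
  have h1 : ‖latticePoint k‖ ^ 2 ≤ d * (j * R) ^ 2 := by
    rw [EuclideanSpace.norm_sq_eq]
    calc _ ≤ ∑ _i : Fin d, ((j * R : ℕ) : ℝ) ^ 2 := by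
          refine Finset.sum_le_sum fun i _ => ?_
          rw [latticePoint_apply, Real.norm_eq_abs]
          refine pow_le_pow_left₀ (abs_nonneg _) ?_ 2
          have := hk i
          exact_mod_cast this
      _ = _ := by simp
  have h2 : 1 + ‖latticePoint k‖ ^ 2 ≤ (1 + d * R ^ 2) * (1 + j) ^ 2 := by
    have : (0 : ℝ) ≤ d * R ^ 2 := by positivity
    have : (0 : ℝ) ≤ j := by positivity
    nlinarith [mul_nonneg (by positivity : (0 : ℝ) ≤ d * R ^ 2) this]
  calc weight α (latticePoint k) ≤ (1 + ‖latticePoint k‖ ^ 2) ^ ((⌈α / 2⌉₊ : ℕ) : ℝ) :=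
        Real.rpow_le_rpow_of_exponent_le (by nlinarith [sq_nonneg ‖latticePoint k‖]) (Nat.le_ceil _)
    _ = (1 + ‖latticePoint k‖ ^ 2) ^ ⌈α / 2⌉₊ := Real.rpow_natCast _ _
    _ ≤ _ := pow_le_pow_left₀ (by positivity) h2 _

-- The sumset lies in a cube of side `O(j)`, so it has `O(j^d)` points, each of weight
-- `O(j^{2⌈α/2⌉})`. Rounding `α / 2` up keeps the exponent `D` a natural number.
open scoped Pointwise in
lemma sum_weight_nsmul_le (α : ℝ) (F : Finset (Fin d → ℤ)) :
    ∃ (C : ℝ) (D : ℕ), ∀ j : ℕ, ∑ k ∈ j • F, weight α (latticePoint k) ≤ C * (1 + j) ^ D := by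
  obtain ⟨R, hR⟩ : ∃ R : ℕ, ∀ k ∈ F, ∀ i, |k i| ≤ R := by
    refine ⟨∑ k ∈ F, ∑ i, (k i).natAbs, fun k hk i => ?_⟩
    rw [Int.abs_eq_natAbs]
    exact_mod_cast (Finset.single_le_sum (f := fun i => (k i).natAbs) (fun _ _ => Nat.zero_le _)
      (Finset.mem_univ i)).trans (Finset.single_le_sum (f := fun k => ∑ i, (k i).natAbs)
        (fun _ _ => Nat.zero_le _) hk)
  refine ⟨(2 * R + 1) ^ d * (1 + d * R ^ 2) ^ ⌈α / 2⌉₊, d + 2 * ⌈α / 2⌉₊, fun j => ?_⟩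
  have hmem := abs_le_of_mem_nsmul hR j
  have hsub : j • F ⊆ Fintype.piFinset fun _ : Fin d => Finset.Icc (-(j * R : ℤ)) (j * R) := by
    intro k hk
    rw [Fintype.mem_piFinset]
    exact fun i => Finset.mem_Icc.2 (abs_le.1 (hmem k hk i))
  have hcard : ((j • F).card : ℝ) ≤ ((2 * R + 1) * (1 + j)) ^ d := by
    have h := Finset.card_le_card hsub
    rw [Fintype.card_piFinset_const, Int.card_Icc] at h
    have e : ((j * R : ℤ) + 1 - -(j * R)).toNat = 2 * (j * R) + 1 := by
      have : ((j * R : ℤ) + 1 - -(j * R)) = ((2 * (j * R) + 1 : ℕ) : ℤ) := by push_cast; ring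
      rw [this, Int.toNat_natCast]
    rw [e] at h
    calc ((j • F).card : ℝ) ≤ ((2 * (j * R) + 1 : ℕ) : ℝ) ^ d := by exact_mod_cast h
      _ ≤ _ := by
        refine pow_le_pow_left₀ (by positivity) ?_ d
        push_cast
        have h1 : (0 : ℝ) ≤ j := by positivity
        have h2 : (0 : ℝ) ≤ R := by positivity
        nlinarith
  calc ∑ k ∈ j • F, weight α (latticePoint k)
      ≤ (j • F).card • ((1 + d * R ^ 2) * (1 + j : ℝ) ^ 2) ^ ⌈α / 2⌉₊ :=
        Finset.sum_le_card_nsmul _ _ _ fun k hk => weight_latticePoint_le (hmem k hk)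
    _ ≤ ((2 * R + 1) * (1 + j)) ^ d * ((1 + d * R ^ 2) * (1 + j : ℝ) ^ 2) ^ ⌈α / 2⌉₊ := by
        rw [nsmul_eq_mul]
        gcongr
    _ = _ := by
        rw [mul_pow, mul_pow, pow_add, pow_mul]
        ring

end Lattice

end WeightedShiftInvariant

/-! ### Weighted bounds for synthesis, analysis and autocorrelation. -/

namespace WeightedShiftInvariant

variable {d : ℕ}

/-- The weight as an extended nonnegative real. -/
noncomputable def eweight (α : ℝ) (x : Euc d) : ℝ≥0∞ := ENNReal.ofReal (weight α x)

lemma eweight_ne_zero (α : ℝ) (x : Euc d) : eweight α x ≠ 0 := by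
  simpa [eweight] using weight_pos α x

lemma eweight_ne_top (α : ℝ) (x : Euc d) : eweight α x ≠ ∞ := ENNReal.ofReal_ne_top

lemma measurable_eweight (α : ℝ) : Measurable (eweight (d := d) α) :=
  (continuous_weight α).measurable.ennreal_ofReal

lemma eweight_neg_apply (α : ℝ) (x : Euc d) : eweight α (-x) = eweight α x := by
  rw [eweight, eweight, weight_neg_apply]

lemma one_le_eweight {α : ℝ} (hα : 0 ≤ α) (x : Euc d) : 1 ≤ eweight α x := by
  rw [eweight, ← ENNReal.ofReal_one]
  exact ENNReal.ofReal_le_ofReal (one_le_weight hα x)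

lemma enorm_weight_mul (α : ℝ) (x : Euc d) (z : ℂ) :
    ‖(weight α x : ℂ) * z‖ₑ = eweight α x * ‖z‖ₑ := by
  rw [enorm_mul, eweight, ← ofReal_norm (weight α x : ℂ), Complex.norm_real,
    Real.norm_of_nonneg (weight_pos α x).le]

lemma eweight_add_le {α : ℝ} (hα : 0 ≤ α) (x y : Euc d) :
    eweight α (x + y) ≤ ENNReal.ofReal (2 ^ (α / 2)) * eweight α x * eweight α y := by
  have h1 := weight_pos α x
  rw [eweight, eweight, eweight, ← ENNReal.ofReal_mul (by positivity),
    ← ENNReal.ofReal_mul (by positivity)]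
  exact ENNReal.ofReal_le_ofReal (weight_add_le hα x y)

lemma eweight_smul_add_le {α : ℝ} (hα : 0 ≤ α) (h : ℝ) (x y : Euc d) :
    eweight (-α) (h • (x + y)) ≤
      ENNReal.ofReal (moderateConst α h) * eweight (-α) (h • x) * eweight α y := by
  have h1 := weight_pos (-α) (h • x)
  have h2 := moderateConst_pos α h
  rw [eweight, eweight, eweight, ← ENNReal.ofReal_mul (by positivity),
    ← ENNReal.ofReal_mul (by positivity)]
  exact ENNReal.ofReal_le_ofReal (weight_smul_add_le hα h x y)

/-- The weighted modulus `⟨x⟩^α |f x|`. -/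
noncomputable def weightedEnorm (α : ℝ) (f : Euc d → ℂ) (x : Euc d) : ℝ≥0∞ :=
  eweight α x * ‖f x‖ₑ

lemma aemeasurable_weightedEnorm {α : ℝ} {f : Euc d → ℂ} (hf : AEStronglyMeasurable f volume) :
    AEMeasurable (weightedEnorm α f) :=
  (measurable_eweight α).aemeasurable.mul hf.enorm

/-- The norm of the hybrid space, computed over the half-open cube. -/
noncomputable def cubeNorm (r : ℝ≥0∞) (α : ℝ) (f : Euc d → ℂ) : ℝ≥0∞ :=
  eLpNorm (periodize (weightedEnorm α f)) r (volume.restrict (unitCube d))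

/-- The cube has finite measure, so the single exponent `q = max p p'` supplies all the exponents
`1`, `2`, `p`, `p'` needed later. -/
lemma cubeNorm_lt_top {q r : ℝ≥0∞} {α : ℝ} {f : Euc d → ℂ} (hf : MemHybrid q α f) (hr : r ≤ q) :
    cubeNorm r α f < ∞ := by
  have hm := (aemeasurable_periodize (aemeasurable_weightedEnorm (α := α) hf.1)).restrict
    (s := unitCube d)
  have hq : MemLp (periodize (weightedEnorm α f)) q (volume.restrict (unitCube d)) := by
    refine ⟨hm.aestronglyMeasurable, lt_of_le_of_lt ?_ hf.2⟩
    unfold hybridNorm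
    simp only [enorm_weight_mul]
    exact eLpNorm_mono_measure _ (Measure.restrict_mono unitCube_subset le_rfl)
  exact (hq.mono_exponent hr).2

lemma eLpNorm_le_const_mul {X : Type*} [MeasurableSpace X] {μ : Measure X} {f g : X → ℝ≥0∞}
    {C : ℝ≥0∞} (hC : C ≠ ∞) (h : ∀ x, ‖f x‖ₑ ≤ C * ‖g x‖ₑ) (p : ℝ≥0∞) :
    eLpNorm f p μ ≤ C * eLpNorm g p μ := by
  lift C to NNReal using hC
  have := eLpNorm_le_nnreal_smul_eLpNorm_of_ae_le_mul' (μ := μ) (f := f) (g := g) (c := C)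
    (Filter.Eventually.of_forall h) p
  rwa [ENNReal.smul_def, smul_eq_mul] at this

/-- Boundedness of the synthesis operator, uniform in dilations of the weight. -/
lemma eLpNorm_synthesis_le {α : ℝ} (hα : 0 ≤ α) (h : ℝ) {φ : Euc d → ℂ}
    (hφ : AEStronglyMeasurable φ volume) {p : ℝ≥0∞} (hp : 1 ≤ p) (c : (Fin d → ℤ) → ℂ) :
    eLpNorm (fun x => eweight (-α) (h • x) * ∑' k, ‖c k‖ₑ * ‖φ (x - latticePoint k)‖ₑ) p volume ≤
      ENNReal.ofReal (moderateConst α h) * (cubeNorm p α φ *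
        eLpNorm (fun k => eweight (-α) (h • latticePoint k) * ‖c k‖ₑ) p Measure.count) := by
  refine le_trans ?_ (mul_le_mul_right (eLpNorm_semidiscrete_conv_le
    (aemeasurable_weightedEnorm (α := α) hφ) hp _) _)
  refine eLpNorm_le_const_mul ENNReal.ofReal_ne_top (fun x => ?_) p
  rw [enorm_eq_self, enorm_eq_self, ← ENNReal.tsum_mul_left, ← ENNReal.tsum_mul_left]
  refine ENNReal.tsum_le_tsum fun k => ?_
  -- From `h x = h (k + (x - k))`: the dilated weight goes to the coefficient, the undilated one to
  -- the kernel.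
  have h1 := eweight_smul_add_le hα h (latticePoint k) (x - latticePoint k)
  rw [add_sub_cancel] at h1
  calc _ ≤ (ENNReal.ofReal (moderateConst α h) * eweight (-α) (h • latticePoint k) *
        eweight α (x - latticePoint k)) * (‖c k‖ₑ * ‖φ (x - latticePoint k)‖ₑ) := by gcongr
    _ = _ := by unfold weightedEnorm; ring

/-- Boundedness of the analysis operator, uniform in dilations of the weight. -/
lemma eLpNorm_analysis_le {α : ℝ} (hα : 0 ≤ α) (h : ℝ) {ψ f : Euc d → ℂ}
    (hψ : AEStronglyMeasurable ψ volume) (hf : AEStronglyMeasurable f volume) {p p' : ℝ≥0∞}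
    (hpp' : p⁻¹ + p'⁻¹ = 1) (hfin : cubeNorm p' α ψ ≠ ∞) :
    eLpNorm (fun k => eweight (-α) (h • latticePoint k) *
      ∫⁻ x, ‖f x‖ₑ * ‖ψ (x - latticePoint k)‖ₑ) p Measure.count ≤
      ENNReal.ofReal (moderateConst α h) * (cubeNorm p' α ψ *
        eLpNorm (fun x => eweight (-α) (h • x) * ‖f x‖ₑ) p volume) := by
  have hm : AEMeasurable fun x => eweight (-α) (h • x) * ‖f x‖ₑ :=
    ((measurable_eweight _).comp (by fun_prop)).aemeasurable.mul hf.enorm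
  refine le_trans ?_ (mul_le_mul_right (eLpNorm_lintegral_shift_mul_le
    (aemeasurable_weightedEnorm (α := α) hψ) hm hpp' hfin) _)
  refine eLpNorm_le_const_mul ENNReal.ofReal_ne_top (fun k => ?_) p
  rw [enorm_eq_self, enorm_eq_self, ← lintegral_const_mul' _ _ (eweight_ne_top _ _),
    ← lintegral_const_mul' _ _ ENNReal.ofReal_ne_top]
  refine lintegral_mono fun x => ?_
  -- The reverse split `h k = h (x - (x - k))`; evenness of the weight removes the sign.
  have h1 := eweight_smul_add_le hα h x (-(x - latticePoint k))
  rw [eweight_neg_apply, neg_sub, add_sub_cancel] at h1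
  calc _ ≤ (ENNReal.ofReal (moderateConst α h) * eweight (-α) (h • x) *
        eweight α (x - latticePoint k)) * (‖f x‖ₑ * ‖ψ (x - latticePoint k)‖ₑ) := by gcongr
    _ = _ := by unfold weightedEnorm; ring

lemma lintegral_weightedEnorm {α : ℝ} {f : Euc d → ℂ} (hf : AEStronglyMeasurable f volume) :
    ∫⁻ x, weightedEnorm α f x = cubeNorm 1 α f := by
  rw [cubeNorm, eLpNorm_one_eq_lintegral_enorm, ← lintegral_unitCube_tsum
    (aemeasurable_weightedEnorm hf)]
  simp

lemma enorm_le_weightedEnorm {α : ℝ} (hα : 0 ≤ α) (f : Euc d → ℂ) (x : Euc d) :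
    ‖f x‖ₑ ≤ weightedEnorm α f x := by
  calc ‖f x‖ₑ = 1 * ‖f x‖ₑ := (one_mul _).symm
    _ ≤ _ := mul_le_mul_left (one_le_eweight hα x) _

lemma memLp_one_of_cubeNorm {α : ℝ} (hα : 0 ≤ α) {f : Euc d → ℂ}
    (hf : AEStronglyMeasurable f volume) (hfin : cubeNorm 1 α f ≠ ∞) : Integrable f := by
  refine ⟨hf, lt_of_le_of_lt ?_ hfin.lt_top⟩
  rw [← lintegral_weightedEnorm hf]
  exact lintegral_mono fun x => enorm_le_weightedEnorm hα f x

/-- Unfolding turns one factor into a second periodization. This integral dominates both the squared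
`L_2` norm and, up to a constant, the weighted `ℓ_1` norm of the autocorrelation. -/
lemma lintegral_weightedEnorm_mul_periodize {α : ℝ} {f : Euc d → ℂ}
    (hf : AEStronglyMeasurable f volume) :
    ∫⁻ x, weightedEnorm α f x * periodize (weightedEnorm α f) x = cubeNorm 2 α f ^ 2 := by
  have hm := aemeasurable_weightedEnorm (α := α) hf
  rw [lintegral_mul_periodic hm (aemeasurable_periodize hm) (periodize_add _), cubeNorm,
    eLpNorm_eq_lintegral_rpow_enorm_toReal two_ne_zero ENNReal.ofNat_ne_top, ← ENNReal.rpow_natCast,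
    ← ENNReal.rpow_mul]
  simp [← sq]

lemma memLp_two_of_cubeNorm {α : ℝ} (hα : 0 ≤ α) {f : Euc d → ℂ}
    (hf : AEStronglyMeasurable f volume) (hfin : cubeNorm 2 α f ≠ ∞) : MemLp f 2 := by
  refine ⟨hf, ?_⟩
  rw [eLpNorm_lt_top_iff_lintegral_rpow_enorm_lt_top two_ne_zero ENNReal.ofNat_ne_top]
  refine lt_of_le_of_lt ?_ (ENNReal.pow_lt_top hfin.lt_top : cubeNorm 2 α f ^ 2 < ∞)
  rw [← lintegral_weightedEnorm_mul_periodize hf]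
  refine lintegral_mono fun x => ?_
  have h1 := enorm_le_weightedEnorm hα f x
  have h2 : weightedEnorm α f x ≤ periodize (weightedEnorm α f) x := by
    refine le_trans ?_ (ENNReal.le_tsum 0)
    rw [latticePoint_zero, add_zero]
  simp only [ENNReal.toReal_ofNat, ENNReal.rpow_ofNat, sq]
  exact mul_le_mul' h1 (h1.trans h2)

/-- The autocorrelation sequence `⟨φ, φ(· - k)⟩`. -/
noncomputable def autocorr (φ : Euc d → ℂ) (k : Fin d → ℤ) : ℂ :=
  ∫ y, φ y * conj (φ (y - latticePoint k))

/-- Writing `k = x - (x - k)` distributes the weight over both factors under the integral; the sum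
over `k` is then a periodization. -/
lemma tsum_eweight_mul_enorm_autocorr_le {α : ℝ} (hα : 0 ≤ α) {φ : Euc d → ℂ}
    (hφ : AEStronglyMeasurable φ volume) :
    ∑' k, eweight α (latticePoint k) * ‖autocorr φ k‖ₑ ≤
      ENNReal.ofReal (2 ^ (α / 2)) * cubeNorm 2 α φ ^ 2 := by
  have hm := aemeasurable_weightedEnorm (α := α) hφ
  have hmk : ∀ k : Fin d → ℤ, AEMeasurable fun x => weightedEnorm α φ (x - latticePoint k) :=
    fun k => aemeasurable_comp_sub hm _
  rw [← lintegral_weightedEnorm_mul_periodize hφ]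
  simp only [← tsum_sub_eq_periodize, ← ENNReal.tsum_mul_left]
  rw [lintegral_tsum (f := fun k x => weightedEnorm α φ x * weightedEnorm α φ (x - latticePoint k))
    fun k => hm.mul (hmk k), ← ENNReal.tsum_mul_left]
  refine ENNReal.tsum_le_tsum fun k => ?_
  rw [← lintegral_const_mul' _ _ ENNReal.ofReal_ne_top]
  refine (mul_le_mul_right (enorm_integral_le_lintegral_enorm _) _).trans ?_
  rw [← lintegral_const_mul' _ _ (eweight_ne_top _ _)]
  refine lintegral_mono fun x => ?_
  have h1 := eweight_add_le hα x (-(x - latticePoint k))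
  rw [eweight_neg_apply, neg_sub, add_sub_cancel] at h1
  rw [enorm_mul, RCLike.enorm_conj]
  calc _ ≤ (ENNReal.ofReal (2 ^ (α / 2)) * eweight α x * eweight α (x - latticePoint k)) *
        (‖φ x‖ₑ * ‖φ (x - latticePoint k)‖ₑ) := by gcongr
    _ = _ := by unfold weightedEnorm; ring

/-- The modulus of a semi-discrete convolution with an `ℓ_{1,α}` sequence. -/
lemma periodize_weightedEnorm_conv_le {α : ℝ} (hα : 0 ≤ α) {φ ψ : Euc d → ℂ}
    {b : (Fin d → ℤ) → ℂ} (hψ : ∀ x, ‖ψ x‖ₑ ≤ ∑' k, ‖b k‖ₑ * ‖φ (x - latticePoint k)‖ₑ)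
    (x : Euc d) :
    periodize (weightedEnorm α ψ) x ≤ (ENNReal.ofReal (2 ^ (α / 2)) *
      ∑' k, eweight α (latticePoint k) * ‖b k‖ₑ) * periodize (weightedEnorm α φ) x := by
  have h1 : ∀ y, weightedEnorm α ψ y ≤ ∑' k, ENNReal.ofReal (2 ^ (α / 2)) *
      (eweight α (latticePoint k) * ‖b k‖ₑ) * weightedEnorm α φ (y - latticePoint k) := fun y => by
    refine (mul_le_mul_right (hψ y) _).trans ?_
    rw [← ENNReal.tsum_mul_left]
    refine ENNReal.tsum_le_tsum fun k => ?_
    have h1 := eweight_add_le hα (latticePoint k) (y - latticePoint k)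
    rw [add_sub_cancel] at h1
    calc _ ≤ (ENNReal.ofReal (2 ^ (α / 2)) * eweight α (latticePoint k) *
          eweight α (y - latticePoint k)) * (‖b k‖ₑ * ‖φ (y - latticePoint k)‖ₑ) := by gcongr
      _ = _ := by unfold weightedEnorm; ring
  refine (ENNReal.tsum_le_tsum fun l => h1 (x + latticePoint l)).trans ?_
  rw [ENNReal.tsum_comm, ← ENNReal.tsum_mul_left, ← ENNReal.tsum_mul_right]
  refine ENNReal.tsum_le_tsum fun k => ?_
  rw [ENNReal.tsum_mul_left]
  refine mul_le_mul_right (le_of_eq ?_) _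
  rw [← periodize_sub _ x k, periodize]
  simp only [sub_add_eq_add_sub]

lemma cubeNorm_conv_lt_top {α : ℝ} (hα : 0 ≤ α) {φ ψ : Euc d → ℂ}
    {b : (Fin d → ℤ) → ℂ} (hψ : ∀ x, ‖ψ x‖ₑ ≤ ∑' k, ‖b k‖ₑ * ‖φ (x - latticePoint k)‖ₑ)
    (hb : ∑' k, eweight α (latticePoint k) * ‖b k‖ₑ ≠ ∞) {r : ℝ≥0∞} (hφ : cubeNorm r α φ < ∞) :
    cubeNorm r α ψ < ∞ :=
  (eLpNorm_le_const_mul (ENNReal.mul_ne_top ENNReal.ofReal_ne_top hb)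
    (fun x => by simpa using periodize_weightedEnorm_conv_le hα hψ x) r).trans_lt
    (ENNReal.mul_lt_top (ENNReal.mul_lt_top ENNReal.ofReal_lt_top hb.lt_top) hφ)

end WeightedShiftInvariant

/-! ### The inverse autocorrelation and the biorthogonal kernel. -/

namespace WeightedShiftInvariant

variable {d : ℕ}

lemma tsum_eweight_ne_top_iff {α : ℝ} {a : (Fin d → ℤ) → ℂ} :
    ∑' k, eweight α (latticePoint k) * ‖a k‖ₑ ≠ ∞ ↔
      Summable fun k => weight α (latticePoint k) * ‖a k‖ := by
  have e : ∀ k, eweight α (latticePoint k) * ‖a k‖ₑ =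
      ENNReal.ofReal (weight α (latticePoint k) * ‖a k‖) := fun k => by
    rw [ENNReal.ofReal_mul (weight_pos _ _).le, ofReal_norm, eweight]
  simp only [e]
  refine ⟨fun h => ?_, fun h => h.tsum_ofReal_ne_top⟩
  refine (ENNReal.summable_toReal h).congr fun k => ?_
  rw [ENNReal.toReal_ofReal (mul_nonneg (weight_pos _ _).le (norm_nonneg _))]

lemma aestronglyMeasurable_shift {f : Euc d → ℂ} (hf : AEStronglyMeasurable f volume) (v : Euc d) :
    AEStronglyMeasurable (fun x => f (x - v)) volume :=
  hf.comp_measurePreserving (measurePreserving_sub_right volume v)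

lemma memLp_shift {f : Euc d → ℂ} {p : ℝ≥0∞} (hf : MemLp f p) (v : Euc d) :
    MemLp (fun x => f (x - v)) p :=
  hf.comp_measurePreserving (measurePreserving_sub_right volume v)

lemma integral_shift_mul_conj_shift (φ : Euc d → ℂ) (k l : Fin d → ℤ) :
    ∫ x, φ (x - latticePoint k) * conj (φ (x - latticePoint l)) = autocorr φ (l - k) := by
  rw [autocorr, ← integral_sub_right_eq_self
    (fun y => φ y * conj (φ (y - latticePoint (l - k)))) (latticePoint k)]
  refine integral_congr_ae (Filter.Eventually.of_forall fun x => ?_)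
  simp only [latticePoint_sub, sub_sub_sub_cancel_right]

lemma autocorr_neg (φ : Euc d → ℂ) (k : Fin d → ℤ) : autocorr φ (-k) = conj (autocorr φ k) := by
  have h := integral_shift_mul_conj_shift φ k 0
  rw [zero_sub] at h
  rw [← h, autocorr, ← integral_conj]
  refine integral_congr_ae (Filter.Eventually.of_forall fun x => ?_)
  simp [latticePoint_zero, mul_comm]

lemma gram_shift {φ : Euc d → ℂ} (hφ : MemLp φ 2) (n k : Fin d → ℤ) :
    inner ℂ ((memLp_shift hφ (latticePoint n)).toLp) ((memLp_shift hφ (latticePoint k)).toLp) =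
      autocorr φ (n - k) := by
  rw [L2.inner_def, ← integral_shift_mul_conj_shift]
  refine integral_congr_ae ?_
  filter_upwards [(memLp_shift hφ (latticePoint n)).coeFn_toLp,
    (memLp_shift hφ (latticePoint k)).coeFn_toLp] with x h1 h2
  rw [h1, h2, RCLike.inner_apply]

/-- Finitely supported coefficients turn the series of the Riesz condition into finite sums in the
Hilbert space, the form required by `convOp_gram_bounds`. -/
lemma norm_sum_shift_bounds {φ : Euc d → ℂ} (hφ : MemLp φ 2) {A B : ℝ} (hB : 0 ≤ B)
    (hAB : ∀ c : lp (fun _ : Fin d → ℤ => ℂ) 2,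
      (∀ᵐ x, Summable (shiftTerm φ 1 c x)) ∧
      ENNReal.ofReal (A * ‖c‖) ≤ eLpNorm (fun x => ∑' k, shiftTerm φ 1 c x k) 2 volume ∧
      eLpNorm (fun x => ∑' k, shiftTerm φ 1 c x k) 2 volume ≤ ENNReal.ofReal (B * ‖c‖))
    (s : Finset (Fin d → ℤ)) (x : (Fin d → ℤ) → ℂ) :
    A * ‖∑ k ∈ s, lp.single (E := fun _ : Fin d → ℤ => ℂ) 2 k (x k)‖ ≤
        ‖∑ k ∈ s, x k • (memLp_shift hφ (latticePoint k)).toLp‖ ∧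
      ‖∑ k ∈ s, x k • (memLp_shift hφ (latticePoint k)).toLp‖ ≤
        B * ‖∑ k ∈ s, lp.single (E := fun _ : Fin d → ℤ => ℂ) 2 k (x k)‖ := by
  set c := ∑ k ∈ s, lp.single (E := fun _ : Fin d → ℤ => ℂ) 2 k (x k) with hc
  have hck : ∀ k, c k = if k ∈ s then x k else 0 := fun k => by
    rw [hc, lp.coeFn_sum, Finset.sum_apply]
    simp [Pi.single_apply]
  have hts : ∀ y, ∑' k, shiftTerm φ 1 c y k = ∑ k ∈ s, x k * φ (y - latticePoint k) := fun y => by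
    rw [tsum_eq_sum (s := s) fun k hk => by simp [shiftTerm, hck, hk]]
    refine Finset.sum_congr rfl fun k hk => ?_
    simp [shiftTerm, hck, hk]
  have hae : (∑ k ∈ s, x k • (memLp_shift hφ (latticePoint k)).toLp :
      Lp ℂ 2 (volume : Measure (Euc d))) =ᵐ[volume] fun y => ∑' k, shiftTerm φ 1 c y k := by
    have h1 : ∀ᵐ y, ∀ k : Fin d → ℤ, (x k • (memLp_shift hφ (latticePoint k)).toLp :
        Lp ℂ 2 (volume : Measure (Euc d))) y = x k * φ (y - latticePoint k) := by
      refine ae_all_iff.2 fun k => ?_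
      filter_upwards [Lp.coeFn_smul (x k) ((memLp_shift hφ (latticePoint k)).toLp),
        (memLp_shift hφ (latticePoint k)).coeFn_toLp] with y h1 h2
      rw [h1, Pi.smul_apply, h2, smul_eq_mul]
    filter_upwards [Lp.coeFn_fun_finsetSum s fun k => x k • (memLp_shift hφ (latticePoint k)).toLp,
      h1] with y h2 h3
    rw [h2, hts]
    exact Finset.sum_congr rfl fun k _ => h3 k
  have hnorm : ENNReal.ofReal ‖∑ k ∈ s, x k • (memLp_shift hφ (latticePoint k)).toLp‖ =
      eLpNorm (fun y => ∑' k, shiftTerm φ 1 c y k) 2 volume := by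
    rw [Lp.norm_def, ENNReal.ofReal_toReal (Lp.eLpNorm_ne_top _), eLpNorm_congr_ae hae]
  obtain ⟨-, h1, h2⟩ := hAB c
  rw [← hnorm] at h1 h2
  exact ⟨(ENNReal.ofReal_le_ofReal_iff (norm_nonneg _)).1 h1,
    (ENNReal.ofReal_le_ofReal_iff (by positivity)).1 h2⟩

/-- The autocorrelation of a Riesz generator is invertible in the weighted convolution algebra. -/
theorem exists_autocorr_inverse {α : ℝ} (hα : 0 ≤ α) {φ : Euc d → ℂ}
    (hfin : cubeNorm 2 α φ < ∞) (hR : IsRieszBasisOfShifts φ) :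
    ∃ b : (Fin d → ℤ) → ℂ, ∑' k, eweight α (latticePoint k) * ‖b k‖ₑ ≠ ∞ ∧
      ∀ n, HasSum (fun k => autocorr φ k * b (n - k)) (Pi.single (M := fun _ => ℂ) 0 1 n) := by
  obtain ⟨hφ, A, B, hA, hB, hAB⟩ := hR
  have ha : Summable fun k => weight α (latticePoint k) * ‖autocorr φ k‖ := by
    refine tsum_eweight_ne_top_iff.1 (ne_top_of_le_ne_top ?_
      (tsum_eweight_mul_enorm_autocorr_le hα hφ.1))
    exact ENNReal.mul_ne_top ENNReal.ofReal_ne_top (ENNReal.pow_ne_top hfin.ne)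
  have ha1 : Summable fun k => (1 : ℝ) * ‖autocorr φ k‖ := by
    refine Summable.of_nonneg_of_le (fun k => by positivity) (fun k => ?_) ha
    have := one_le_weight hα (latticePoint k)
    gcongr
  have hQ := convOp_gram_bounds ha1 (gram_shift hφ) hA.le
    (norm_sum_shift_bounds hφ hB.le hAB)
  -- Tested on a unit mass.
  have hAB' : A ^ 2 ≤ B ^ 2 := by
    obtain ⟨t, -, h1, h2⟩ := hQ (lp.single 2 0 1)
    have h3 : ‖lp.single (E := fun _ : Fin d → ℤ => ℂ) 2 0 1‖ = 1 := by
      rw [lp.norm_single (by norm_num)]; simp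
    rw [h3] at h1 h2
    linarith
  have hlt := norm_one_sub_smul_lt_one _ (by positivity : 0 < A ^ 2) hAB' hQ
  obtain ⟨b, hb, hab⟩ := (moderateWeight_latticePoint (d := d) hα).exists_convolution_inverse
    (sum_weight_nsmul_le α) ha _ hlt
  exact ⟨b, tsum_eweight_ne_top_iff.2 hb, hab⟩

/-- The semi-discrete convolution `∑ b[k] φ(· - k)`. -/
noncomputable def semiConv (b : (Fin d → ℤ) → ℂ) (φ : Euc d → ℂ) (x : Euc d) : ℂ :=
  ∑' k, b k * φ (x - latticePoint k)

lemma enorm_semiConv_le (b : (Fin d → ℤ) → ℂ) (φ : Euc d → ℂ) (x : Euc d) :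
    ‖semiConv b φ x‖ₑ ≤ ∑' k, ‖b k‖ₑ * ‖φ (x - latticePoint k)‖ₑ :=
  enorm_tsum_le_tsum_enorm.trans_eq (tsum_congr fun _ => enorm_mul _ _)

lemma aestronglyMeasurable_semiConv (b : (Fin d → ℤ) → ℂ) {φ : Euc d → ℂ}
    (hφ : AEStronglyMeasurable φ volume) : AEStronglyMeasurable (semiConv b φ) volume :=
  (AEMeasurable.tsum fun _ => ((aestronglyMeasurable_shift hφ _).aemeasurable.const_mul
    _)).aestronglyMeasurable

lemma lintegral_enorm_mul_enorm_le {f g : Euc d → ℂ} (hf : AEStronglyMeasurable f volume)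
    (hg : AEStronglyMeasurable g volume) (k l : Fin d → ℤ) :
    ∫⁻ x, ‖f (x - latticePoint k)‖ₑ * ‖g (x - latticePoint l)‖ₑ ≤
      eLpNorm f 2 volume * eLpNorm g 2 volume := by
  have h := ENNReal.lintegral_mul_le_Lp_mul_Lq volume Real.HolderConjugate.two_two
    (aestronglyMeasurable_shift hf (latticePoint k)).enorm
    (aestronglyMeasurable_shift hg (latticePoint l)).enorm
  rw [lintegral_sub_right_eq_self fun x => ‖f x‖ₑ ^ (2 : ℝ),
    lintegral_sub_right_eq_self fun x => ‖g x‖ₑ ^ (2 : ℝ)] at h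
  rw [eLpNorm_eq_lintegral_rpow_enorm_toReal two_ne_zero ENNReal.ofNat_ne_top,
    eLpNorm_eq_lintegral_rpow_enorm_toReal two_ne_zero ENNReal.ofNat_ne_top]
  exact h

/-- Biorthogonality of the shifts of `φ` and of the dual generator. -/
lemma integral_shift_mul_conj_semiConv {φ : Euc d → ℂ} (hφ : MemLp φ 2)
    {b : (Fin d → ℤ) → ℂ} (hb : ∑' k, ‖b k‖ₑ ≠ ∞)
    (hab : ∀ n, HasSum (fun k => autocorr φ k * b (n - k)) (Pi.single (M := fun _ => ℂ) 0 1 n))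
    (k l : Fin d → ℤ) :
    ∫ x, φ (x - latticePoint k) * conj (semiConv b φ (x - latticePoint l)) =
      Pi.single (M := fun _ => ℂ) l 1 k := by
  have e1 : ∀ x, φ (x - latticePoint k) * conj (semiConv b φ (x - latticePoint l)) =
      ∑' j, conj (b j) * (φ (x - latticePoint k) * conj (φ (x - latticePoint (l + j)))) :=
    fun x => by
      rw [semiConv, Complex.conj_tsum, ← tsum_mul_left]
      refine tsum_congr fun j => ?_
      rw [map_mul, latticePoint_add, sub_sub]
      ring
  have hs := fun v : Fin d → ℤ => aestronglyMeasurable_shift hφ.1 (latticePoint v)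
  -- Summation and integration may be exchanged: Cauchy–Schwarz bounds each integral uniformly, and
  -- `b` is summable.
  have hfin : ∑' j, ∫⁻ x, ‖conj (b j) *
      (φ (x - latticePoint k) * conj (φ (x - latticePoint (l + j))))‖ₑ ≠ ∞ := by
    have : ∑' j, ‖b j‖ₑ * (eLpNorm φ 2 volume * eLpNorm φ 2 volume) ≠ ∞ := by
      rw [ENNReal.tsum_mul_right]
      exact ENNReal.mul_ne_top hb (ENNReal.mul_ne_top hφ.2.ne hφ.2.ne)
    refine ne_top_of_le_ne_top this (ENNReal.tsum_le_tsum fun j => ?_)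
    simp only [enorm_mul, RCLike.enorm_conj]
    rw [lintegral_const_mul' _ _ enorm_ne_top]
    exact mul_le_mul_right (lintegral_enorm_mul_enorm_le hφ.1 hφ.1 k (l + j)) _
  have hm : ∀ j, AEStronglyMeasurable (fun x => conj (b j) * (φ (x - latticePoint k) *
      conj (φ (x - latticePoint (l + j))))) volume := fun j =>
    ((hs k).mul (RCLike.continuous_conj.comp_aestronglyMeasurable (hs (l + j)))).const_mul _
  simp only [e1]
  rw [integral_tsum hm hfin]
  -- The sum over `j` becomes the conjugate of `(a * b)[k - l]`.
  have e2 : ∀ j, ∫ x, conj (b j) * (φ (x - latticePoint k) * conj (φ (x - latticePoint (l + j)))) =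
      conj (autocorr φ (k - l - j) * b j) := fun j => by
    rw [integral_const_mul, integral_shift_mul_conj_shift, map_mul, ← autocorr_neg, mul_comm]
    congr 2
    abel
  simp only [e2]
  have h := (Equiv.subLeft (k - l)).hasSum_iff.2 (hab (k - l))
  have h' : HasSum (fun j => autocorr φ (k - l - j) * b j)
      (Pi.single (M := fun _ => ℂ) (0 : Fin d → ℤ) (1 : ℂ) (k - l)) := by
    convert h using 1
    ext j
    simp
  rw [← Complex.conj_tsum, h'.tsum_eq]
  rcases eq_or_ne k l with rfl | hkl
  · simp
  · rw [Pi.single_eq_of_ne hkl, Pi.single_eq_of_ne (sub_ne_zero.2 hkl), map_zero]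

/-- The analysis coefficients of a semi-discrete convolution with `φ`, taken with a kernel whose
shifts are biorthogonal to those of `φ`. -/
lemma integral_semiConv_mul_conj {φ ψ : Euc d → ℂ} (hφ : AEStronglyMeasurable φ volume)
    (hψ : AEStronglyMeasurable ψ volume)
    (hbi : ∀ k l : Fin d → ℤ, ∫ x, φ (x - latticePoint k) * conj (ψ (x - latticePoint l)) =
      Pi.single (M := fun _ => ℂ) l 1 k) {c : (Fin d → ℤ) → ℂ} (l : Fin d → ℤ)
    (hfin : ∫⁻ x, (∑' k, ‖c k‖ₑ * ‖φ (x - latticePoint k)‖ₑ) * ‖ψ (x - latticePoint l)‖ₑ ≠ ∞) :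
    ∫ x, semiConv c φ x * conj (ψ (x - latticePoint l)) = c l := by
  have hs := fun v : Fin d → ℤ => aestronglyMeasurable_shift hφ (latticePoint v)
  have ht := aestronglyMeasurable_shift hψ (latticePoint l)
  have e1 : ∀ x, semiConv c φ x * conj (ψ (x - latticePoint l)) =
      ∑' k, c k * (φ (x - latticePoint k) * conj (ψ (x - latticePoint l))) := fun x => by
    rw [semiConv, ← tsum_mul_right]
    exact tsum_congr fun k => by ring
  have hm : ∀ k, AEStronglyMeasurable (fun x => c k * (φ (x - latticePoint k) *
      conj (ψ (x - latticePoint l)))) volume := fun k =>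
    ((hs k).mul (RCLike.continuous_conj.comp_aestronglyMeasurable ht)).const_mul _
  simp only [e1]
  rw [integral_tsum hm]
  · simp only [integral_const_mul, hbi]
    rw [tsum_eq_single l fun k hk => by rw [Pi.single_eq_of_ne hk, mul_zero], Pi.single_eq_same,
      mul_one]
  · rw [← lintegral_tsum fun k => (hm k).enorm]
    refine ne_top_of_le_ne_top hfin (le_of_eq (lintegral_congr fun x => ?_))
    rw [← ENNReal.tsum_mul_right]
    refine tsum_congr fun k => ?_
    rw [enorm_mul, enorm_mul, RCLike.enorm_conj, mul_assoc]

end WeightedShiftInvariant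

/-! ### Fourier uniqueness on the torus and unfolding of Bochner integrals. -/

namespace WeightedShiftInvariant

variable {d : ℕ}

section Torus

open UnitAddTorus Filter Topology

/-- The normalized Haar measure on the torus. -/
noncomputable def torusMeasure (d : ℕ) : Measure (UnitAddTorus (Fin d)) :=
  Measure.pi fun _ => AddCircle.haarAddCircle

instance : IsProbabilityMeasure (torusMeasure d) :=
  inferInstanceAs (IsProbabilityMeasure (Measure.pi fun _ => AddCircle.haarAddCircle))

/-- An integrable function on the torus is determined by its Fourier coefficients. -/
lemma ae_eq_zero_of_integral_mFourier_mul {g : UnitAddTorus (Fin d) → ℂ} (hg : Integrable g (torusMeasure d))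
    (h : ∀ n : Fin d → ℤ, ∫ t, mFourier n t * g t ∂torusMeasure d = 0) : g =ᵐ[torusMeasure d] 0 := by
  have hint : ∀ f : C(UnitAddTorus (Fin d), ℂ), Integrable (fun t => f t * g t) (torusMeasure d) := fun f =>
    hg.bdd_mul f.continuous.aestronglyMeasurable
      (Eventually.of_forall fun t => f.norm_coe_le_norm t)
  let T : C(UnitAddTorus (Fin d), ℂ) →L[ℂ] ℂ := LinearMap.mkContinuous
    { toFun := fun f => ∫ t, f t * g t ∂torusMeasure d
      map_add' := fun f₁ f₂ => by
        simp only [ContinuousMap.add_apply, add_mul]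
        exact integral_add (hint f₁) (hint f₂)
      map_smul' := fun a f => by
        simp only [ContinuousMap.smul_apply, smul_eq_mul, mul_assoc, RingHom.id_apply]
        exact integral_const_mul _ _ } (∫ t, ‖g t‖ ∂torusMeasure d) (fun f => by
      refine (norm_integral_le_integral_norm _).trans ?_
      rw [mul_comm, ← integral_const_mul]
      refine integral_mono (hint f).norm (hg.norm.const_mul _) fun t => ?_
      change ‖f t * g t‖ ≤ ‖f‖ * ‖g t‖
      rw [norm_mul]
      gcongr
      exact f.norm_coe_le_norm t)
  -- Trigonometric polynomials are uniformly dense in the continuous functions, and the functional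
  -- vanishes on them.
  have hT : ∀ f, T f = 0 := fun f => by
    have hle : (Submodule.span ℂ (range (mFourier (d := Fin d)))).topologicalClosure ≤
        LinearMap.ker (T : C(UnitAddTorus (Fin d), ℂ) →ₗ[ℂ] ℂ) := by
      refine Submodule.topologicalClosure_minimal _ ?_ T.isClosed_ker
      rw [Submodule.span_le]
      rintro _ ⟨n, rfl⟩
      exact h n
    rw [span_mFourier_closure_eq_top] at hle
    exact hle (Submodule.mem_top (x := f))
  refine ae_eq_zero_of_forall_setIntegral_isClosed_eq_zero hg fun s hs => ?_
  have hpos : ∀ n : ℕ, (0 : ℝ) < 1 / (n + 1) := fun n => Nat.one_div_pos_of_nat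
  have hlim := tendsto_pi_nhds.1 (thickenedIndicator_tendsto_indicator_closure hpos
    tendsto_one_div_add_atTop_nhds_zero_nat s)
  rw [hs.closure_eq] at hlim
  -- Continuous approximations of the indicator of a closed set carry the vanishing over to its
  -- integral.
  let χ : ℕ → C(UnitAddTorus (Fin d), ℂ) := fun n =>
    ⟨fun t => ((thickenedIndicator (hpos n) s t : NNReal) : ℝ), by fun_prop⟩
  have hdct : Tendsto (fun n => ∫ t, χ n t * g t ∂torusMeasure d) atTop
      (𝓝 (∫ t, s.indicator g t ∂torusMeasure d)) := by
    refine tendsto_integral_of_dominated_convergence (fun t => ‖g t‖)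
      (fun n => (hint (χ n)).aestronglyMeasurable) hg.norm (fun n => ?_) ?_
    · refine Eventually.of_forall fun t => ?_
      have h1 : ‖χ n t‖ ≤ 1 := by
        change ‖(((thickenedIndicator (hpos n) s t : NNReal) : ℝ) : ℂ)‖ ≤ 1
        rw [Complex.norm_real, Real.norm_of_nonneg (NNReal.coe_nonneg _)]
        exact_mod_cast thickenedIndicator_le_one (hpos n) s t
      rw [norm_mul]
      exact mul_le_of_le_one_left (norm_nonneg _) h1
    · refine Eventually.of_forall fun t => ?_
      have e : s.indicator g t = (((s.indicator (fun _ => (1 : NNReal)) t : NNReal) : ℝ) : ℂ) *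
          g t := by
        by_cases ht : t ∈ s <;> simp [ht]
      rw [e]
      refine Tendsto.mul_const _ ?_
      exact (Complex.continuous_ofReal.comp NNReal.continuous_coe).tendsto _ |>.comp (hlim t)
  rw [← integral_indicator hs.measurableSet]
  refine tendsto_nhds_unique hdct ?_
  refine tendsto_const_nhds.congr fun n => ?_
  exact (hT (χ n)).symm

lemma integral_mFourier (n : Fin d → ℤ) :
    ∫ t, mFourier n t ∂torusMeasure d = Pi.single (M := fun _ => ℂ) 0 1 n := by
  have h := orthonormal_iff_ite.1 (orthonormal_mFourier (d := Fin d)) 0 n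
  rw [mFourierLp, mFourierLp, ContinuousMap.inner_toLp] at h
  simp only [mFourier_zero, ContinuousMap.one_apply, map_one, mul_one] at h
  refine h.trans ?_
  rw [Pi.single_apply]
  simp only [eq_comm]

/-- The section of the projection onto the torus with values in the unit cube. -/
noncomputable def torusSection (t : UnitAddTorus (Fin d)) : Euc d :=
  WithLp.toLp 2 (measurableEquivPiIoc (fun _ => (0 : ℝ)) t).1

lemma measurePreserving_torusSection :
    MeasurePreserving (torusSection (d := d)) (torusMeasure d) (volume.restrict (unitCube d)) := by
  have h1 := measurePreserving_equivPiIoc (fun _ : Fin d => (0 : ℝ))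
  have hm : MeasurableSet {x : Fin d → ℝ | ∀ i, x i ∈ Ioc (0 : ℝ) (0 + 1)} :=
    MeasurableSet.univ_pi' (fun i => measurableSet_Ioc)
  have h2 : MeasurePreserving (Subtype.val : {x : Fin d → ℝ // ∀ i, x i ∈ Ioc (0 : ℝ) (0 + 1)} → _)
      (Measure.comap Subtype.val volume)
      (volume.restrict {x : Fin d → ℝ | ∀ i, x i ∈ Ioc (0 : ℝ) (0 + 1)}) :=
    ⟨measurable_subtype_coe, map_comap_subtype_coe hm volume⟩
  have h3 := (PiLp.volume_preserving_toLp (Fin d)).restrict_preimage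
    (measurableSet_unitCube (d := d))
  have e : (WithLp.toLp 2 : (Fin d → ℝ) → Euc d) ⁻¹' unitCube d =
      {x : Fin d → ℝ | ∀ i, x i ∈ Ioc (0 : ℝ) (0 + 1)} := by
    ext x
    simp [unitCube]
  rw [e] at h3
  exact h3.comp (h2.comp h1)

/-- The character `ξ ↦ e^{2πi⟨k, ξ⟩}`. -/
noncomputable def latticeChar (k : Fin d → ℤ) (ξ : Euc d) : ℂ :=
  Real.fourierChar (inner ℝ (latticePoint k) ξ)

lemma latticeChar_eq_exp (k : Fin d → ℤ) (ξ : Euc d) :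
    latticeChar k ξ = Complex.exp (2 * Real.pi * Complex.I * ∑ i, (k i : ℂ) * ξ i) := by
  rw [latticeChar, Real.fourierChar_apply, PiLp.inner_apply]
  congr 1
  simp only [RCLike.inner_apply, latticePoint_apply]
  push_cast
  rw [mul_right_comm]
  congr 1
  exact Finset.sum_congr rfl fun i _ => by simp [mul_comm]

lemma continuous_latticeChar (k : Fin d → ℤ) : Continuous (latticeChar k) := by
  unfold latticeChar
  fun_prop

lemma norm_latticeChar (k : Fin d → ℤ) (ξ : Euc d) : ‖latticeChar k ξ‖ = 1 := by
  rw [latticeChar, Circle.norm_coe]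

lemma latticeChar_add (k : Fin d → ℤ) (ξ : Euc d) (l : Fin d → ℤ) :
    latticeChar k (ξ + latticePoint l) = latticeChar k ξ := by
  rw [latticeChar_eq_exp, latticeChar_eq_exp, Complex.exp_eq_exp_iff_exists_int]
  refine ⟨∑ i, k i * l i, ?_⟩
  simp only [PiLp.add_apply, latticePoint_apply, Complex.ofReal_add, mul_add,
    Finset.sum_add_distrib, Complex.ofReal_intCast]
  push_cast
  ring

lemma mFourier_eq_latticeChar (k : Fin d → ℤ) (t : UnitAddTorus (Fin d)) :
    mFourier k t = latticeChar k (torusSection t) := by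
  have h : ∀ i, t i = ((torusSection t i : ℝ) : UnitAddCircle) := fun i =>
    (AddCircle.coe_equivIoc (p := (1 : ℝ)) (a := 0) (y := t i)).symm
  rw [latticeChar_eq_exp, Finset.mul_sum, Complex.exp_sum, mFourier, ContinuousMap.coe_mk]
  refine Finset.prod_congr rfl fun i _ => ?_
  rw [h i, fourier_coe_apply]
  congr 1
  push_cast
  ring

/-- A periodic function on the unit cube whose Fourier coefficients are those of `1` equals `1`. -/
lemma ae_eq_one_of_fourierCoeff {F : Euc d → ℂ} (hF : IntegrableOn F (unitCube d))
    (h : ∀ n : Fin d → ℤ, ∫ x in unitCube d, latticeChar n x * F x =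
      Pi.single (M := fun _ => ℂ) 0 1 n) : ∀ᵐ x ∂volume.restrict (unitCube d), F x = 1 := by
  have hmp := measurePreserving_torusSection (d := d)
  have hm := hF.aestronglyMeasurable
  have hint : Integrable (F ∘ torusSection) (torusMeasure d) := (hmp.integrable_comp hm).2 hF
  have hG : (fun t => F (torusSection t) - 1) =ᵐ[torusMeasure d] 0 := by
    refine ae_eq_zero_of_integral_mFourier_mul (hint.sub (integrable_const 1)) fun n => ?_
    have i1 : Integrable (fun t => mFourier n t * F (torusSection t)) (torusMeasure d) :=
      hint.bdd_mul (mFourier n).continuous.aestronglyMeasurable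
        (Eventually.of_forall fun t => (mFourier n).norm_coe_le_norm t)
    have i2 : Integrable (fun t => mFourier n t) (torusMeasure d) :=
      ((integrable_const (1 : ℂ)).bdd_mul (mFourier n).continuous.aestronglyMeasurable
        (Eventually.of_forall fun t => (mFourier n).norm_coe_le_norm t)).congr
        (Eventually.of_forall fun t => mul_one _)
    have e : ∫ t, mFourier n t * F (torusSection t) ∂torusMeasure d =
        ∫ x in unitCube d, latticeChar n x * F x := by
      rw [← hmp.map_eq, integral_map hmp.measurable.aemeasurable]
      · simp only [mFourier_eq_latticeChar]
      · rw [hmp.map_eq]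
        exact (continuous_latticeChar n).aestronglyMeasurable.mul hm
    simp only [mul_sub, mul_one]
    rw [integral_sub i1 i2, integral_mFourier, e, h, sub_self]
  have hm' : AEMeasurable (fun x => ‖F x - 1‖ₑ) (volume.restrict (unitCube d)) :=
    (hm.sub aestronglyMeasurable_const).enorm
  have hz : ∫⁻ x in unitCube d, ‖F x - 1‖ₑ = 0 := by
    rw [← hmp.map_eq] at hm' ⊢
    rw [lintegral_map' hm' hmp.measurable.aemeasurable]
    refine (lintegral_congr_ae ?_).trans lintegral_zero
    filter_upwards [hG] with t ht
    simpa using ht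
  rw [lintegral_eq_zero_iff' hm'] at hz
  filter_upwards [hz] with x hx
  simpa [sub_eq_zero] using hx

end Torus

section Periodization

lemma enorm_tsum_shift_le (G : Euc d → ℂ) (x : Euc d) :
    ‖∑' k : Fin d → ℤ, G (x + latticePoint k)‖ₑ ≤ periodize (fun y => ‖G y‖ₑ) x :=
  enorm_tsum_le_tsum_enorm

lemma aestronglyMeasurable_add {G : Euc d → ℂ} (hG : AEStronglyMeasurable G volume) (v : Euc d) :
    AEStronglyMeasurable (fun x => G (x + v)) volume :=
  hG.comp_measurePreserving (measurePreserving_add_right volume v)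

lemma integrableOn_periodization {G : Euc d → ℂ} (hG : Integrable G) :
    IntegrableOn (fun x => ∑' k : Fin d → ℤ, G (x + latticePoint k)) (unitCube d) := by
  refine ⟨(AEMeasurable.tsum fun k =>
    (aestronglyMeasurable_add hG.1 _).aemeasurable).restrict.aestronglyMeasurable, ?_⟩
  refine (lintegral_mono fun x => enorm_tsum_shift_le G x).trans_lt ?_
  rw [lintegral_unitCube_tsum hG.1.enorm]
  exact hG.2

lemma integral_unitCube_tsum {G : Euc d → ℂ} (hG : Integrable G) :
    ∫ x in unitCube d, ∑' k : Fin d → ℤ, G (x + latticePoint k) = ∫ x, G x := by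
  have hm : ∀ k : Fin d → ℤ,
      MeasurableSet ((fun x : Euc d => x + latticePoint k) ⁻¹' unitCube d) :=
    fun k => measurableSet_unitCube.preimage (by fun_prop)
  have hU : (⋃ k : Fin d → ℤ, (fun x : Euc d => x + latticePoint k) ⁻¹' unitCube d) = univ := by
    refine eq_univ_of_forall fun x => mem_iUnion.2 ?_
    exact (existsUnique_add_latticePoint_mem x).exists
  rw [integral_tsum fun k => (aestronglyMeasurable_add hG.1 _).restrict]
  · conv_rhs => rw [← setIntegral_univ, ← hU, integral_iUnion hm (fun k l hkl => by
      refine disjoint_left.2 fun x hx hx' => hkl ?_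
      exact (existsUnique_add_latticePoint_mem x).unique hx hx') hG.integrableOn]
    rw [← (Equiv.neg (Fin d → ℤ)).tsum_eq]
    refine tsum_congr fun k => ?_
    have := (measurePreserving_add_right volume (latticePoint k)).setIntegral_preimage_emb
      (measurableEmbedding_addRight _) (fun x => G (x + latticePoint (-k))) (unitCube d)
    rw [Equiv.neg_apply, ← this]
    simp [latticePoint_neg]
  · have h := lintegral_unitCube_tsum hG.1.enorm
    unfold periodize at h
    rw [lintegral_tsum fun k => (aemeasurable_comp_add hG.1.enorm _).restrict] at h
    rw [h]
    exact hG.2.ne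

end Periodization

end WeightedShiftInvariant

/-! ### The Plancherel transform and identification of the dual kernel. -/

namespace WeightedShiftInvariant

variable {d : ℕ}

lemma continuous_fourierIntegral {f : Euc d → ℂ} (hf : Integrable f) : Continuous (𝓕 f) :=
  VectorFourier.fourierIntegral_continuous Real.continuous_fourierChar
    (by exact continuous_inner) hf

/-- On `L₁ ∩ L₂` the Plancherel transform is given by the Fourier integral. -/
lemma fourier_toLp_ae_eq {f : Euc d → ℂ} (hf : Integrable f) (hf2 : MemLp f 2 volume) :
    -- Both sides are tested against smooth compactly supported functions: the `L_2` transform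
    -- agrees with that of tempered distributions, and the integral transform can be moved onto the
    -- test function.
    (𝓕 (hf2.toLp f) : Lp ℂ 2 (volume : Measure (Euc d))) =ᵐ[volume] 𝓕 f := by
  refine ae_eq_of_integral_contDiff_smul_eq
    ((Lp.memLp _).locallyIntegrable (by norm_num)) (continuous_fourierIntegral hf).locallyIntegrable
    fun g g_smooth g_cpt => ?_
  have hg₁ : HasCompactSupport (Complex.ofRealCLM ∘ g) := g_cpt.comp_left rfl
  have hg₂ : ContDiff ℝ (⊤ : ℕ∞) (Complex.ofRealCLM ∘ g) := by fun_prop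
  let G : SchwartzMap (Euc d) ℂ := hg₁.toSchwartzMap hg₂
  have hG : ∀ x, G x = (g x : ℂ) := fun x => rfl
  have h1 : ∫ x, g x • (𝓕 (hf2.toLp f) : Lp ℂ 2 (volume : Measure (Euc d))) x =
      Lp.toTemperedDistribution (𝓕 (hf2.toLp f) : Lp ℂ 2 (volume : Measure (Euc d))) G := by
    rw [Lp.toTemperedDistribution_apply]
    simp [hG]
  rw [h1, ← Lp.fourier_toTemperedDistribution_eq, TemperedDistribution.fourier_apply,
    Lp.toTemperedDistribution_apply]
  have h2 := VectorFourier.integral_fourierIntegral_smul_eq_flip (μ := (volume : Measure (Euc d)))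
    (ν := (volume : Measure (Euc d))) (L := innerₗ (Euc d)) (f := G) (g := f)
    Real.continuous_fourierChar (by exact continuous_inner) G.integrable hf
  rw [flip_innerₗ] at h2
  have h3 : ∫ x, (𝓕 G) x • (hf2.toLp f) x = ∫ x, (𝓕 G) x • f x := by
    refine integral_congr_ae ?_
    filter_upwards [hf2.coeFn_toLp] with x hx
    rw [hx]
  rw [h3]
  rw [SchwartzMap.fourier_coe]
  refine h2.trans ?_
  simp only [hG]
  rfl

lemma fourierL2_ae_eq {f : Euc d → ℂ} (hf : Integrable f) (hf2 : MemLp f 2 volume) :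
    fourierL2 f =ᵐ[volume] 𝓕 f := by
  rw [fourierL2, dif_pos hf2]
  exact fourier_toLp_ae_eq hf hf2

lemma memLp_fourierIntegral {f : Euc d → ℂ} (hf : Integrable f) (hf2 : MemLp f 2 volume) :
    MemLp (𝓕 f) 2 volume :=
  (memLp_congr_ae (fourier_toLp_ae_eq hf hf2)).1 (Lp.memLp _)

/-- Parseval's identity on `L₁ ∩ L₂`. -/
lemma integral_fourier_mul_conj {f g : Euc d → ℂ} (hf : Integrable f) (hf2 : MemLp f 2 volume)
    (hg : Integrable g) (hg2 : MemLp g 2 volume) :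
    ∫ ξ, 𝓕 f ξ * conj (𝓕 g ξ) = ∫ x, f x * conj (g x) := by
  have h := Lp.inner_fourier_eq (hg2.toLp g) (hf2.toLp f)
  rw [L2.inner_def, L2.inner_def] at h
  simp only [RCLike.inner_apply] at h
  calc ∫ ξ, 𝓕 f ξ * conj (𝓕 g ξ) = _ := ?_
    _ = _ := h
    _ = _ := ?_
  · refine integral_congr_ae ?_
    filter_upwards [fourier_toLp_ae_eq hf hf2, fourier_toLp_ae_eq hg hg2] with x h1 h2
    rw [h1, h2]
  · refine integral_congr_ae ?_
    filter_upwards [hf2.coeFn_toLp, hg2.coeFn_toLp] with x h1 h2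
    rw [h1, h2]

lemma fourier_shift (f : Euc d → ℂ) (k : Fin d → ℤ) (ξ : Euc d) :
    𝓕 (fun x => f (x - latticePoint k)) ξ = conj (latticeChar k ξ) * 𝓕 f ξ := by
  have h := congrFun (VectorFourier.fourierIntegral_comp_add_right Real.fourierChar
    (volume : Measure (Euc d)) (innerₗ (Euc d)) f (-latticePoint k)) ξ
  refine Eq.trans ?_ (h.trans ?_)
  · rfl
  · simp only [innerₗ_apply_apply, inner_neg_left, latticeChar, Circle.smul_def, smul_eq_mul,
      AddChar.map_neg_eq_inv, Circle.coe_inv_eq_conj]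
    rfl

/-- The symbol of the semi-discrete convolution with `b`. -/
noncomputable def symbol (b : (Fin d → ℤ) → ℂ) (ξ : Euc d) : ℂ :=
  ∑' k, b k * conj (latticeChar k ξ)

lemma symbol_add (b : (Fin d → ℤ) → ℂ) (ξ : Euc d) (l : Fin d → ℤ) :
    symbol b (ξ + latticePoint l) = symbol b ξ := by
  simp [symbol, latticeChar_add]

lemma fourier_semiConv {φ : Euc d → ℂ} (hφ : Integrable φ) {b : (Fin d → ℤ) → ℂ}
    (hb : ∑' k, ‖b k‖ₑ ≠ ∞) (ξ : Euc d) :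
    𝓕 (semiConv b φ) ξ = symbol b ξ * 𝓕 φ ξ := by
  have hF : ∀ (f : Euc d → ℂ), 𝓕 f ξ = ∫ v, Real.fourierChar (-inner ℝ v ξ) • f v :=
    fun f => Real.fourier_eq f ξ
  have hterm : ∀ k, ∫ v, Real.fourierChar (-inner ℝ v ξ) • (b k * φ (v - latticePoint k)) =
      b k * conj (latticeChar k ξ) * 𝓕 φ ξ := fun k => by
    rw [mul_assoc, ← fourier_shift, hF, ← integral_const_mul]
    refine integral_congr_ae (.of_forall fun v => ?_)
    simp only [Circle.smul_def, smul_eq_mul]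
    ring
  have hchar : Continuous fun v : Euc d => Real.fourierChar (-inner ℝ v ξ) :=
    Real.continuous_fourierChar.comp (by fun_prop)
  rw [symbol, ← tsum_mul_right, hF]
  simp_rw [← hterm]
  rw [← integral_tsum]
  · refine integral_congr_ae (.of_forall fun v => ?_)
    simp only [semiConv, Circle.smul_def]
    exact tsum_mul_left.symm
  · intro k
    refine hchar.aestronglyMeasurable.smul ?_
    exact ((aestronglyMeasurable_shift hφ.1 _)).const_mul _
  · have : ∀ k, ∫⁻ v, ‖Real.fourierChar (-inner ℝ v ξ) • (b k * φ (v - latticePoint k))‖ₑ =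
        ‖b k‖ₑ * ∫⁻ v, ‖φ v‖ₑ := fun k => by
      rw [← lintegral_sub_right_eq_self (fun v => ‖φ v‖ₑ) (latticePoint k),
        ← lintegral_const_mul' _ _ (by simp)]
      refine lintegral_congr fun v => ?_
      rw [Circle.smul_def, smul_eq_mul, enorm_mul, enorm_mul, ← ofReal_norm ((_ : Circle) : ℂ),
        Circle.norm_coe, ENNReal.ofReal_one, one_mul]
    simp_rw [this]
    rw [ENNReal.tsum_mul_right]
    exact ENNReal.mul_ne_top hb hφ.2.ne

/-- The dual symbol of `φ` is the Fourier transform of the biorthogonal semi-discrete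
convolution of `φ`. -/
lemma dualSymbol_ae_eq {φ : Euc d → ℂ} (hφ : Integrable φ) (hφ2 : MemLp φ 2 volume)
    {b : (Fin d → ℤ) → ℂ} (hb : ∑' k, ‖b k‖ₑ ≠ ∞) (hψ : Integrable (semiConv b φ))
    (hψ2 : MemLp (semiConv b φ) 2 volume)
    (hdual : ∀ k l, ∫ x, φ (x - latticePoint k) * conj (semiConv b φ (x - latticePoint l)) =
      Pi.single (M := fun _ => ℂ) l 1 k) :
    dualSymbol φ =ᵐ[volume] 𝓕 (semiConv b φ) := by
  set G : Euc d → ℂ := fun ξ => 𝓕 φ ξ * conj (𝓕 (semiConv b φ) ξ) with hGdef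
  have hGint : Integrable G := by
    have h1 := memLp_fourierIntegral hφ hφ2
    have h2 : MemLp (fun ξ => conj (𝓕 (semiConv b φ) ξ)) 2 volume :=
      (memLp_fourierIntegral hψ hψ2).star
    exact h1.integrable_mul h2
  set F : Euc d → ℂ := fun ξ => ∑' k, G (ξ + latticePoint k) with hFdef
  -- Unfolded, the Fourier coefficient is an integral of `φ̂` against the conjugate transform of
  -- `ψ(· - n)`; Parseval and biorthogonality evaluate it.
  have hcoef : ∀ n, ∫ x in unitCube d, latticeChar n x * F x =
      Pi.single (M := fun _ => ℂ) 0 1 n := by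
    intro n
    have hint : Integrable fun ξ => latticeChar n ξ * G ξ :=
      hGint.bdd_mul (c := 1) (continuous_latticeChar n).aestronglyMeasurable
        (.of_forall fun ξ => (norm_latticeChar n ξ).le)
    have h1 := integral_unitCube_tsum hint
    simp_rw [latticeChar_add, tsum_mul_left] at h1
    refine h1.trans ?_
    have h2 := integral_fourier_mul_conj hφ hφ2 (hψ.comp_sub_right (latticePoint n))
      (memLp_shift hψ2 (latticePoint n))
    simp_rw [fourier_shift] at h2
    have h3 := hdual 0 n
    simp only [latticePoint_zero, sub_zero] at h3
    rw [h3] at h2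
    calc ∫ ξ, latticeChar n ξ * G ξ = _ := by
          refine integral_congr_ae (.of_forall fun ξ => ?_)
          simp only [hGdef, map_mul, Complex.conj_conj]
          ring_nf
      _ = _ := h2
      _ = _ := by
          simp only [Pi.single_apply, eq_comm]
  have hF1 := ae_eq_one_of_fourierCoeff (integrableOn_periodization hGint) hcoef
  have hF2 : ∀ᵐ ξ : Euc d, F ξ = 1 := by
    refine ae_of_ae_unitCube hF1 fun x k hx => ?_
    rw [← hx, hFdef]
    simp only
    rw [← (Equiv.addLeft k).tsum_eq]
    refine tsum_congr fun l => ?_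
    rw [Equiv.coe_addLeft, latticePoint_add, add_assoc]
  have hFT : ∀ᵐ ξ : Euc d, ∀ k, fourierL2 φ (ξ + latticePoint k) = 𝓕 φ (ξ + latticePoint k) :=
    ae_all_iff.2 fun k =>
      (measurePreserving_add_right volume (latticePoint k)).quasiMeasurePreserving.ae
        (fourierL2_ae_eq hφ hφ2)
  filter_upwards [hF2, hFT, fourierL2_ae_eq hφ hφ2] with ξ h1 h2 h3
  -- `F` factors because the symbol is periodic. The identity also shows that the denominator of the
  -- dual symbol does not vanish; as that denominator is real, conjugation then gives the symbol
  -- itself.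
  have hS : conj (symbol b ξ) *
      ((∑' k : Fin d → ℤ, ‖fourierL2 φ (ξ + latticePoint k)‖ ^ 2 : ℝ) : ℂ) = 1 := by
    rw [← h1, hFdef, Complex.ofReal_tsum, ← tsum_mul_left]
    refine tsum_congr fun k => ?_
    simp only [hGdef]
    rw [h2 k, fourier_semiConv hφ hb, symbol_add, map_mul]
    push_cast
    rw [← Complex.mul_conj']
    ring
  have hS' := congrArg conj hS
  rw [map_mul, Complex.conj_conj, Complex.conj_ofReal, map_one] at hS'
  rw [dualSymbol, fourier_semiConv hφ hb, h3, div_eq_iff (right_ne_zero_of_mul_eq_one hS'),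
    mul_right_comm, hS', one_mul]

lemma memLp_dualSymbol_of_ae_eq {φ ψ : Euc d → ℂ} (hψ : Integrable ψ) (hψ2 : MemLp ψ 2 volume)
    (h : dualSymbol φ =ᵐ[volume] 𝓕 ψ) : MemLp (dualSymbol φ) 2 volume :=
  (memLp_congr_ae h).2 (memLp_fourierIntegral hψ hψ2)

lemma dualKernel_ae_eq_of_dualSymbol_ae_eq {φ ψ : Euc d → ℂ} (hψ : Integrable ψ)
    (hψ2 : MemLp ψ 2 volume) (h : dualSymbol φ =ᵐ[volume] 𝓕 ψ) :
    dualKernel φ =ᵐ[volume] ψ := by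
  have hm := memLp_dualSymbol_of_ae_eq hψ hψ2 h
  rw [dualKernel, fourierInvL2, dif_pos hm]
  have : hm.toLp (dualSymbol φ) = (𝓕 (hψ2.toLp ψ) : Lp ℂ 2 (volume : Measure (Euc d))) := by
    refine Lp.ext ?_
    filter_upwards [hm.coeFn_toLp, h, fourier_toLp_ae_eq hψ hψ2] with x h1 h2 h3
    rw [h1, h2, h3]
  rw [this, FourierTransform.fourierInv_fourier_eq]
  exact hψ2.coeFn_toLp

end WeightedShiftInvariant

/-! ### Dilations and sequence norms. -/

namespace WeightedShiftInvariant

variable {d : ℕ}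

lemma quasiMeasurePreserving_smul {h : ℝ} (hh : h ≠ 0) :
    Measure.QuasiMeasurePreserving (fun x : Euc d => h • x) volume volume := by
  refine ⟨by fun_prop, ?_⟩
  rw [Measure.map_addHaar_smul volume hh]
  exact Measure.smul_absolutelyContinuous

/-- The factor by which the dilation `g ↦ g (· / h)` scales the `L_p` norm. -/
noncomputable def dilationFactor (d : ℕ) (p : ℝ≥0∞) (h : ℝ) : ℝ≥0∞ :=
  ENNReal.ofReal |(h⁻¹ ^ d)⁻¹| ^ (1 / p).toReal

lemma dilationFactor_ne_zero {h : ℝ} (hh : h ≠ 0) (p : ℝ≥0∞) : dilationFactor d p h ≠ 0 := by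
  have : 0 < |(h⁻¹ ^ d)⁻¹| := by positivity
  exact (ENNReal.rpow_pos (ENNReal.ofReal_pos.2 this) ENNReal.ofReal_ne_top).ne'

lemma dilationFactor_ne_top (p : ℝ≥0∞) (h : ℝ) : dilationFactor d p h ≠ ∞ :=
  ENNReal.rpow_ne_top_of_nonneg ENNReal.toReal_nonneg ENNReal.ofReal_ne_top

lemma eLpNorm_comp_inv_smul {h : ℝ} (hh : h ≠ 0) {g : Euc d → ℝ≥0∞} (hg : AEMeasurable g volume)
    (p : ℝ≥0∞) :
    eLpNorm (fun x => g (h⁻¹ • x)) p volume = dilationFactor d p h * eLpNorm g p volume := by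
  have hmap := Measure.map_addHaar_smul (volume : Measure (Euc d)) (inv_ne_zero hh)
  have hpos : 0 < |(h⁻¹ ^ Module.finrank ℝ (Euc d))⁻¹| := by positivity
  have h1 := eLpNorm_map_measure (p := p) (μ := (volume : Measure (Euc d)))
    (f := fun x => h⁻¹ • x) (g := g) (by
      rw [hmap]
      exact (hg.smul_measure _).aestronglyMeasurable) (by fun_prop)
  rw [hmap, eLpNorm_smul_measure_of_ne_zero (ENNReal.ofReal_pos.2 hpos).ne', finrank_euclideanSpace,
    Fintype.card_fin, smul_eq_mul] at h1
  exact h1.symm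

lemma eLpNorm_eq_dilationFactor_mul {h : ℝ} (hh : h ≠ 0) {g : Euc d → ℝ≥0∞}
    (hg : AEMeasurable (fun x => g (h • x)) volume) (p : ℝ≥0∞) :
    eLpNorm g p volume = dilationFactor d p h * eLpNorm (fun x => g (h • x)) p volume := by
  rw [← eLpNorm_comp_inv_smul hh hg]
  simp_rw [smul_inv_smul₀ hh]

lemma ae_lt_top_of_eLpNorm_lt_top {X : Type*} [MeasurableSpace X] {μ : Measure X} {g : X → ℝ≥0∞}
    (hg : AEMeasurable g μ) {p : ℝ≥0∞} (hp : p ≠ 0) (hfin : eLpNorm g p μ < ∞) :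
    ∀ᵐ x ∂μ, g x < ∞ := by
  rcases eq_or_ne p ∞ with rfl | hp'
  · rw [eLpNorm_exponent_top] at hfin
    filter_upwards [enorm_ae_le_eLpNormEssSup g μ] with x hx
    exact lt_of_le_of_lt hx hfin
  · have h1 := lintegral_rpow_enorm_lt_top_of_eLpNorm_lt_top hp hp' hfin
    filter_upwards [ae_lt_top' (hg.enorm.pow_const _) h1.ne] with x hx
    exact (ENNReal.rpow_lt_top_iff_of_pos (ENNReal.toReal_pos hp hp')).1 hx

lemma memℓp_iff_eLpNorm_count {ι : Type*} [MeasurableSpace ι] [MeasurableSingletonClass ι]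
    {p : ℝ≥0∞} (hp : p ≠ 0) (c : ι → ℂ) : Memℓp c p ↔ eLpNorm c p Measure.count < ∞ := by
  rcases eq_or_ne p ∞ with rfl | hp'
  · rw [memℓp_infty_iff, eLpNorm_exponent_top, eLpNormEssSup_count]
    constructor
    · rintro ⟨C, hC⟩
      refine lt_of_le_of_lt (iSup_le fun i => ?_) (ENNReal.ofReal_lt_top (r := C))
      rw [← ofReal_norm]
      exact ENNReal.ofReal_le_ofReal (hC ⟨i, rfl⟩)
    · intro h
      refine ⟨(⨆ i, ‖c i‖ₑ).toReal, ?_⟩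
      rintro _ ⟨i, rfl⟩
      refine (toReal_enorm (c i)).symm.trans_le ?_
      exact ENNReal.toReal_mono h.ne (le_iSup (fun i => ‖c i‖ₑ) i)
  · have hpos := ENNReal.toReal_pos hp hp'
    rw [memℓp_gen_iff hpos, eLpNorm_lt_top_iff_lintegral_rpow_enorm_lt_top hp hp',
      lintegral_count, lt_top_iff_ne_top, ← summable_norm_iff, ← tsum_enorm_ne_top_iff_summable_norm]
    have : ∀ i, ‖‖c i‖ ^ p.toReal‖ₑ = ‖c i‖ₑ ^ p.toReal := fun i => by
      rw [Real.enorm_rpow_of_nonneg (norm_nonneg _) hpos.le, enorm_norm]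
    simp_rw [this]

end WeightedShiftInvariant

/-! ### Synthesis at scale `h`. -/

namespace WeightedShiftInvariant

variable {d : ℕ}

lemma eweight_neg_smul_le {α : ℝ} (hα : 0 ≤ α) {h : ℝ} (hh : h ≠ 0) (x : Euc d) :
    eweight (-α) (h • x) ≤ ENNReal.ofReal (max 1 |h⁻¹| ^ α) * eweight (-α) x := by
  have hC : 0 ≤ max 1 |h⁻¹| ^ α := by positivity
  rw [eweight, eweight, ← ENNReal.ofReal_mul hC]
  refine ENNReal.ofReal_le_ofReal ?_
  have h1 := weight_smul_le hα h⁻¹ (h • x)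
  rw [inv_smul_smul₀ hh] at h1
  rw [weight_neg_exponent, weight_neg_exponent, ← div_eq_mul_inv, le_div_iff₀ (weight_pos _ _),
    ← div_eq_inv_mul, div_le_iff₀ (weight_pos _ _)]
  exact h1

lemma eweight_neg_le_smul {α : ℝ} (hα : 0 ≤ α) {h : ℝ} (hh : h ≠ 0) (x : Euc d) :
    eweight (-α) x ≤ ENNReal.ofReal (max 1 |h| ^ α) * eweight (-α) (h • x) := by
  have := eweight_neg_smul_le hα (inv_ne_zero hh) (h • x)
  rwa [inv_smul_smul₀ hh, inv_inv] at this

/-- The norm of `ℓ_{p,-α}` with the weight sampled on the dilated lattice `hℤᵈ`. -/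
noncomputable def seqNorm (p : ℝ≥0∞) (α h : ℝ) (c : (Fin d → ℤ) → ℂ) : ℝ≥0∞ :=
  eLpNorm (fun k => eweight (-α) (h • latticePoint k) * ‖c k‖ₑ) p Measure.count

/-- For fixed `h` the weights on `ℤᵈ` and `hℤᵈ` are comparable. The constants may degenerate as `h →
0`, so this serves for membership only; uniform estimates use `seqNorm` directly. -/
lemma memWeightedSeq_iff {α : ℝ} (hα : 0 ≤ α) {h : ℝ} (hh : h ≠ 0) {p : ℝ≥0∞} (hp : p ≠ 0)
    (c : (Fin d → ℤ) → ℂ) : MemWeightedSeq p (-α) c ↔ seqNorm p α h c < ∞ := by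
  have h1 : eLpNorm (fun k => (weight (-α) (latticePoint k) : ℂ) * c k) p Measure.count =
      eLpNorm (fun k => eweight (-α) (latticePoint k) * ‖c k‖ₑ) p Measure.count := by
    rw [← eLpNorm_enorm]
    simp_rw [enorm_weight_mul]
  rw [MemWeightedSeq, memℓp_iff_eLpNorm_count hp, h1, seqNorm]
  constructor <;> intro hfin
  · refine lt_of_le_of_lt (eLpNorm_le_const_mul (C := ENNReal.ofReal (max 1 |h⁻¹| ^ α))
      ENNReal.ofReal_ne_top (fun k => ?_) p) (ENNReal.mul_lt_top ENNReal.ofReal_lt_top hfin)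
    rw [enorm_eq_self, enorm_eq_self, ← mul_assoc]
    gcongr
    exact eweight_neg_smul_le hα hh _
  · refine lt_of_le_of_lt (eLpNorm_le_const_mul (C := ENNReal.ofReal (max 1 |h| ^ α))
      ENNReal.ofReal_ne_top (fun k => ?_) p) (ENNReal.mul_lt_top ENNReal.ofReal_lt_top hfin)
    rw [enorm_eq_self, enorm_eq_self, ← mul_assoc]
    gcongr
    exact eweight_neg_le_smul hα hh _

lemma WeightedLp.enorm_def {p : ℝ≥0∞} [Fact (1 ≤ p)] {α : ℝ} (f : WeightedLp d p α) :
    ‖f‖ₑ = eLpNorm (fun x => eweight α x * ‖f.1 x‖ₑ) p volume := by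
  have h1 : ‖f‖ₑ = ‖WeightedLp.mulWeight d p α f‖ₑ := rfl
  have h2 : ‖WeightedLp.mulWeight d p α f‖ₑ =
      eLpNorm (fun x => (weight α x : ℂ) * f.1 x) p volume := Lp.enorm_toLp (WeightedLp.memLp f)
  rw [h1, h2, ← eLpNorm_enorm]
  simp_rw [enorm_weight_mul]

lemma mem_weightedLp_of_eLpNorm_lt_top {p : ℝ≥0∞} {α : ℝ} {f : Euc d →ₘ[volume] ℂ}
    (hf : eLpNorm (fun x => eweight α x * ‖f x‖ₑ) p volume < ∞) : f ∈ WeightedLp d p α := by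
  refine ⟨(Complex.continuous_ofReal.comp (continuous_weight α)).aestronglyMeasurable.mul
    f.aestronglyMeasurable, ?_⟩
  rw [← eLpNorm_enorm]
  simpa only [enorm_weight_mul] using hf

/-- The pointwise sum of the absolute values of the terms of an expansion. -/
noncomputable def absSynthesis (φ : Euc d → ℂ) (c : (Fin d → ℤ) → ℂ) (x : Euc d) : ℝ≥0∞ :=
  ∑' k, ‖c k‖ₑ * ‖φ (x - latticePoint k)‖ₑ

lemma aemeasurable_absSynthesis {φ : Euc d → ℂ} (hφ : AEStronglyMeasurable φ volume)
    (c : (Fin d → ℤ) → ℂ) : AEMeasurable (absSynthesis φ c) volume :=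
  AEMeasurable.tsum fun _ => (aestronglyMeasurable_shift hφ _).enorm.const_mul _

lemma tsum_enorm_shiftTerm (φ : Euc d → ℂ) (h : ℝ) (c : (Fin d → ℤ) → ℂ) (x : Euc d) :
    ∑' k, ‖shiftTerm φ h c x k‖ₑ = absSynthesis φ c (h⁻¹ • x) := by
  simp only [shiftTerm, absSynthesis, enorm_mul]

/-- A kernel `φ` together with a biorthogonal kernel `ψ` representing the dual kernel. -/
structure IsDualPair (p p' : ℝ≥0∞) (α : ℝ) (φ ψ : Euc d → ℂ) : Prop where
  aestronglyMeasurable : AEStronglyMeasurable φ volume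
  aestronglyMeasurable_dual : AEStronglyMeasurable ψ volume
  cubeNorm_ne_top : cubeNorm p α φ ≠ ∞
  cubeNorm_dual_ne_top : cubeNorm p' α ψ ≠ ∞
  biorthogonal : ∀ k l, ∫ x, φ (x - latticePoint k) * conj (ψ (x - latticePoint l)) =
    Pi.single (M := fun _ => ℂ) l 1 k
  dualKernel_ae_eq : dualKernel φ =ᵐ[volume] ψ

/-- The bound for the synthesis operator at scale `h`. -/
noncomputable def synthesisConst (p : ℝ≥0∞) (α h : ℝ) (φ : Euc d → ℂ) : ℝ≥0∞ :=
  ENNReal.ofReal (moderateConst α h) * cubeNorm p α φ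

lemma synthesisConst_ne_top {p : ℝ≥0∞} {α : ℝ} {φ : Euc d → ℂ} (hφ : cubeNorm p α φ ≠ ∞) (h : ℝ) :
    synthesisConst p α h φ ≠ ∞ :=
  ENNReal.mul_ne_top ENNReal.ofReal_ne_top hφ

lemma eLpNorm_absSynthesis_le {α : ℝ} (hα : 0 ≤ α) (h : ℝ) {φ : Euc d → ℂ}
    (hφ : AEStronglyMeasurable φ volume) {p : ℝ≥0∞} (hp : 1 ≤ p) (c : (Fin d → ℤ) → ℂ) :
    eLpNorm (fun x => eweight (-α) (h • x) * absSynthesis φ c x) p volume ≤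
      synthesisConst p α h φ * seqNorm p α h c := by
  rw [synthesisConst, mul_assoc]
  exact eLpNorm_synthesis_le hα h hφ hp c

lemma aemeasurable_weighted_absSynthesis (α h : ℝ) {φ : Euc d → ℂ}
    (hφ : AEStronglyMeasurable φ volume) (c : (Fin d → ℤ) → ℂ) :
    AEMeasurable (fun x => eweight (-α) (h • x) * absSynthesis φ c x) volume :=
  ((measurable_eweight _).comp (by fun_prop)).aemeasurable.mul (aemeasurable_absSynthesis hφ c)

lemma eLpNorm_absSynthesis_inv_smul_le {α : ℝ} (hα : 0 ≤ α) {h : ℝ} (hh : h ≠ 0) {φ : Euc d → ℂ}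
    (hφ : AEStronglyMeasurable φ volume) {p : ℝ≥0∞} (hp : 1 ≤ p) (c : (Fin d → ℤ) → ℂ) :
    eLpNorm (fun x => eweight (-α) x * absSynthesis φ c (h⁻¹ • x)) p volume ≤
      dilationFactor d p h * (synthesisConst p α h φ * seqNorm p α h c) := by
  refine le_trans (le_of_eq ?_) (mul_le_mul_right (eLpNorm_absSynthesis_le hα h hφ hp c) _)
  rw [← eLpNorm_comp_inv_smul hh (aemeasurable_weighted_absSynthesis α h hφ c)]
  simp_rw [smul_inv_smul₀ hh]

lemma ae_absSynthesis_lt_top {α : ℝ} (hα : 0 ≤ α) (h : ℝ) {φ : Euc d → ℂ}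
    (hφ : AEStronglyMeasurable φ volume) {p : ℝ≥0∞} (hp : 1 ≤ p) (hfin : cubeNorm p α φ ≠ ∞)
    {c : (Fin d → ℤ) → ℂ} (hc : seqNorm p α h c < ∞) :
    ∀ᵐ x, absSynthesis φ c x < ∞ := by
  have h1 := lt_of_le_of_lt (eLpNorm_absSynthesis_le hα h hφ hp c)
    (ENNReal.mul_lt_top (synthesisConst_ne_top hfin h).lt_top hc)
  filter_upwards [ae_lt_top_of_eLpNorm_lt_top (aemeasurable_weighted_absSynthesis α h hφ c)
    (zero_lt_one.trans_le hp).ne' h1] with x hx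
  by_contra hx'
  rw [not_lt, top_le_iff] at hx'
  rw [hx', ENNReal.mul_top (eweight_ne_zero _ _)] at hx
  exact lt_irrefl _ hx

lemma ae_summable_shiftTerm {α : ℝ} (hα : 0 ≤ α) {h : ℝ} (hh : h ≠ 0) {φ : Euc d → ℂ}
    (hφ : AEStronglyMeasurable φ volume) {p : ℝ≥0∞} (hp : 1 ≤ p) (hfin : cubeNorm p α φ ≠ ∞)
    {c : (Fin d → ℤ) → ℂ} (hc : seqNorm p α h c < ∞) :
    ∀ᵐ x, Summable (shiftTerm φ h c x) := by
  filter_upwards [(quasiMeasurePreserving_smul (inv_ne_zero hh)).ae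
    (ae_absSynthesis_lt_top hα h hφ hp hfin hc)] with x hx
  refine Summable.of_enorm ?_
  rw [tsum_enorm_shiftTerm]
  exact hx.ne

lemma enorm_le_absSynthesis {φ : Euc d → ℂ} {h : ℝ} {c : (Fin d → ℤ) → ℂ} {x : Euc d} {z : ℂ}
    (hz : HasSum (shiftTerm φ h c x) z) : ‖z‖ₑ ≤ absSynthesis φ c (h⁻¹ • x) := by
  rw [← hz.tsum_eq]
  exact enorm_semiConv_le c φ (h⁻¹ • x)

lemma eLpNorm_le_of_hasSum {α : ℝ} (hα : 0 ≤ α) {h : ℝ} (hh : h ≠ 0) {φ : Euc d → ℂ}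
    (hφ : AEStronglyMeasurable φ volume) {p : ℝ≥0∞} (hp : 1 ≤ p) {c : (Fin d → ℤ) → ℂ}
    {f : Euc d → ℂ} (hf : ∀ᵐ x, HasSum (shiftTerm φ h c x) (f x)) :
    eLpNorm (fun x => eweight (-α) x * ‖f x‖ₑ) p volume ≤
      dilationFactor d p h * (synthesisConst p α h φ * seqNorm p α h c) := by
  refine le_trans (eLpNorm_mono_enorm_ae ?_) (eLpNorm_absSynthesis_inv_smul_le hα hh hφ hp c)
  filter_upwards [hf] with x hx
  rw [enorm_eq_self, enorm_eq_self]
  gcongr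
  exact enorm_le_absSynthesis hx

lemma shiftInvariantSpace_le {α : ℝ} (hα : 0 ≤ α) {h : ℝ} (hh : h ≠ 0) {φ : Euc d → ℂ}
    (hφ : AEStronglyMeasurable φ volume) {p : ℝ≥0∞} (hp : 1 ≤ p) (hfin : cubeNorm p α φ ≠ ∞) :
    shiftInvariantSpace φ p (-α) h ≤ WeightedLp d p (-α) := by
  rintro f ⟨c, hc, hf⟩
  rw [memWeightedSeq_iff hα hh (zero_lt_one.trans_le hp).ne'] at hc
  exact mem_weightedLp_of_eLpNorm_lt_top (lt_of_le_of_lt (eLpNorm_le_of_hasSum hα hh hφ hp hf)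
    (ENNReal.mul_lt_top (dilationFactor_ne_top p h).lt_top
      (ENNReal.mul_lt_top (synthesisConst_ne_top hfin h).lt_top hc)))

/-- The weighted norm of the dilated function `x ↦ f (h x)`. -/
lemma dilationFactor_mul_eLpNorm_comp_smul {p : ℝ≥0∞} [Fact (1 ≤ p)] {α h : ℝ} (hh : h ≠ 0)
    (f : WeightedLp d p (-α)) :
    dilationFactor d p h * eLpNorm (fun x => eweight (-α) (h • x) * ‖f.1 (h • x)‖ₑ) p volume =
      ‖f‖ₑ := by
  rw [WeightedLp.enorm_def,
    eLpNorm_eq_dilationFactor_mul (g := fun x => eweight (-α) x * ‖f.1 x‖ₑ) hh]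
  exact ((measurable_eweight _).comp (by fun_prop)).aemeasurable.mul
    (f.1.aestronglyMeasurable.comp_quasiMeasurePreserving (quasiMeasurePreserving_smul hh)).enorm

lemma eLpNorm_comp_smul_lt_top {p : ℝ≥0∞} [Fact (1 ≤ p)] {α h : ℝ} (hh : h ≠ 0)
    (f : WeightedLp d p (-α)) :
    eLpNorm (fun x => eweight (-α) (h • x) * ‖f.1 (h • x)‖ₑ) p volume < ∞ := by
  by_contra hcon
  have h1 := dilationFactor_mul_eLpNorm_comp_smul hh f
  rw [not_lt, top_le_iff] at hcon
  rw [hcon, ENNReal.mul_top (dilationFactor_ne_zero hh p)] at h1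
  exact enorm_ne_top h1.symm

end WeightedShiftInvariant

/-! ### Analysis at scale `h` and the projector. -/

namespace WeightedShiftInvariant

variable {d : ℕ}

/-- The bound for the analysis operator at scale `h`. -/
noncomputable def analysisConst (p' : ℝ≥0∞) (α h : ℝ) (ψ : Euc d → ℂ) : ℝ≥0∞ :=
  ENNReal.ofReal (moderateConst α h) * cubeNorm p' α ψ

lemma eLpNorm_analysis_le' {α : ℝ} (hα : 0 ≤ α) (h : ℝ) {ψ f : Euc d → ℂ}
    (hψ : AEStronglyMeasurable ψ volume) (hf : AEStronglyMeasurable f volume) {p p' : ℝ≥0∞}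
    (hpp' : p⁻¹ + p'⁻¹ = 1) (hfin : cubeNorm p' α ψ ≠ ∞) :
    eLpNorm (fun k => eweight (-α) (h • latticePoint k) *
      ∫⁻ x, ‖f x‖ₑ * ‖ψ (x - latticePoint k)‖ₑ) p Measure.count ≤
      analysisConst p' α h ψ * eLpNorm (fun x => eweight (-α) (h • x) * ‖f x‖ₑ) p volume := by
  rw [analysisConst, mul_assoc]
  exact eLpNorm_analysis_le hα h hψ hf hpp' hfin

lemma lintegral_enorm_mul_shift_ne_top {α : ℝ} (hα : 0 ≤ α) (h : ℝ) {ψ f : Euc d → ℂ}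
    (hψ : AEStronglyMeasurable ψ volume) (hf : AEStronglyMeasurable f volume) {p p' : ℝ≥0∞}
    (hp : p ≠ 0) (hpp' : p⁻¹ + p'⁻¹ = 1) (hfin : cubeNorm p' α ψ ≠ ∞)
    (hffin : eLpNorm (fun x => eweight (-α) (h • x) * ‖f x‖ₑ) p volume < ∞) (k : Fin d → ℤ) :
    ∫⁻ x, ‖f x‖ₑ * ‖ψ (x - latticePoint k)‖ₑ ≠ ∞ := by
  have h1 := lt_of_le_of_lt (eLpNorm_analysis_le' hα h hψ hf hpp' hfin)
    (ENNReal.mul_lt_top (ENNReal.mul_ne_top ENNReal.ofReal_ne_top hfin).lt_top hffin)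
  have h2 := lt_of_le_of_lt (enorm_le_eLpNorm_count (fun k => eweight (-α) (h • latticePoint k) *
      ∫⁻ x, ‖f x‖ₑ * ‖ψ (x - latticePoint k)‖ₑ) k hp) h1
  rw [enorm_eq_self] at h2
  intro hcon
  rw [hcon, ENNReal.mul_top (eweight_ne_zero _ _)] at h2
  exact lt_irrefl _ h2

lemma dualKernel_shift_ae_eq {φ ψ : Euc d → ℂ} (hφψ : dualKernel φ =ᵐ[volume] ψ)
    (k : Fin d → ℤ) :
    ∀ᵐ x, dualKernel φ (x - latticePoint k) = ψ (x - latticePoint k) :=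
  (measurePreserving_sub_right volume (latticePoint k)).quasiMeasurePreserving.ae hφψ

lemma coeffIntegrand_eq {φ : Euc d → ℂ} {h : ℝ} (hh : h ≠ 0) (f : Euc d → ℂ) (k : Fin d → ℤ) :
    coeffIntegrand φ h f k = fun y =>
      (fun x => f (h • x) * conj (dualKernel φ (x - latticePoint k))) (h⁻¹ • y) := by
  funext y
  simp only [coeffIntegrand, smul_inv_smul₀ hh]

/-- The substitution `y = h x` absorbs `h⁻ᵈ`, reducing to scale one with `f` replaced by `f(h ·)`.
-/
lemma projCoeff_eq {φ ψ : Euc d → ℂ} (hφψ : dualKernel φ =ᵐ[volume] ψ) {h : ℝ} (hh : 0 < h)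
    (f : Euc d → ℂ) (k : Fin d → ℤ) :
    projCoeff φ h f k = ∫ x, f (h • x) * conj (ψ (x - latticePoint k)) := by
  rw [projCoeff, coeffIntegrand_eq hh.ne', Measure.integral_comp_inv_smul, finrank_euclideanSpace,
    Fintype.card_fin, abs_of_pos (by positivity), Complex.real_smul, ← mul_assoc,
    ← Complex.ofReal_mul, inv_mul_cancel₀ (by positivity), Complex.ofReal_one, one_mul]
  refine integral_congr_ae ?_
  filter_upwards [dualKernel_shift_ae_eq hφψ k] with x hx
  rw [hx]

namespace IsDualPair

variable {p p' : ℝ≥0∞} [Fact (1 ≤ p)] {α h : ℝ} {φ ψ : Euc d → ℂ}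

lemma aestronglyMeasurable_comp_smul (hh : h ≠ 0) (f : Euc d →ₘ[volume] ℂ) :
    AEStronglyMeasurable (fun x => f (h • x)) volume :=
  f.aestronglyMeasurable.comp_quasiMeasurePreserving (quasiMeasurePreserving_smul hh)

lemma integrable_coeffIntegrand (hD : IsDualPair p p' α φ ψ) (hα : 0 ≤ α)
    (hpp' : p⁻¹ + p'⁻¹ = 1) (hh : h ≠ 0) (f : WeightedLp d p (-α)) (k : Fin d → ℤ) :
    Integrable (coeffIntegrand φ h f.1 k) volume := by
  have hm := aestronglyMeasurable_comp_smul hh f.1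
  have hψ := hD.aestronglyMeasurable_dual
  have h1 : Integrable (fun x => f.1 (h • x) * conj (ψ (x - latticePoint k))) volume := by
    refine ⟨hm.mul (aestronglyMeasurable_shift hψ _).star, ?_⟩
    rw [HasFiniteIntegral, lt_top_iff_ne_top]
    simp_rw [enorm_mul, RCLike.enorm_conj]
    exact lintegral_enorm_mul_shift_ne_top hα h hψ hm (zero_lt_one.trans_le Fact.out).ne' hpp'
      hD.cubeNorm_dual_ne_top (eLpNorm_comp_smul_lt_top hh f) k
  have h2 : Integrable (fun x => f.1 (h • x) * conj (dualKernel φ (x - latticePoint k)))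
      volume := by
    refine h1.congr ?_
    filter_upwards [dualKernel_shift_ae_eq hD.dualKernel_ae_eq k] with x hx
    rw [hx]
  rw [coeffIntegrand_eq hh]
  exact h2.comp_smul (inv_ne_zero hh)

omit [Fact (1 ≤ p)] in
lemma seqNorm_projCoeff_le (hD : IsDualPair p p' α φ ψ) (hα : 0 ≤ α)
    (hpp' : p⁻¹ + p'⁻¹ = 1) (hh : 0 < h) (f : WeightedLp d p (-α)) :
    seqNorm p α h (projCoeff φ h f.1) ≤ analysisConst p' α h ψ *
      eLpNorm (fun x => eweight (-α) (h • x) * ‖f.1 (h • x)‖ₑ) p volume := by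
  refine le_trans (eLpNorm_mono_enorm fun k => ?_) (eLpNorm_analysis_le' hα h
    hD.aestronglyMeasurable_dual (aestronglyMeasurable_comp_smul hh.ne' f.1) hpp'
    hD.cubeNorm_dual_ne_top)
  rw [enorm_eq_self, enorm_eq_self, projCoeff_eq hD.dualKernel_ae_eq hh]
  gcongr
  refine (enorm_integral_le_lintegral_enorm _).trans (le_of_eq ?_)
  simp_rw [enorm_mul, RCLike.enorm_conj]

lemma seqNorm_projCoeff_lt_top (hD : IsDualPair p p' α φ ψ) (hα : 0 ≤ α)
    (hpp' : p⁻¹ + p'⁻¹ = 1) (hh : 0 < h) (f : WeightedLp d p (-α)) :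
    seqNorm p α h (projCoeff φ h f.1) < ∞ :=
  lt_of_le_of_lt (hD.seqNorm_projCoeff_le hα hpp' hh f) (ENNReal.mul_lt_top
    (ENNReal.mul_ne_top ENNReal.ofReal_ne_top hD.cubeNorm_dual_ne_top).lt_top
    (eLpNorm_comp_smul_lt_top hh.ne' f))

lemma ae_summable_projection (hD : IsDualPair p p' α φ ψ) (hα : 0 ≤ α)
    (hpp' : p⁻¹ + p'⁻¹ = 1) (hh : 0 < h) (f : WeightedLp d p (-α)) :
    ∀ᵐ x, Summable (shiftTerm φ h (projCoeff φ h f.1) x) :=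
  ae_summable_shiftTerm hα hh.ne' hD.aestronglyMeasurable Fact.out hD.cubeNorm_ne_top
    (hD.seqNorm_projCoeff_lt_top hα hpp' hh f)

lemma enorm_le_of_hasSum (hD : IsDualPair p p' α φ ψ) (hα : 0 ≤ α)
    (hpp' : p⁻¹ + p'⁻¹ = 1) (hh : 0 < h) (f : WeightedLp d p (-α)) {g : Euc d → ℂ}
    (hg : ∀ᵐ x, HasSum (shiftTerm φ h (projCoeff φ h f.1) x) (g x)) :
    eLpNorm (fun x => eweight (-α) x * ‖g x‖ₑ) p volume ≤
      synthesisConst p α h φ * analysisConst p' α h ψ * ‖f‖ₑ := by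
  refine (eLpNorm_le_of_hasSum hα hh.ne' hD.aestronglyMeasurable Fact.out hg).trans ?_
  -- The factor produced by dilating the output is the one relating `f(h ·)` to `f`, so `h` survives
  -- only in the moderateness constants.
  rw [← dilationFactor_mul_eLpNorm_comp_smul hh.ne' f]
  calc _ ≤ dilationFactor d p h * (synthesisConst p α h φ * (analysisConst p' α h ψ *
        eLpNorm (fun x => eweight (-α) (h • x) * ‖f.1 (h • x)‖ₑ) p volume)) := by
        gcongr
        exact hD.seqNorm_projCoeff_le hα hpp' hh f
    _ = _ := by ring

/-- The coefficient functionals recover the coefficients of an expansion. -/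
lemma projCoeff_of_hasSum (hD : IsDualPair p p' α φ ψ) (hα : 0 ≤ α)
    (hpp' : p⁻¹ + p'⁻¹ = 1) (hh : 0 < h) {c : (Fin d → ℤ) → ℂ} (hc : seqNorm p α h c < ∞)
    {f : Euc d → ℂ} (hf : ∀ᵐ x, HasSum (shiftTerm φ h c x) (f x)) :
    projCoeff φ h f = c := by
  funext l
  have hp : 1 ≤ p := Fact.out
  have hφ := hD.aestronglyMeasurable
  have hS := ae_absSynthesis_lt_top hα h hφ hp hD.cubeNorm_ne_top hc
  -- The analysis bound, applied to the sum of the moduli, yields the integrability needed to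
  -- integrate the expansion term by term.
  let F : Euc d → ℂ := fun x => ((absSynthesis φ c x).toReal : ℂ)
  have hFm : AEStronglyMeasurable F volume :=
    (Complex.measurable_ofReal.comp_aemeasurable
      (aemeasurable_absSynthesis hφ c).ennreal_toReal).aestronglyMeasurable
  have hF : ∀ x, ‖F x‖ₑ = ENNReal.ofReal (absSynthesis φ c x).toReal := fun x => by
    rw [← ofReal_norm, Complex.norm_real, Real.norm_of_nonneg ENNReal.toReal_nonneg]
  have hFfin : eLpNorm (fun x => eweight (-α) (h • x) * ‖F x‖ₑ) p volume < ∞ := by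
    refine lt_of_le_of_lt ((eLpNorm_mono_enorm fun x => ?_).trans
      (eLpNorm_absSynthesis_le hα h hφ hp c))
      (ENNReal.mul_lt_top (synthesisConst_ne_top hD.cubeNorm_ne_top h).lt_top hc)
    rw [enorm_eq_self, enorm_eq_self, hF]
    gcongr
    exact ENNReal.ofReal_toReal_le
  have hfin := lintegral_enorm_mul_shift_ne_top hα h hD.aestronglyMeasurable_dual hFm
    (zero_lt_one.trans_le hp).ne' hpp' hD.cubeNorm_dual_ne_top hFfin l
  have hfin' : ∫⁻ x, absSynthesis φ c x * ‖ψ (x - latticePoint l)‖ₑ ≠ ∞ := by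
    refine (lintegral_congr_ae ?_).trans_ne hfin
    filter_upwards [hS] with x hx
    rw [hF, ENNReal.ofReal_toReal hx.ne]
  rw [projCoeff_eq hD.dualKernel_ae_eq hh,
    ← integral_semiConv_mul_conj hφ hD.aestronglyMeasurable_dual hD.biorthogonal l hfin']
  refine integral_congr_ae ?_
  filter_upwards [(quasiMeasurePreserving_smul hh.ne').ae hf] with x hx
  rw [← hx.tsum_eq]
  simp only [shiftTerm, semiConv, inv_smul_smul₀ hh.ne']

lemma projCoeff_add (hD : IsDualPair p p' α φ ψ) (hα : 0 ≤ α) (hpp' : p⁻¹ + p'⁻¹ = 1) (hh : h ≠ 0)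
    (f g : WeightedLp d p (-α)) :
    projCoeff φ h (f + g).1 = projCoeff φ h f.1 + projCoeff φ h g.1 := by
  funext k
  rw [Pi.add_apply, projCoeff, projCoeff, projCoeff, ← mul_add,
    ← integral_add (hD.integrable_coeffIntegrand hα hpp' hh f k)
      (hD.integrable_coeffIntegrand hα hpp' hh g k)]
  congr 1
  refine integral_congr_ae ?_
  filter_upwards [AEEqFun.coeFn_add f.1 g.1] with x hx
  have h1 : (f + g).1 x = f.1 x + g.1 x := hx
  simp only [coeffIntegrand, h1, add_mul]

omit [Fact (1 ≤ p)] in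
lemma projCoeff_smul (φ : Euc d → ℂ) (h : ℝ) (a : ℂ) (f : WeightedLp d p (-α)) :
    projCoeff φ h (a • f).1 = a • projCoeff φ h f.1 := by
  funext k
  rw [Pi.smul_apply, projCoeff, projCoeff, smul_eq_mul, mul_left_comm,
    ← integral_const_mul a, ← integral_const_mul, ← integral_const_mul]
  refine integral_congr_ae ?_
  filter_upwards [AEEqFun.coeFn_smul a f.1] with x hx
  have h1 : (a • f).1 x = a * f.1 x := hx
  simp only [coeffIntegrand, h1, mul_assoc]

lemma exists_projection (hD : IsDualPair p p' α φ ψ) (hα : 0 ≤ α) (hpp' : p⁻¹ + p'⁻¹ = 1)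
    (hh : 0 < h) : ∃ P : WeightedLp d p (-α) →L[ℂ] WeightedLp d p (-α),
      (∀ f, ∀ᵐ x, HasSum (shiftTerm φ h (projCoeff φ h f.1) x) ((P f).1 x)) ∧
      ∀ f, ‖P f‖ ≤ (synthesisConst p α h φ * analysisConst p' α h ψ).toReal * ‖f‖ := by
  have hm : ∀ f : WeightedLp d p (-α), AEStronglyMeasurable
      (fun x => semiConv (projCoeff φ h f.1) φ (h⁻¹ • x)) volume := fun f =>
    (aestronglyMeasurable_semiConv _ hD.aestronglyMeasurable).comp_quasiMeasurePreserving
      (quasiMeasurePreserving_smul (inv_ne_zero hh.ne'))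
  have hsum : ∀ f : WeightedLp d p (-α), ∀ᵐ x,
      HasSum (shiftTerm φ h (projCoeff φ h f.1) x) (AEEqFun.mk _ (hm f) x) := fun f => by
    filter_upwards [hD.ae_summable_projection hα hpp' hh f, AEEqFun.coeFn_mk _ (hm f)] with x h1 h2
    rw [h2]
    exact h1.hasSum
  have hK : synthesisConst p α h φ * analysisConst p' α h ψ ≠ ∞ :=
    ENNReal.mul_ne_top (synthesisConst_ne_top hD.cubeNorm_ne_top h)
      (ENNReal.mul_ne_top ENNReal.ofReal_ne_top hD.cubeNorm_dual_ne_top)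
  have hbound := fun f => hD.enorm_le_of_hasSum hα hpp' hh f (hsum f)
  let T : WeightedLp d p (-α) → WeightedLp d p (-α) := fun f =>
    ⟨AEEqFun.mk _ (hm f), mem_weightedLp_of_eLpNorm_lt_top
      (lt_of_le_of_lt (hbound f) (ENNReal.mul_lt_top hK.lt_top enorm_lt_top))⟩
  have hT : ∀ f, ∀ᵐ x, HasSum (shiftTerm φ h (projCoeff φ h f.1) x) ((T f).1 x) := hsum
  have hnorm : ∀ f, ‖T f‖ ≤ (synthesisConst p α h φ * analysisConst p' α h ψ).toReal * ‖f‖ := by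
    intro f
    rw [← toReal_enorm (T f), ← toReal_enorm f, ← ENNReal.toReal_mul]
    refine ENNReal.toReal_mono (ENNReal.mul_ne_top hK enorm_ne_top) ?_
    rw [WeightedLp.enorm_def]
    exact hbound f
  let L : WeightedLp d p (-α) →ₗ[ℂ] WeightedLp d p (-α) :=
    { toFun := T
      map_add' := fun f g => by
        refine Subtype.ext (AEEqFun.ext ?_)
        filter_upwards [hT f, hT g, hT (f + g), AEEqFun.coeFn_add (T f).1 (T g).1] with x h1 h2 h3 h4
        rw [hD.projCoeff_add hα hpp' hh.ne'] at h3
        refine h3.unique ?_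
        have h5 : (T f + T g).1 x = (T f).1 x + (T g).1 x := h4
        rw [h5]
        convert h1.add h2 using 2 with k
        simp [shiftTerm, add_mul]
      map_smul' := fun a f => by
        refine Subtype.ext (AEEqFun.ext ?_)
        filter_upwards [hT f, hT (a • f), AEEqFun.coeFn_smul a (T f).1] with x h1 h3 h4
        rw [projCoeff_smul] at h3
        refine h3.unique ?_
        have h5 : (a • T f).1 x = a * (T f).1 x := h4
        rw [RingHom.id_apply, h5]
        have h6 : shiftTerm φ h (a • projCoeff φ h f.1) x =
            fun k => a * shiftTerm φ h (projCoeff φ h f.1) x k := by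
          funext k
          simp only [shiftTerm, Pi.smul_apply, smul_eq_mul, mul_assoc]
        rw [h6]
        exact h1.mul_left a }
  exact ⟨L.mkContinuous _ hnorm, hT, hnorm⟩

lemma isProj (hD : IsDualPair p p' α φ ψ) (hα : 0 ≤ α) (hpp' : p⁻¹ + p'⁻¹ = 1)
    (hh : 0 < h) {P : WeightedLp d p (-α) →L[ℂ] WeightedLp d p (-α)}
    (hP : ∀ f, ∀ᵐ x, HasSum (shiftTerm φ h (projCoeff φ h f.1) x) ((P f).1 x)) :
    LinearMap.IsProj ((shiftInvariantSpace φ p (-α) h).submoduleOf (WeightedLp d p (-α))) P := by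
  have hp : p ≠ 0 := (zero_lt_one.trans_le (Fact.out : 1 ≤ p)).ne'
  constructor
  · intro f
    exact ⟨_, (memWeightedSeq_iff hα hh.ne' hp _).2 (hD.seqNorm_projCoeff_lt_top hα hpp' hh f), hP f⟩
  · rintro f ⟨c, hc, hf⟩
    have h1 := hD.projCoeff_of_hasSum hα hpp' hh ((memWeightedSeq_iff hα hh.ne' hp _).1 hc) hf
    refine Subtype.ext (AEEqFun.ext ?_)
    filter_upwards [hP f, hf] with x h2 h3
    exact HasSum.unique (h1 ▸ h2) h3

end IsDualPair

/-- The image of a projector is its set of fixed points, which is closed by continuity; no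
completeness is involved. -/
lemma isClosed_of_isProj {E : Type*} [NormedAddCommGroup E] [NormedSpace ℂ E] {V : Submodule ℂ E}
    {P : E →L[ℂ] E} (hP : LinearMap.IsProj V P) : IsClosed (V : Set E) := by
  have : (V : Set E) = {f | P f = f} := by
    ext f
    exact ⟨fun hf => hP.map_id f hf, fun hf => hf ▸ hP.map_mem f⟩
  rw [this]
  exact isClosed_eq P.continuous continuous_id

lemma two_le_max_of_inv_add_inv {p p' : ℝ≥0∞} (hpp' : p⁻¹ + p'⁻¹ = 1) : 2 ≤ max p p' := by
  by_contra hcon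
  rw [not_le, max_lt_iff] at hcon
  have h1 := ENNReal.add_lt_add (ENNReal.inv_lt_inv.2 hcon.1) (ENNReal.inv_lt_inv.2 hcon.2)
  rw [hpp', ENNReal.inv_two_add_inv_two] at h1
  exact lt_irrefl _ h1

/-- The dual kernel is a semi-discrete convolution of `φ` with a weighted `ℓ₁` sequence. -/
lemma exists_isDualPair {p p' : ℝ≥0∞} (hpp' : p⁻¹ + p'⁻¹ = 1) {α : ℝ} (hα : 0 ≤ α)
    {φ : Euc d → ℂ} (hφ : MemHybrid (max p p') α φ) (hR : IsRieszBasisOfShifts φ) :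
    MemLp (dualSymbol φ) 2 volume ∧ ∃ ψ, IsDualPair p p' α φ ψ := by
  have h2 := two_le_max_of_inv_add_inv hpp'
  have hc1 := cubeNorm_lt_top hφ (one_le_two.trans h2)
  have hc2 := cubeNorm_lt_top hφ h2
  obtain ⟨b, hb, hab⟩ := exists_autocorr_inverse hα hc2 hR
  have hb' : ∑' k, ‖b k‖ₑ ≠ ∞ := ne_top_of_le_ne_top hb
    (ENNReal.tsum_le_tsum fun k => le_mul_of_one_le_left' (one_le_eweight hα _))
  have hψm := aestronglyMeasurable_semiConv b hφ.1
  -- Used with `r = 1` and `r = 2` for the Fourier argument and with `r = p'` for analysis.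
  have hψc : ∀ {r}, cubeNorm r α φ < ∞ → cubeNorm r α (semiConv b φ) < ∞ := fun hr =>
    cubeNorm_conv_lt_top hα (enorm_semiConv_le b φ) hb hr
  have hψ1 := memLp_one_of_cubeNorm hα hψm (hψc hc1).ne
  have hψ2 := memLp_two_of_cubeNorm hα hψm (hψc hc2).ne
  have hdual := integral_shift_mul_conj_semiConv hR.1 hb' hab
  have hsymb := dualSymbol_ae_eq (memLp_one_of_cubeNorm hα hφ.1 hc1.ne) hR.1 hb' hψ1 hψ2 hdual
  exact ⟨memLp_dualSymbol_of_ae_eq hψ1 hψ2 hsymb, semiConv b φ,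
    { aestronglyMeasurable := hφ.1
      aestronglyMeasurable_dual := hψm
      cubeNorm_ne_top := (cubeNorm_lt_top hφ (le_max_left _ _)).ne
      cubeNorm_dual_ne_top := (hψc (cubeNorm_lt_top hφ (le_max_right _ _))).ne
      biorthogonal := hdual
      dualKernel_ae_eq := dualKernel_ae_eq_of_dualSymbol_ae_eq hψ1 hψ2 hsymb }⟩

lemma moderateConst_eq_of_mem_Ioo (α : ℝ) {h : ℝ} (hh : h ∈ Ioo (0 : ℝ) 1) :
    moderateConst α h = moderateConst α 1 := by
  have h1 : |h| ≤ 1 := by rw [abs_of_pos hh.1]; exact hh.2.le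
  simp [moderateConst, max_eq_left h1]

end WeightedShiftInvariant

open WeightedShiftInvariant in
theorem theorem1 (d : ℕ) (hd : 1 ≤ d) (p p' : ℝ≥0∞) [Fact (1 ≤ p)] (hpp' : p⁻¹ + p'⁻¹ = 1)
    (α : ℝ) (hα : 0 ≤ α) (φ : Euc d → ℂ) (hφ : MemHybrid (max p p') α φ)
    (hR : IsRieszBasisOfShifts φ) :
    -- the dual kernel exists, and all expansions with coefficients in `ℓ_{p,-α}` make sense
    MemLp (dualSymbol φ) 2 volume ∧
    (∀ h : ℝ, 0 < h → ∀ c : (Fin d → ℤ) → ℂ, MemWeightedSeq p (-α) c →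
      ∀ᵐ x, Summable (shiftTerm φ h c x)) ∧
    -- `V_{p,-α,h}(φ)` is a closed subspace of `L_{p,-α}`
    (∀ h : ℝ, 0 < h →
      shiftInvariantSpace φ p (-α) h ≤ WeightedLp d p (-α) ∧
      IsClosed (((shiftInvariantSpace φ p (-α) h).submoduleOf (WeightedLp d p (-α)) :
        Submodule ℂ (WeightedLp d p (-α))) : Set (WeightedLp d p (-α)))) ∧
    -- `P h` is the operator `P_{φ,h}`, given by its series
    ∃ P : ℝ → (WeightedLp d p (-α) →L[ℂ] WeightedLp d p (-α)),
      (∀ h : ℝ, 0 < h → ∀ f : WeightedLp d p (-α),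
        (∀ k, Integrable (coeffIntegrand φ h f.1 k) volume) ∧
        ∀ᵐ x, HasSum (shiftTerm φ h (projCoeff φ h f.1) x) ((P h f).1 x)) ∧
      -- it is a projector onto `V_{p,-α,h}(φ)`
      (∀ h : ℝ, 0 < h → LinearMap.IsProj
        ((shiftInvariantSpace φ p (-α) h).submoduleOf (WeightedLp d p (-α))) (P h)) ∧
      -- with norms bounded uniformly for `h ∈ (0, 1)`
      ∃ C : ℝ, ∀ h ∈ Ioo (0 : ℝ) 1, ∀ f : WeightedLp d p (-α), ‖P h f‖ ≤ C * ‖f‖ := by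
  have hp : 1 ≤ p := Fact.out
  obtain ⟨hsymb, ψ, hD⟩ := exists_isDualPair hpp' hα hφ hR
  have hex := fun (h : ℝ) (hh : 0 < h) => hD.exists_projection hα hpp' hh
  choose P hP hPnorm using hex
  refine ⟨hsymb, fun h hh c hc => ?_, fun h hh => ⟨?_, ?_⟩,
    fun h => if hh : 0 < h then P h hh else 0, fun h hh f => ⟨fun k => ?_, ?_⟩,
    fun h hh => ?_, (synthesisConst p α 1 φ * analysisConst p' α 1 ψ).toReal, fun h hh f => ?_⟩
  · exact ae_summable_shiftTerm hα hh.ne' hφ.1 hp hD.cubeNorm_ne_top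
      ((memWeightedSeq_iff hα hh.ne' (zero_lt_one.trans_le hp).ne' c).1 hc)
  · exact shiftInvariantSpace_le hα hh.ne' hφ.1 hp hD.cubeNorm_ne_top
  · exact isClosed_of_isProj (hD.isProj hα hpp' hh (hP h hh))
  · exact hD.integrable_coeffIntegrand hα hpp' hh.ne' f k
  · simp only [dif_pos hh]
    exact hP h hh f
  · simp only [dif_pos hh]
    exact hD.isProj hα hpp' hh (hP h hh)
  · simp only [dif_pos hh.1]
    have := hPnorm h hh.1 f
    rwa [synthesisConst, analysisConst, moderateConst_eq_of_mem_Ioo α hh] at this
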